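/- Let $r\ge 2$ be an integer. Let $\Sigma_r$ be the set of simple closed $C^r$ curves $\sigma$ in $\mathbb{R}^2$ with positive curvature, parametrized counterclockwise at constant speed by $S^1=\mathbb{R}/\mathbb{Z}$, where two parametrizations that differ by a translation of the parameter are regarded as the same curve. For $0\le k\le r$ the $C^k$ topology on $\Sigma_r$ is the one induced by the distance $$d_k(\sigma,\widetilde\sigma)=\inf_{s_0\in\mathbb{R}}\ \max_{0\le j\le k}\ \sup_{s\in[0,1]}\bigl|\sigma^{(j)}(s+s_0)-\widetilde\sigma^{(j)}(s)\bigr| .$$ Let $M(\sigma)$ be the compact region bounded by $\sigma$. For $x,y\in\mathrm{Int}\,M(\sigma)$, a billiard path from $x$ to $y$ is a polygonal path $P_0P_1\cdots P_{m+1}$ in $M(\sigma)$ $(m\ge 0)$ with $P_0=x$, $P_{m+1}=y$, $P_i\ne P_{i+1}$, whose vertices $P_1,\dots,P_m$ lie on $\sigma$ and at each of which the path is reflected non-tangentially, with angle of incidence equal to angle of reflection. Billiard paths $\gamma_1,\dots,\gamma_n$ from $x$ to $y$ are in general position if (1) no two of them share a vertex; (2) no point occurs more than once as a vertex of the same path;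 (3) no point other than $x$ and $y$ lies on three or more distinct segments of the $n$ paths; (4) none of the paths passes through $x$ or $y$ at a time strictly between its initial and final times. The pair $(x,y)$ is insecure if there is no finite set $B\subset M(\sigma)\setminus\{x,y\}$ such that every billiard path from $x$ to $y$ passes through a point of $B$. Theorem. There exists a dense $G_\delta$ subset $A$ of $\Sigma_r$ in the $C^r$ topology such that for every $\sigma\in A$ there is a dense $G_\delta$ subset $\mathcal{R}(\sigma)$ of $M(\sigma)\times M(\sigma)$ (with the topology induced from $\mathbb{R}^2\times\mathbb{R}^2$), consisting of pairs of distinct interior points of $M(\sigma)$, such that for each $(x,y)\in\mathcal{R}(\sigma)$ and each positive integer $n$ there are $n$ distinct billiard paths in $M(\sigma)$ from $x$ to $y$ that are in general position. In particular, every pair $(x,y)\in\mathcal{R}(\sigma)$ is insecure. Moreover, $A$ may be chosen to be the intersection of countably many subsets of $\Sigma_r$ that are open in the $C^2$ topology and dense in the $C^r$ topology. -/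

import Mathlib

open scoped Topology

noncomputable section

/-- The Euclidean plane. -/
abbrev Plane : Type := EuclideanSpace ℝ (Fin 2)

/-- Counterclockwise rotation by a right angle. -/
def rot90 (v : Plane) : Plane := !₂[-(v 1), v 0]

/-- The set `Σ_r`: simple closed `C^r` curves of positive curvature, parametrized counterclockwise
at constant speed by `ℝ/ℤ` (that is, by a `1`-periodic function on `ℝ`). The left-hand normal
`rot90 σ'` is the inward one for a counterclockwise curve, and the condition `curv_pos` for a simple
closed curve forces the orientation to be counterclockwise. Two parametrizations of the same
curve differ by a translation of the parameter; they are at distance `0` for the distances `ckDist`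
below and are not separated by the topologies `ckTopology`. -/
structure ConvexCurve (r : ℕ) where
  /-- the parametrization -/
  toFun : ℝ → Plane
  contDiff : ContDiff ℝ r toFun
  periodic : Function.Periodic toFun 1
  injOn : Set.InjOn toFun (Set.Ico 0 1)
  const_speed : ∃ c : ℝ, 0 < c ∧ ∀ s, ‖deriv toFun s‖ = c
  curv_pos : ∀ s, 0 < inner ℝ (deriv (deriv toFun) s) (rot90 (deriv toFun s))

namespace ConvexCurve

variable {r : ℕ}

/-- The set of points of the curve. -/
def trace (σ : ConvexCurve r) : Set Plane := Set.range σ.toFun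

/-- The unit tangent vector. -/
def T (σ : ConvexCurve r) (s : ℝ) : Plane := ‖deriv σ.toFun s‖⁻¹ • deriv σ.toFun s

/-- The inward-pointing unit normal vector. -/
def N (σ : ConvexCurve r) (s : ℝ) : Plane := rot90 (σ.T s)

/-- The table `M(σ)`: the compact region bounded by `σ`, i.e. the curve together with the points
whose connected component in the complement of the curve is bounded. -/
def table (σ : ConvexCurve r) : Set Plane :=
  σ.trace ∪ {p | p ∉ σ.trace ∧ Bornology.IsBounded (connectedComponentIn σ.traceᶜ p)}

end ConvexCurve

/-- The `C^k` distance of two maps on `[0,1]`. -/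
def ckDistFun (k : ℕ) (f g : ℝ → Plane) : ℝ :=
  ⨆ j : Fin (k + 1), ⨆ s : Set.Icc (0 : ℝ) 1, ‖iteratedDeriv j f s - iteratedDeriv j g s‖

/-- The geometric `C^k` distance `d_k` of two curves: the infimum, over all starting points
`σ s₀` on the first curve, of the `C^k` distance of the constant speed parametrizations. -/
def ckDist {r : ℕ} (k : ℕ) (σ τ : ConvexCurve r) : ℝ :=
  ⨅ s₀ : ℝ, ckDistFun k (fun s => σ.toFun (s + s₀)) τ.toFun

/-- The `C^k` topology on `Σ_r` (for `k ≤ r`): the topology induced by `d_k`. -/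
@[reducible] def ckTopology (r k : ℕ) : TopologicalSpace (ConvexCurve r) where
  IsOpen U := ∀ σ ∈ U, ∃ ε > 0, ∀ τ, ckDist k σ τ < ε → τ ∈ U
  isOpen_univ := fun _ _ => ⟨1, one_pos, fun _ _ => trivial⟩
  isOpen_inter := by
    rintro U V hU hV σ ⟨h1, h2⟩
    obtain ⟨a, ha, hU⟩ := hU σ h1
    obtain ⟨b, hb, hV⟩ := hV σ h2
    exact ⟨min a b, lt_min ha hb, fun τ h =>
      ⟨hU τ (h.trans_le (min_le_left _ _)), hV τ (h.trans_le (min_le_right _ _))⟩⟩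
  isOpen_sUnion := by
    rintro S hS σ ⟨U, hU, hσ⟩
    obtain ⟨ε, hε, h⟩ := hS U hU σ hσ
    exact ⟨ε, hε, fun τ hτ => ⟨U, hU, h τ hτ⟩⟩

/-- The unit vector pointing from `p` to `q` (for `p ≠ q`). -/
def unitDir (p q : Plane) : Plane := ‖q - p‖⁻¹ • (q - p)

/-- A billiard path in `M(σ)` from the interior point `x` to the interior point `y`, recorded by
its successive points `P₀ = x, P₁, …, P_m, P_{m+1} = y`: it is traversed at unit speed along the
segments `P_i P_{i+1}`, which lie in the table, and it is reflected at the vertices `P₁, …, P_m` on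
the boundary curve, with angle of incidence equal to the angle of reflection. -/
structure BilliardPath {r : ℕ} (σ : ConvexCurve r) (x y : Plane) where
  /-- the number of vertices -/
  m : ℕ
  /-- the points `P₀, …, P_{m+1}` -/
  pt : Fin (m + 2) → Plane
  start_mem : x ∈ interior σ.table
  end_mem : y ∈ interior σ.table
  pt_zero : pt 0 = x
  pt_last : pt (Fin.last (m + 1)) = y
  pt_ne : ∀ i : Fin (m + 1), pt i.castSucc ≠ pt i.succ
  segment_subset : ∀ i : Fin (m + 1), segment ℝ (pt i.castSucc) (pt i.succ) ⊆ σ.table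
  reflect : ∀ i : Fin m, ∃ s α : ℝ, σ.toFun s = pt i.succ.castSucc ∧ α ∈ Set.Ioo 0 Real.pi ∧
    unitDir (pt i.castSucc.castSucc) (pt i.succ.castSucc)
      = Real.cos α • σ.T s - Real.sin α • σ.N s ∧
    unitDir (pt i.succ.castSucc) (pt i.succ.succ)
      = Real.cos α • σ.T s + Real.sin α • σ.N s

namespace BilliardPath

variable {r : ℕ} {σ : ConvexCurve r} {x y : Plane}

/-- The vertices `P₁, …, P_m`. -/
def vertex (γ : BilliardPath σ x y) (i : Fin γ.m) : Plane := γ.pt i.succ.castSucc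

/-- The segments of the path. -/
def seg (γ : BilliardPath σ x y) (i : Fin (γ.m + 1)) : Set Plane :=
  segment ℝ (γ.pt i.castSucc) (γ.pt i.succ)

/-- The set of all points of the path. -/
def trace (γ : BilliardPath σ x y) : Set Plane := ⋃ i, γ.seg i

/-- The interior points of the path: those passed at a time strictly between the initial and the
final time. -/
def interiorPoints (γ : BilliardPath σ x y) : Set Plane :=
  {z | ∃ (i : Fin (γ.m + 1)) (u : ℝ), u ∈ Set.Icc 0 1 ∧ ¬ (i = 0 ∧ u = 0) ∧
    ¬ (i = Fin.last γ.m ∧ u = 1) ∧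
    z = AffineMap.lineMap (γ.pt i.castSucc) (γ.pt i.succ) u}

end BilliardPath

/-- `n` billiard paths from `x` to `y` are in general position. -/
structure InGeneralPosition {r : ℕ} {σ : ConvexCurve r} {x y : Plane} {n : ℕ}
    (γ : Fin n → BilliardPath σ x y) : Prop where
  /-- no two paths share a vertex -/
  no_shared_vertex : ∀ i j, i ≠ j → ∀ (k : Fin (γ i).m) (l : Fin (γ j).m),
    (γ i).vertex k ≠ (γ j).vertex l
  /-- no point occurs as a vertex of the same path more than once -/
  vertex_injective : ∀ i, Function.Injective (γ i).vertex
  /-- there are no points, other than `x` and `y`, where three or more segments meet -/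
  no_triple : ∀ z, z ≠ x → z ≠ y →
    {p : (i : Fin n) × Fin ((γ i).m + 1) | z ∈ (γ p.1).seg p.2}.encard ≤ 2
  /-- `x` and `y` are not interior points of any of the paths -/
  not_interior : ∀ i, x ∉ (γ i).interiorPoints ∧ y ∉ (γ i).interiorPoints

/-- `B` is a blocking set for the pair `(x, y)`. -/
def IsBlockingSet {r : ℕ} (σ : ConvexCurve r) (x y : Plane) (B : Set Plane) : Prop :=
  B ⊆ σ.table \ {x, y} ∧ ∀ γ : BilliardPath σ x y, (γ.trace ∩ B).Nonempty

/-- The pair `(x, y)` is secure if it has a finite blocking set. -/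
def Secure {r : ℕ} (σ : ConvexCurve r) (x y : Plane) : Prop :=
  ∃ B : Set Plane, B.Finite ∧ IsBlockingSet σ x y B

/-- The pair `(x, y)` is insecure if it has no finite blocking set. -/
def Insecure {r : ℕ} (σ : ConvexCurve r) (x y : Plane) : Prop := ¬ Secure σ x y

end

/-! ### Plane geometry and the turning of the tangent -/

noncomputable section

/-! Among the polygons from `x` to `y` with `m` vertices on the curve there is a longest one, by
compactness. Varying a single vertex shows that it obeys the reflection law (`IsMaxPoly.refl`), so
every `m` yields a billiard path with `m` vertices. The proof takes the longest paths with `1, …, n`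
vertices, shows that for most `(x, y)` they are in general position apart from possible triple
points, and removes the triple points by perturbing the curve. Throughout, positive curvature is
used in the form that the table is convex and touches each tangent line in one point (`table_eq`,
`hull_support`); this rests on the turning of the tangent (`eq_add_int_of_deriv_eq_smul`).

Generic end points. Longest paths are rigid. When `x` is moved backwards along the first segment,
the longest path keeps its vertices and becomes unique (`slide_unique`). Splicing two longest paths
or reversing a loop gives longest paths again, and these must leave every vertex in the direction
forced by reflection. A repeated vertex therefore produces a perpendicular hit (`exists_turn`).
Perpendicular hits are rare by a dimension count: such a path is determined by its foot point and
the lengths of its two last segments, three parameters against four for `(x, y)`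
(`avoidable_perpSet`). Given this, rigidity shows that returns to `x` or `y` and vertices common to
two paths occur only on closed sets of pairs without interior points in the set of interior pairs
(`avoidable_return`, `avoidable_shared`).

Perturbation. The maxima found so far need not be strict, and three segments may meet. Near each
vertex the curve is pushed by a quadratically small amount in a direction in which the length
decreases, which makes the maxima strict. Small affine maps that preserve the derivative of the
length then move the vertices to nearby positions without losing strictness (`exists_deform`). Since
configurations without triple points are dense (`dense_noTriple`), the new positions can be chosen
among them (`exists_robust_of_generic`).

Openness and category. `Robust` records a maximum that is strict against the boundary of a compact
neighbourhood of configurations in general position. It survives uniformly small changes of the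
curve and of the end points (`Robust.stable`), hence the openness in the `C²` topology. Asking for a
robust pair in each set of a countable basis gives countably many open dense sets of curves, and the
Baire property is obtained from a complete space of jets (`ConvexCurve.dense_iInter_of_isOpen`). For
a curve in the intersection, a second Baire argument in the table gives the generic pairs.
Insecurity is the pigeonhole principle: a point other than `x` and `y` lies on at most two of the
paths in general position. -/

lemma rot90_apply_zero (v : Plane) : rot90 v 0 = -(v 1) := rfl

lemma rot90_apply_one (v : Plane) : rot90 v 1 = v 0 := rfl

lemma plane_inner (a b : Plane) : inner ℝ a b = a 0 * b 0 + a 1 * b 1 := by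
  simp [PiLp.inner_apply, Fin.sum_univ_two, mul_comm]

lemma plane_ext {a b : Plane} (h0 : a 0 = b 0) (h1 : a 1 = b 1) : a = b := by
  ext i; fin_cases i
  · exact h0
  · exact h1

lemma plane_norm_sq (a : Plane) : ‖a‖ ^ 2 = a 0 ^ 2 + a 1 ^ 2 := by
  rw [← real_inner_self_eq_norm_sq, plane_inner]; ring

lemma continuous_rot90 : Continuous rot90 := by
  unfold rot90; fun_prop

lemma contDiff_rot90 {n : WithTop ℕ∞} : ContDiff ℝ n rot90 := by
  have : rot90 = fun v : Plane => WithLp.toLp 2 ![-(v 1), v 0] := rfl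
  rw [this, contDiff_euclidean]
  intro i; fin_cases i
  · simp only [Fin.zero_eta, Matrix.cons_val_zero]
    exact (contDiff_piLp_apply (p := 2) (i := (1 : Fin 2))).neg
  · simp only [Fin.mk_one, Matrix.cons_val_one]
    exact contDiff_piLp_apply (p := 2) (i := (0 : Fin 2))

/-- The determinant of two plane vectors. -/
def cross (a b : Plane) : ℝ := a 0 * b 1 - a 1 * b 0

lemma inner_rot90 (a b : Plane) : inner ℝ b (rot90 a) = cross a b := by
  rw [plane_inner, rot90_apply_zero, rot90_apply_one, cross]; ring

lemma rot90_ne_zero {v : Plane} (hv : v ≠ 0) : rot90 v ≠ 0 := by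
  intro h
  apply hv
  have h0 := congrFun (congrArg (fun w : Plane => (w : Fin 2 → ℝ)) h) 0
  have h1 := congrFun (congrArg (fun w : Plane => (w : Fin 2 → ℝ)) h) 1
  simp only [rot90_apply_zero, rot90_apply_one, PiLp.zero_apply] at h0 h1
  exact plane_ext (by simpa using h1) (by simpa using h0)

lemma norm_rot90 (v : Plane) : ‖rot90 v‖ = ‖v‖ := by
  have := plane_norm_sq (rot90 v)
  rw [rot90_apply_zero, rot90_apply_one] at this
  have h2 := plane_norm_sq v
  have : ‖rot90 v‖ ^ 2 = ‖v‖ ^ 2 := by rw [this, h2]; ring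
  exact (sq_eq_sq₀ (norm_nonneg _) (norm_nonneg _)).1 this

/-- The second derivative at a global minimum is nonnegative. -/
lemma nonneg_of_hasDerivAt_of_forall_le {g g' : ℝ → ℝ} {u₀ c : ℝ}
    (hg : ∀ u, HasDerivAt g (g' u) u) (hg' : HasDerivAt g' c u₀) (hmin : ∀ u, g u₀ ≤ g u) :
    0 ≤ c := by
  by_contra! hneg
  have hderiv : deriv g = g' := funext fun u => (hg u).deriv
  have hlm : IsLocalMin g u₀ := Filter.Eventually.of_forall hmin
  -- With a negative second derivative the minimum would also be a local maximum, so `g` would be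
  -- locally constant and the second derivative zero.
  have hmax : IsLocalMax g u₀ := by
    apply isLocalMax_of_deriv_deriv_neg
    · rw [hderiv, hg'.deriv]; exact hneg
    · exact hlm.deriv_eq_zero
    · exact (hg u₀).continuousAt
  have heq : g =ᶠ[𝓝 u₀] fun _ => g u₀ := by
    filter_upwards [hmax] with u hu
    exact le_antisymm hu (hmin u)
  have h1 := heq.deriv.deriv_eq
  rw [hderiv, hg'.deriv] at h1
  simp at h1
  exact hneg.ne h1

/-- Continuous choice of an angle for a nonvanishing plane field on `ℝ × ℝ`. -/
lemma exists_continuous_angle (f : ℝ × ℝ → Plane) (hf : Continuous f) (h0 : ∀ p, f p ≠ 0) :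
    ∃ Θ : ℝ × ℝ → ℝ, Continuous Θ ∧ ∀ p, f p 0 = ‖f p‖ * Real.cos (Θ p) ∧
      f p 1 = ‖f p‖ * Real.sin (Θ p) := by
  have hn : ∀ p, ‖f p‖ ≠ 0 := fun p => norm_ne_zero_iff.2 (h0 p)
  have hz : ∀ p, ‖(⟨f p 0 / ‖f p‖, f p 1 / ‖f p‖⟩ : ℂ)‖ = 1 := by
    intro p
    rw [← sq_eq_sq₀ (norm_nonneg _) zero_le_one, Complex.sq_norm, Complex.normSq_mk]
    have := plane_norm_sq (f p)
    have h := hn p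
    field_simp
    linarith
  let g : C(ℝ × ℝ, Circle) := ⟨fun p => ⟨⟨f p 0 / ‖f p‖, f p 1 / ‖f p‖⟩, mem_sphere_zero_iff_norm.2 (hz p)⟩, by
    refine Continuous.subtype_mk ?_ _
    have h1 : Continuous fun p => ((f p 0 / ‖f p‖ : ℝ), (f p 1 / ‖f p‖ : ℝ)) := by
      refine Continuous.prodMk ?_ ?_ <;> refine Continuous.div ?_ (by fun_prop) hn <;> fun_prop
    exact Complex.equivRealProdCLM.symm.continuous.comp h1⟩
  obtain ⟨e₀, he⟩ := Circle.exp_surjective (g 0)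
  obtain ⟨F, ⟨_, hF⟩, _⟩ := Circle.isCoveringMap_exp.existsUnique_continuousMap_lifts g 0 e₀ he
  refine ⟨F, F.continuous, fun p => ?_⟩
  have h1 : ((Circle.exp (F p) : Circle) : ℂ) = ⟨f p 0 / ‖f p‖, f p 1 / ‖f p‖⟩ :=
    congrArg Subtype.val (congrFun hF p)
  rw [Circle.coe_exp] at h1
  have hre := congrArg Complex.re h1
  have him := congrArg Complex.im h1
  rw [Complex.exp_ofReal_mul_I_re] at hre
  rw [Complex.exp_ofReal_mul_I_im] at him
  rw [hre, him]
  constructor <;> (dsimp only; field_simp [hn p])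

/-- An angle that varies continuously with nonnegative sine stays in the half turn it starts in. -/
lemma angle_mem_Icc_of_sin_nonneg {θ : ℝ → ℝ} (hθ : Continuous θ) {a : ℝ} (ha : θ 0 = a)
    (hs : ∀ u ∈ Set.Icc (0:ℝ) 1, 0 ≤ Real.sin (θ u - a)) : θ 1 ∈ Set.Icc a (a + Real.pi) := by
  have hpi := Real.pi_pos
  constructor
  · by_contra! h
    -- An angle ending below `a` takes a value in `[a - π/2, a)`, where the sine is negative; the
    -- `max` caps the overshoot. The upper bound is symmetric, with `a + 3π/2` as cap.
    obtain ⟨u, hu, hv⟩ := intermediate_value_Icc' (zero_le_one (α := ℝ)) hθ.continuousOn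
      (show max (θ 1) (a - Real.pi / 2) ∈ Set.Icc (θ 1) (θ 0) from
        ⟨le_max_left _ _, by rw [ha]; exact max_le h.le (by linarith)⟩)
    have := hs u hu
    rw [hv] at this
    have h3 : Real.sin (max (θ 1) (a - Real.pi / 2) - a) < 0 := by
      apply Real.sin_neg_of_neg_of_neg_pi_lt
      · have : max (θ 1) (a - Real.pi / 2) < a := max_lt h (by linarith)
        linarith
      · have := le_max_right (θ 1) (a - Real.pi / 2); linarith
    linarith
  · by_contra! h
    obtain ⟨u, hu, hv⟩ := intermediate_value_Icc (zero_le_one (α := ℝ)) hθ.continuousOn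
      (show min (θ 1) (a + 3 * Real.pi / 2) ∈ Set.Icc (θ 0) (θ 1) from
        ⟨by rw [ha]; exact le_min (by linarith) (by linarith), min_le_left _ _⟩)
    have := hs u hu
    rw [hv] at this
    have h3 : Real.sin (min (θ 1) (a + 3 * Real.pi / 2) - a) < 0 := by
      have e1 : min (θ 1) (a + 3 * Real.pi / 2) - a
        = (min (θ 1) (a + 3 * Real.pi / 2) - a - 2 * Real.pi) + 2 * Real.pi := by ring
      rw [e1, Real.sin_add_two_pi]
      apply Real.sin_neg_of_neg_of_neg_pi_lt
      · have := min_le_right (θ 1) (a + 3 * Real.pi / 2); linarith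
      · have : a + Real.pi < min (θ 1) (a + 3 * Real.pi / 2) := lt_min h (by linarith)
        linarith
    linarith

namespace ConvexCurve

variable {r : ℕ}

lemma contDiff_two (σ : ConvexCurve r) (hr : 2 ≤ r) : ContDiff ℝ 2 σ.toFun :=
  σ.contDiff.of_le (by exact_mod_cast hr)

lemma hasDerivAt (σ : ConvexCurve r) (hr : 2 ≤ r) (s : ℝ) :
    HasDerivAt σ.toFun (deriv σ.toFun s) s :=
  ((σ.contDiff_two hr).differentiable (by norm_num) s).hasDerivAt

lemma contDiff_deriv (σ : ConvexCurve r) (hr : 2 ≤ r) : ContDiff ℝ 1 (deriv σ.toFun) :=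
  ((contDiff_succ_iff_deriv (n := 1)).1 (by simpa [one_add_one_eq_two] using σ.contDiff_two hr)).2.2

lemma continuous_deriv (σ : ConvexCurve r) (hr : 2 ≤ r) : Continuous (deriv σ.toFun) :=
  (σ.contDiff_deriv hr).continuous

lemma hasDerivAt_deriv (σ : ConvexCurve r) (hr : 2 ≤ r) (s : ℝ) :
    HasDerivAt (deriv σ.toFun) (deriv (deriv σ.toFun) s) s :=
  ((σ.contDiff_deriv hr).differentiable (by norm_num) s).hasDerivAt

lemma continuous (σ : ConvexCurve r) : Continuous σ.toFun := σ.contDiff.continuous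

lemma deriv_ne_zero (σ : ConvexCurve r) (s : ℝ) : deriv σ.toFun s ≠ 0 := by
  obtain ⟨c, hc, h⟩ := σ.const_speed
  exact norm_ne_zero_iff.1 (by rw [h]; exact hc.ne')

lemma deriv_periodic (σ : ConvexCurve r) : Function.Periodic (deriv σ.toFun) 1 := by
  intro s
  have h : (fun u => σ.toFun (u + 1)) = σ.toFun := funext σ.periodic
  rw [← deriv_comp_add_const, h]

lemma cross_pos (σ : ConvexCurve r) (s : ℝ) :
    0 < cross (deriv σ.toFun s) (deriv (deriv σ.toFun) s) := by
  rw [← inner_rot90]; exact σ.curv_pos s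

/-- The parametrization is injective modulo `1`. -/
lemma eq_add_int (σ : ConvexCurve r) {s t : ℝ} (h : σ.toFun s = σ.toFun t) :
    ∃ k : ℤ, t = s + k := by
  have h1 : σ.toFun (Int.fract s) = σ.toFun (Int.fract t) := by
    have := σ.periodic.sub_int_mul_eq ⌊s⌋ (x := s)
    have h2 := σ.periodic.sub_int_mul_eq ⌊t⌋ (x := t)
    rw [mul_one] at this h2
    rw [Int.fract, Int.fract, this, h2, h]
  have h2 := σ.injOn ⟨Int.fract_nonneg s, Int.fract_lt_one s⟩
    ⟨Int.fract_nonneg t, Int.fract_lt_one t⟩ h1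
  refine ⟨⌊t⌋ - ⌊s⌋, ?_⟩
  rw [Int.fract, Int.fract] at h2
  push_cast; linarith

lemma add_int (σ : ConvexCurve r) (s : ℝ) (k : ℤ) : σ.toFun (s + k) = σ.toFun s := by
  simpa using (σ.periodic.int_mul k) s

lemma deriv_add_int (σ : ConvexCurve r) (s : ℝ) (k : ℤ) :
    deriv σ.toFun (s + k) = deriv σ.toFun s := by
  simpa using (σ.deriv_periodic.int_mul k) s

/-- The average velocity between two parameters. -/
def avg (σ : ConvexCurve r) (s t : ℝ) : Plane :=
  ∫ u in (0:ℝ)..1, deriv σ.toFun (s + u * (t - s))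

lemma continuous_avg (σ : ConvexCurve r) (hr : 2 ≤ r) :
    Continuous fun p : ℝ × ℝ => σ.avg p.1 p.2 := by
  unfold avg
  apply intervalIntegral.continuous_parametric_intervalIntegral_of_continuous'
  exact (σ.continuous_deriv hr).comp (by fun_prop)

lemma avg_self (σ : ConvexCurve r) (s : ℝ) : σ.avg s s = deriv σ.toFun s := by
  simp [avg]

lemma smul_avg (σ : ConvexCurve r) (hr : 2 ≤ r) (s t : ℝ) :
    (t - s) • σ.avg s t = σ.toFun t - σ.toFun s := by
  unfold avg
  have h : ∀ u ∈ Set.uIcc (0:ℝ) 1, HasDerivAt (fun u => σ.toFun (s + u * (t - s)))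
      ((t - s) • deriv σ.toFun (s + u * (t - s))) u := by
    intro u _
    have h1 : HasDerivAt (fun u : ℝ => s + u * (t - s)) (t - s) u := by
      simpa using ((hasDerivAt_id u).mul_const (t - s)).const_add s
    exact HasDerivAt.scomp u (σ.hasDerivAt hr _) h1
  have := intervalIntegral.integral_eq_sub_of_hasDerivAt h
    ((((σ.continuous_deriv hr).comp (by fun_prop : Continuous fun u : ℝ => s + u * (t - s))).const_smul
      (t - s)).intervalIntegrable 0 1)
  rw [intervalIntegral.integral_smul] at this
  simpa using this

/-- A positive multiple of the secant vector from `s` to `s + e` for `0 < e < 1`, extended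
continuously by the tangent vectors for `e = 0` and `e = 1`. -/
def secant (σ : ConvexCurve r) (s e : ℝ) : Plane :=
  (1 - e) • σ.avg s (s + e) - e • σ.avg s (s + e - 1)

lemma secant_zero (σ : ConvexCurve r) (s : ℝ) : σ.secant s 0 = deriv σ.toFun s := by
  simp [secant, avg_self]

lemma secant_one (σ : ConvexCurve r) (s : ℝ) : σ.secant s 1 = -deriv σ.toFun s := by
  simp [secant, avg_self]

/-- The parameters `s + e` and `s + e - 1` give the same point, so both averages are multiples of
the same chord, by `1 / e` and `1 / (e - 1)`. The weights `1 - e` and `-e` make both contributions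
positive. -/
lemma secant_eq (σ : ConvexCurve r) (hr : 2 ≤ r) (s : ℝ) {e : ℝ} (h0 : 0 < e) (h1 : e < 1) :
    ∃ c > 0, σ.secant s e = (c : ℝ) • (σ.toFun (s + e) - σ.toFun s) := by
  have a1 : σ.avg s (s + e) = e⁻¹ • (σ.toFun (s + e) - σ.toFun s) := by
    rw [← σ.smul_avg hr, smul_smul, add_sub_cancel_left, inv_mul_cancel₀ h0.ne', one_smul]
  have a2 : σ.avg s (s + e - 1) = (e - 1)⁻¹ • (σ.toFun (s + e) - σ.toFun s) := by
    have h := σ.smul_avg hr s (s + e - 1)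
    rw [σ.periodic.sub_eq, show s + e - 1 - s = e - 1 by ring] at h
    rw [← h, smul_smul, inv_mul_cancel₀ (by linarith), one_smul]
  refine ⟨(1 - e) * e⁻¹ + e * (1 - e)⁻¹, ?_, ?_⟩
  · have : 0 < 1 - e := by linarith
    positivity
  · rw [secant, a1, a2, smul_smul, smul_smul, ← sub_smul]
    congr 1
    rw [show e - 1 = -(1 - e) by ring, inv_neg]; ring

lemma continuous_secant (σ : ConvexCurve r) (hr : 2 ≤ r) :
    Continuous fun p : ℝ × ℝ => σ.secant p.1 p.2 := by
  unfold secant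
  have h1 : Continuous fun p : ℝ × ℝ => σ.avg p.1 (p.1 + p.2) :=
    (σ.continuous_avg hr).comp (by fun_prop : Continuous fun p : ℝ × ℝ => (p.1, p.1 + p.2))
  have h2 : Continuous fun p : ℝ × ℝ => σ.avg p.1 (p.1 + p.2 - 1) :=
    (σ.continuous_avg hr).comp (by fun_prop : Continuous fun p : ℝ × ℝ => (p.1, p.1 + p.2 - 1))
  fun_prop

/-- This is where simplicity of the curve enters the turning argument: a chord inside one period
does not degenerate. -/
lemma secant_ne_zero (σ : ConvexCurve r) (hr : 2 ≤ r) (s : ℝ) {e : ℝ} (h0 : 0 ≤ e) (h1 : e ≤ 1) :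
    σ.secant s e ≠ 0 := by
  rcases h0.eq_or_lt with rfl | h0
  · rw [secant_zero]; exact σ.deriv_ne_zero s
  rcases h1.eq_or_lt with rfl | h1
  · rw [secant_one]; exact neg_ne_zero.2 (σ.deriv_ne_zero s)
  obtain ⟨c, hc, h⟩ := σ.secant_eq hr s h0 h1
  rw [h]
  refine smul_ne_zero hc.ne' (sub_ne_zero.2 fun h => ?_)
  obtain ⟨k, hk⟩ := σ.eq_add_int h
  have h2 : (k : ℝ) = -e := by linarith
  have h3 : k < 0 := by exact_mod_cast (by linarith : (k : ℝ) < 0)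
  have h4 : -1 < k := by exact_mod_cast (by linarith : (-1 : ℝ) < k)
  omega

/-- Two parameters with the same tangent direction differ by an integer: the tangent of a simple
closed curve of positive curvature turns exactly once. -/
lemma eq_add_int_of_deriv_eq_smul (σ : ConvexCurve r) (hr : 2 ≤ r) {s t c : ℝ} (hc : 0 < c)
    (h : deriv σ.toFun t = c • deriv σ.toFun s) : ∃ k : ℤ, t = s + k := by
  have hpi := Real.pi_pos
  -- Hopf's argument for the rotation index: a continuous angle of the secants interpolates between
  -- tangents. Clamping `e` extends the secant field from a strip to the whole plane, where a global
  -- angle exists.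
  let cl : ℝ → ℝ := fun e => max 0 (min e 1)
  have hcl0 : ∀ e, 0 ≤ cl e := fun e => le_max_left _ _
  have hcl1 : ∀ e, cl e ≤ 1 := fun e => max_le zero_le_one (min_le_right _ _)
  have hclid : ∀ e, 0 ≤ e → e ≤ 1 → cl e = e := fun e h0 h1 => by
    simp only [cl]; rw [min_eq_left h1, max_eq_right h0]
  have hclc : Continuous cl := by fun_prop
  obtain ⟨Θ, hΘ, hf⟩ := exists_continuous_angle (fun p => σ.secant p.1 (cl p.2))
    ((σ.continuous_secant hr).comp (continuous_fst.prodMk (hclc.comp continuous_snd)))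
    (fun p => σ.secant_ne_zero hr _ (hcl0 _) (hcl1 _))
  -- the lowest point of the curve
  obtain ⟨s₀, -, hs₀⟩ := isCompact_Icc.exists_isMinOn (Set.nonempty_Icc.2 (zero_le_one (α := ℝ)))
    (show ContinuousOn (fun u => σ.toFun u 1) (Set.Icc (0:ℝ) 1) from by
      have := σ.continuous; fun_prop)
  have hmin : ∀ u, σ.toFun s₀ 1 ≤ σ.toFun u 1 := by
    intro u
    have h1 := hs₀ (show Int.fract u ∈ Set.Icc (0:ℝ) 1 from
      ⟨Int.fract_nonneg u, (Int.fract_lt_one u).le⟩)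
    have h2 := σ.add_int (Int.fract u) ⌊u⌋
    rw [Int.fract_add_floor] at h2
    rw [h2]; exact h1
  have hcoord : ∀ (g : ℝ → Plane) (g' : Plane) (u : ℝ) (i : Fin 2), HasDerivAt g g' u →
      HasDerivAt (fun v => g v i) (g' i) u := fun g g' u i hg =>
    (EuclideanSpace.proj (𝕜 := ℝ) i).hasFDerivAt.comp_hasDerivAt u hg
  have hd1 : deriv σ.toFun s₀ 1 = 0 := by
    have : IsLocalMin (fun u => σ.toFun u 1) s₀ := Filter.Eventually.of_forall hmin
    exact this.hasDerivAt_eq_zero (hcoord _ _ _ 1 (σ.hasDerivAt hr s₀))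
  have hdd : 0 ≤ deriv (deriv σ.toFun) s₀ 1 :=
    nonneg_of_hasDerivAt_of_forall_le (fun u => hcoord _ _ _ 1 (σ.hasDerivAt hr u))
      (hcoord _ _ _ 1 (σ.hasDerivAt_deriv hr s₀)) hmin
  -- At the lowest point the acceleration does not point downwards, so positive curvature forces the
  -- horizontal tangent to point to the right.
  have hd0 : 0 < deriv σ.toFun s₀ 0 := by
    have := σ.cross_pos s₀
    rw [cross, hd1, zero_mul, sub_zero] at this
    by_contra! hneg
    nlinarith
  set ω : ℝ → ℝ := fun u => Θ (u, 0) with hω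
  have hω0 : ∀ u, deriv σ.toFun u 0 = ‖deriv σ.toFun u‖ * Real.cos (ω u) ∧
      deriv σ.toFun u 1 = ‖deriv σ.toFun u‖ * Real.sin (ω u) := by
    intro u
    have := hf (u, 0)
    dsimp only at this
    rw [hclid 0 le_rfl zero_le_one, secant_zero] at this
    exact this
  have hnpos : ∀ u, 0 < ‖deriv σ.toFun u‖ := fun u => norm_pos_iff.2 (σ.deriv_ne_zero u)
  have hsin0 : Real.sin (ω s₀) = 0 := by
    have := (hω0 s₀).2; rw [hd1] at this
    rcases mul_eq_zero.1 this.symm with h | h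
    · exact absurd h (hnpos s₀).ne'
    · exact h
  have hcos0 : 0 < Real.cos (ω s₀) := by
    have := (hω0 s₀).1; rw [this] at hd0
    exact pos_of_mul_pos_right hd0 (hnpos s₀).le
  have hcos1 : Real.cos (ω s₀) = 1 := by
    have := Real.sin_sq_add_cos_sq (ω s₀)
    rw [hsin0] at this; nlinarith
  have hsub : ∀ x, Real.sin (x - ω s₀) = Real.sin x := fun x => by
    rw [Real.sin_sub, hsin0, hcos1]; ring
  have hsubc : ∀ x, Real.cos (x - ω s₀) = Real.cos x := fun x => by
    rw [Real.cos_sub, hsin0, hcos1]; ring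
  have hcosmem : ∀ x, x ∈ Set.Icc (ω s₀) (ω s₀ + Real.pi) → Real.cos x = -1 →
      x = ω s₀ + Real.pi := by
    intro x hx hcx
    have := Real.injOn_cos (show x - ω s₀ ∈ Set.Icc 0 Real.pi from
      ⟨by linarith [hx.1], by linarith [hx.2]⟩) ⟨hpi.le, le_rfl⟩
      (by rw [hsubc, hcx, Real.cos_pi])
    linarith
  -- the secants from the lowest point turn by a half turn
  have hstep1 : Θ (s₀, 1) = ω s₀ + Real.pi := by
    apply hcosmem
    · refine angle_mem_Icc_of_sin_nonneg (θ := fun u => Θ (s₀, u)) (by fun_prop) rfl ?_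
      intro u hu
      rw [hsub]
      have h1 := (hf (s₀, u)).2
      dsimp only at h1
      rw [hclid u hu.1 hu.2] at h1
      have h2 : 0 ≤ σ.secant s₀ u 1 := by
        rcases hu.1.eq_or_lt with rfl | h0
        · rw [secant_zero, hd1]
        rcases hu.2.eq_or_lt with rfl | h1
        · rw [secant_one, PiLp.neg_apply, hd1, neg_zero]
        obtain ⟨c, hc, h⟩ := σ.secant_eq hr s₀ h0 h1
        rw [h, PiLp.smul_apply, PiLp.sub_apply, smul_eq_mul]
        exact mul_nonneg hc.le (sub_nonneg.2 (hmin _))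
      rw [h1] at h2
      exact nonneg_of_mul_nonneg_right h2 (norm_pos_iff.2 (σ.secant_ne_zero hr _ hu.1 hu.2))
    · have h1 := (hf (s₀, 1)).1
      dsimp only at h1
      rw [hclid 1 zero_le_one le_rfl, secant_one, norm_neg, PiLp.neg_apply, (hω0 s₀).1, hcos1] at h1
      have := hnpos s₀
      nlinarith
  -- and so do the secants to the lowest point
  have hstep2 : ω (s₀ + 1) = ω s₀ + 2 * Real.pi := by
    have h1 : Θ (s₀ + 1, 0) ∈ Set.Icc (ω s₀ + Real.pi) (ω s₀ + Real.pi + Real.pi) := by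
      have := angle_mem_Icc_of_sin_nonneg (θ := fun u => Θ (s₀ + u, 1 - u)) (by fun_prop)
        (a := ω s₀ + Real.pi) (by simpa using hstep1) ?_
      · simpa using this
      intro u hu
      rw [show Θ (s₀ + u, 1 - u) - (ω s₀ + Real.pi) = Θ (s₀ + u, 1 - u) - ω s₀ - Real.pi by ring,
        Real.sin_sub_pi, hsub]
      have h1 := (hf (s₀ + u, 1 - u)).2
      dsimp only at h1
      rw [hclid (1 - u) (by linarith [hu.2]) (by linarith [hu.1])] at h1
      have h2 : σ.secant (s₀ + u) (1 - u) 1 ≤ 0 := by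
        rcases hu.1.eq_or_lt with rfl | h0
        · simp [secant_one, hd1]
        rcases hu.2.eq_or_lt with rfl | h1
        · rw [sub_self, secant_zero, σ.deriv_periodic, hd1]
        obtain ⟨c, hc, h⟩ := σ.secant_eq hr (s₀ + u) (e := 1 - u) (by linarith) (by linarith)
        rw [h, PiLp.smul_apply, PiLp.sub_apply, smul_eq_mul,
          show s₀ + u + (1 - u) = s₀ + 1 by ring, σ.periodic]
        exact mul_nonpos_of_nonneg_of_nonpos hc.le (sub_nonpos.2 (hmin _))
      rw [h1] at h2
      have h3 := norm_pos_iff.2 (σ.secant_ne_zero hr (s₀ + u) (e := 1 - u)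
        (by linarith [hu.2]) (by linarith [hu.1]))
      have : Real.sin (Θ (s₀ + u, 1 - u)) ≤ 0 := by
        by_contra! hh
        exact absurd h2 (not_le.2 (mul_pos h3 hh))
      linarith
    have h2 : Real.cos (ω (s₀ + 1) - Real.pi) = -1 := by
      rw [Real.cos_sub_pi]
      have h3 := (hω0 (s₀ + 1)).1
      rw [σ.deriv_periodic, (hω0 s₀).1, hcos1] at h3
      have := hnpos s₀
      have h4 : Real.cos (ω (s₀ + 1)) = 1 := by
        apply mul_left_cancel₀ this.ne'; linarith
      rw [h4]
    have := hcosmem (ω (s₀ + 1) - Real.pi) ⟨by linarith [h1.1], by linarith [h1.2]⟩ h2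
    linarith
  have hωc : Continuous ω := by rw [hω]; fun_prop
  -- the tangent angle increases
  have hcross : ∀ u v, cross (deriv σ.toFun u) (deriv σ.toFun v)
      = ‖deriv σ.toFun u‖ * ‖deriv σ.toFun v‖ * Real.sin (ω v - ω u) := by
    intro u v
    rw [cross, (hω0 u).1, (hω0 u).2, (hω0 v).1, (hω0 v).2, Real.sin_sub]; ring
  -- The determinant against the tangent at `u` has positive derivative there, and for angle
  -- differences below `π` its sign is that of the difference.
  have hloc : ∀ u, ∀ᶠ v in 𝓝[>] u, ω u < ω v := by
    intro u
    have h1 : HasDerivAt (fun v => cross (deriv σ.toFun u) (deriv σ.toFun v))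
        (cross (deriv σ.toFun u) (deriv (deriv σ.toFun) u)) u := by
      unfold cross
      exact ((hcoord _ _ _ 1 (σ.hasDerivAt_deriv hr u)).const_mul _).sub
        ((hcoord _ _ _ 0 (σ.hasDerivAt_deriv hr u)).const_mul _)
    have h2 : ∀ᶠ v in 𝓝[>] u, 0 < cross (deriv σ.toFun u) (deriv σ.toFun v) := by
      have := h1.hasDerivWithinAt (s := Set.Ioi u)
      have h3 := hasDerivWithinAt_iff_tendsto_slope.1 this
      rw [Set.sdiff_singleton_eq_self (by simp)] at h3
      filter_upwards [h3.eventually_const_lt (σ.cross_pos u), self_mem_nhdsWithin] with v hv huv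
      rw [slope_def_field] at hv
      have h4 : cross (deriv σ.toFun u) (deriv σ.toFun u) = 0 := by rw [cross]; ring
      rw [h4, sub_zero] at hv
      have : 0 < v - u := sub_pos.2 huv
      by_contra! hneg
      exact absurd hv (not_lt.2 (div_nonpos_of_nonpos_of_nonneg hneg this.le))
    have h3 : ∀ᶠ v in 𝓝[>] u, |ω v - ω u| < Real.pi := by
      have : Filter.Tendsto (fun v => |ω v - ω u|) (𝓝 u) (𝓝 |ω u - ω u|) :=
        (Continuous.tendsto (by fun_prop) u)
      rw [sub_self, abs_zero] at this
      exact (this.eventually_lt_const hpi).filter_mono nhdsWithin_le_nhds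
    filter_upwards [h2, h3] with v hv hv'
    rw [hcross] at hv
    have h4 : 0 < Real.sin (ω v - ω u) :=
      pos_of_mul_pos_right hv (by positivity)
    by_contra! h5
    have := Real.sin_nonpos_of_nonpos_of_neg_pi_le (x := ω v - ω u) (by linarith)
      (by linarith [(abs_lt.1 hv').1])
    linarith
  have hmono : ∀ u v, u < v → ω u < ω v := by
    intro u v huv
    have key : ∀ a b, a ≤ b → ω a ≤ ω b := by
      intro a b hab
      have : Set.Icc a b ⊆ {x | ω a ≤ ω x} := by
        apply IsClosed.Icc_subset_of_forall_mem_nhdsWithin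
        · exact (isClosed_le continuous_const hωc).inter isClosed_Icc
        · exact le_refl (ω a)
        · rintro x ⟨hx, -⟩
          filter_upwards [hloc x] with y hy
          exact le_trans hx hy.le
      exact this ⟨hab, le_rfl⟩
    obtain ⟨w, hw, huw, hwv⟩ : ∃ w, ω u < ω w ∧ u < w ∧ w < v := by
      have := (hloc u).and (Ioo_mem_nhdsGT huv)
      obtain ⟨w, hw⟩ := this.exists
      exact ⟨w, hw.1, hw.2.1, hw.2.2⟩
    exact hw.trans_le (key w v hwv.le)
  -- reduce both parameters to one period
  have hred : ∀ u, ∃ k : ℤ, s₀ ≤ u + k ∧ u + k < s₀ + 1 := by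
    intro u
    refine ⟨-⌊u - s₀⌋, ?_, ?_⟩
    · have := Int.floor_le (u - s₀); push_cast; linarith
    · have := Int.lt_floor_add_one (u - s₀); push_cast; linarith
  obtain ⟨k, hk0, hk1⟩ := hred s
  obtain ⟨l, hl0, hl1⟩ := hred t
  rw [← σ.deriv_add_int s k, ← σ.deriv_add_int t l] at h
  have hsin : Real.sin (ω (t + l) - ω (s + k)) = 0 := by
    have h1 := hcross (s + k) (t + l)
    rw [h] at h1
    have h2 : cross (deriv σ.toFun (s + k)) (c • deriv σ.toFun (s + k)) = 0 := by
      rw [cross]; simp; ring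
    rw [h2, ← h] at h1
    rcases mul_eq_zero.1 h1.symm with h3 | h3
    · exact absurd h3 (mul_pos (hnpos _) (hnpos _)).ne'
    · exact h3
  have hcos : 0 < Real.cos (ω (t + l) - ω (s + k)) := by
    have h1 : inner ℝ (deriv σ.toFun (s + k)) (deriv σ.toFun (t + l))
        = ‖deriv σ.toFun (s + k)‖ * ‖deriv σ.toFun (t + l)‖
          * Real.cos (ω (t + l) - ω (s + k)) := by
      rw [plane_inner, (hω0 _).1, (hω0 (s + k)).2, (hω0 (t + l)).1, (hω0 (t + l)).2, Real.cos_sub]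
      ring
    have h2 : 0 < inner ℝ (deriv σ.toFun (s + k)) (deriv σ.toFun (t + l)) := by
      rw [h, inner_smul_right, real_inner_self_eq_norm_sq]
      have := hnpos (s + k)
      positivity
    rw [h1] at h2
    exact pos_of_mul_pos_right h2 (by positivity)
  -- Within one period the angles span less than a full turn. Of the multiples of `π` only `0` and
  -- `±π` are left, and the positive cosine excludes `±π`.
  have hlt : |ω (t + l) - ω (s + k)| < 2 * Real.pi := by
    have m1 : ∀ a b, a ≤ b → ω a ≤ ω b := fun a b hab => by
      rcases hab.eq_or_lt with rfl | h
      · exact le_rfl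
      · exact (hmono a b h).le
    have := m1 _ _ hk0; have := m1 _ _ hl0
    have := hmono _ _ hk1; have := hmono _ _ hl1
    rw [abs_lt]; constructor <;> linarith
  obtain ⟨n, hn⟩ := Real.sin_eq_zero_iff.1 hsin
  have hn0 : n = 0 := by
    rw [← hn, abs_lt] at hlt
    have a1 : n < 2 := by exact_mod_cast (by nlinarith [hlt.2] : (n : ℝ) < 2)
    have a2 : -2 < n := by exact_mod_cast (by nlinarith [hlt.1] : (-2 : ℝ) < n)
    have : n = -1 ∨ n = 0 ∨ n = 1 := by omega
    rcases this with rfl | h | rfl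
    · rw [← hn] at hcos; norm_num [Real.cos_neg] at hcos
    · exact h
    · rw [← hn] at hcos; norm_num at hcos
  rw [hn0, Int.cast_zero, zero_mul] at hn
  have hst : s + k = t + l := by
    rcases lt_trichotomy (s + k) (t + l) with h | h | h
    · have := hmono _ _ h; linarith
    · exact h
    · have := hmono _ _ h; linarith
  exact ⟨k - l, by push_cast; linarith⟩

end ConvexCurve
end

/-! ### The table as the convex hull of the curve -/

noncomputable section

lemma cross_smul_right (a b : Plane) (c : ℝ) : cross a (c • b) = c * cross a b := by
  simp only [cross, PiLp.smul_apply, smul_eq_mul]; ring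

lemma cross_smul_left (a b : Plane) (c : ℝ) : cross (c • a) b = c * cross a b := by
  simp only [cross, PiLp.smul_apply, smul_eq_mul]; ring

lemma cross_sub_right (a b c : Plane) : cross a (b - c) = cross a b - cross a c := by
  simp only [cross, PiLp.sub_apply]; ring

lemma cross_add_right (a b c : Plane) : cross a (b + c) = cross a b + cross a c := by
  simp only [cross, PiLp.add_apply]; ring

/-- A vector with vanishing determinant against `a ≠ 0` is a multiple of `a`. -/
lemma exists_eq_smul_of_cross_eq_zero {a b : Plane} (ha : a ≠ 0) (h : cross a b = 0) :
    ∃ c : ℝ, b = c • a := by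
  have hn : a 0 ^ 2 + a 1 ^ 2 ≠ 0 := by
    rw [← plane_norm_sq]; exact pow_ne_zero 2 (norm_ne_zero_iff.2 ha)
  rw [cross] at h
  refine ⟨(a 0 * b 0 + a 1 * b 1) / (a 0 ^ 2 + a 1 ^ 2), plane_ext ?_ ?_⟩
  · rw [PiLp.smul_apply, smul_eq_mul, div_mul_eq_mul_div, eq_div_iff hn]
    linear_combination (-(a 1)) * h
  · rw [PiLp.smul_apply, smul_eq_mul, div_mul_eq_mul_div, eq_div_iff hn]
    linear_combination (a 0) * h

lemma hasDerivAt_plane_apply {g : ℝ → Plane} {g' : Plane} {u : ℝ} (hg : HasDerivAt g g' u)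
    (i : Fin 2) : HasDerivAt (fun v => g v i) (g' i) u :=
  (EuclideanSpace.proj (𝕜 := ℝ) i).hasFDerivAt.comp_hasDerivAt u hg

lemma HasDerivAt.cross_right {g : ℝ → Plane} {g' : Plane} {u : ℝ} (hg : HasDerivAt g g' u)
    (a : Plane) : HasDerivAt (fun v => cross a (g v)) (cross a g') u :=
  ((hasDerivAt_plane_apply hg 1).const_mul _).sub ((hasDerivAt_plane_apply hg 0).const_mul _)

/-- In the plane the convex hull of a compact set is compact. -/
lemma isCompact_convexHull_plane {S : Set Plane} (hS : IsCompact S) :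
    IsCompact (convexHull ℝ S) := by
  rcases S.eq_empty_or_nonempty with rfl | ⟨z₀, hz₀⟩
  · simp
  have hcomp : IsCompact (stdSimplex ℝ (Fin 3) ×ˢ Set.univ.pi fun _ : Fin 3 => S) :=
    (isCompact_stdSimplex ℝ (Fin 3)).prod (isCompact_univ_pi fun _ => hS)
  -- Carathéodory's theorem in the plane: three points suffice, so the hull is a continuous image of
  -- a compact product. Shorter combinations are padded by `z₀` with weight `0`.
  have himg : convexHull ℝ S = (fun q : (Fin 3 → ℝ) × (Fin 3 → Plane) => ∑ i, q.1 i • q.2 i) ''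
      (stdSimplex ℝ (Fin 3) ×ˢ Set.univ.pi fun _ : Fin 3 => S) := by
    apply Set.Subset.antisymm
    · intro p hp
      obtain ⟨ι, hι, z, w, hz, hind, hw0, hw1, hsum⟩ := eq_pos_convex_span_of_mem_convexHull hp
      have hcard : Fintype.card ι ≤ Fintype.card (Fin 3) := by
        have h1 := hind.card_le_finrank_succ
        have h2 := Submodule.finrank_le (vectorSpan ℝ (Set.range z))
        have h3 : Module.finrank ℝ Plane = 2 := by simp
        rw [Fintype.card_fin]; omega
      obtain ⟨e⟩ := Function.Embedding.nonempty_of_card_le hcard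
      refine ⟨(Function.extend e w 0, Function.extend e z fun _ => z₀), ⟨⟨?_, ?_⟩, ?_⟩, ?_⟩
      · intro i
        by_cases hi : ∃ j, e j = i
        · obtain ⟨j, rfl⟩ := hi
          dsimp only
          rw [e.injective.extend_apply]; exact (hw0 j).le
        · dsimp only
          rw [Function.extend_apply' _ _ _ hi]; rfl
      · rw [← hw1]
        refine (Fintype.sum_of_injective e e.injective w (Function.extend e w 0)
          (fun i hi => ?_) (fun j => (e.injective.extend_apply _ _ _).symm)).symm
        rw [Function.extend_apply' _ _ _ hi]; rfl
      · intro i _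
        by_cases hi : ∃ j, e j = i
        · obtain ⟨j, rfl⟩ := hi
          dsimp only
          rw [e.injective.extend_apply]; exact hz ⟨j, rfl⟩
        · dsimp only
          rw [Function.extend_apply' _ _ _ hi]; exact hz₀
      · rw [← hsum]
        refine (Fintype.sum_of_injective e e.injective (fun j => w j • z j) _
          (fun i hi => ?_) (fun j => ?_)).symm
        · dsimp only
          rw [Function.extend_apply' _ _ _ hi]; simp
        · dsimp only
          rw [e.injective.extend_apply, e.injective.extend_apply]
    · rintro _ ⟨⟨w, z⟩, ⟨⟨hw0, hw1⟩, hz⟩, rfl⟩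
      exact (convex_convexHull ℝ S).sum_mem (fun i _ => hw0 i) hw1
        (fun i _ => subset_convexHull ℝ S (hz i trivial))
  rw [himg]
  exact hcomp.image (by fun_prop)

namespace ConvexCurve

variable {r : ℕ}

/-- The curve lies strictly on the left of each of its tangent lines. -/
lemma support (σ : ConvexCurve r) (hr : 2 ≤ r) {s t : ℝ} (hst : σ.toFun t ≠ σ.toFun s) :
    0 < inner ℝ (σ.toFun t - σ.toFun s) (rot90 (deriv σ.toFun s)) := by
  rw [inner_rot90, cross_sub_right]
  set a := deriv σ.toFun s with ha
  have ha0 : a ≠ 0 := σ.deriv_ne_zero s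
  set g : ℝ → ℝ := fun u => cross a (σ.toFun u) with hg
  have hd : ∀ u, HasDerivAt g (cross a (deriv σ.toFun u)) u := fun u => (σ.hasDerivAt hr u).cross_right a
  have hgp : ∀ u (k : ℤ), g (u + k) = g u := fun u k => by simp only [hg]; rw [σ.add_int]
  -- At a minimum of `g` the tangent is parallel to `a`. The second derivative test and the sign of
  -- the curvature make the factor positive, and then the turning lemma identifies the parameter.
  have hmink : ∀ u₀, (∀ u, g u₀ ≤ g u) → ∃ k : ℤ, u₀ = s + k := by
    intro u₀ hmin
    have h1 : cross a (deriv σ.toFun u₀) = 0 :=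
      IsLocalMin.hasDerivAt_eq_zero (Filter.Eventually.of_forall hmin) (hd u₀)
    obtain ⟨c, hc⟩ := exists_eq_smul_of_cross_eq_zero ha0 h1
    have h2 : 0 ≤ cross a (deriv (deriv σ.toFun) u₀) :=
      nonneg_of_hasDerivAt_of_forall_le hd ((σ.hasDerivAt_deriv hr u₀).cross_right a) hmin
    have h3 := σ.cross_pos u₀
    rw [hc, cross_smul_left] at h3
    have hc0 : 0 < c := by
      by_contra! h; nlinarith
    exact σ.eq_add_int_of_deriv_eq_smul hr hc0 hc
  obtain ⟨u₀, -, hu₀⟩ := isCompact_Icc.exists_isMinOn (Set.nonempty_Icc.2 (zero_le_one (α := ℝ)))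
    (show ContinuousOn g (Set.Icc (0:ℝ) 1) from
      (continuous_iff_continuousAt.2 fun u => (hd u).continuousAt).continuousOn)
  have hmin : ∀ u, g u₀ ≤ g u := by
    intro u
    have h1 := hu₀ (show Int.fract u ∈ Set.Icc (0:ℝ) 1 from
      ⟨Int.fract_nonneg u, (Int.fract_lt_one u).le⟩)
    have h2 := hgp (Int.fract u) ⌊u⌋
    rw [Int.fract_add_floor] at h2
    rw [h2]; exact h1
  obtain ⟨k, hk⟩ := hmink u₀ hmin
  have hs : g u₀ = g s := by rw [hk, hgp]
  rw [hs] at hmin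
  have hle : g s ≤ g t := hmin t
  rcases hle.eq_or_lt with h | h
  · obtain ⟨l, hl⟩ := hmink t (fun u => h ▸ hmin u)
    exact absurd (by rw [hl, σ.add_int]) hst
  · exact sub_pos.2 h

lemma isCompact_trace (σ : ConvexCurve r) : IsCompact σ.trace := by
  have : σ.trace = σ.toFun '' Set.Icc 0 1 := by
    have := σ.periodic.image_Icc one_pos 0
    rw [zero_add] at this
    exact this.symm
  rw [this]
  exact isCompact_Icc.image σ.continuous

lemma isCompact_hull (σ : ConvexCurve r) : IsCompact (convexHull ℝ σ.trace) :=
  isCompact_convexHull_plane σ.isCompact_trace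

lemma trace_nonempty (σ : ConvexCurve r) : σ.trace.Nonempty := ⟨_, 0, rfl⟩

/-- Points of the convex hull lie strictly to the left of the tangent lines. -/
lemma hull_support (σ : ConvexCurve r) (hr : 2 ≤ r) {s : ℝ} {p : Plane}
    (hp : p ∈ convexHull ℝ σ.trace) (hps : p ≠ σ.toFun s) :
    0 < inner ℝ (p - σ.toFun s) (rot90 (deriv σ.toFun s)) := by
  set n := rot90 (deriv σ.toFun s)
  -- An open half plane together with a single point of its boundary line is convex.
  have key : convexHull ℝ σ.trace ⊆
      {p | p = σ.toFun s ∨ 0 < inner ℝ (p - σ.toFun s) n} := by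
    apply convexHull_min
    · rintro _ ⟨t, rfl⟩
      by_cases h : σ.toFun t = σ.toFun s
      · exact Or.inl h
      · exact Or.inr (σ.support hr h)
    · intro a ha b hb u v hu hv huv
      have e : u • a + v • b - σ.toFun s = u • (a - σ.toFun s) + v • (b - σ.toFun s) := by
        rw [smul_sub, smul_sub, sub_add_sub_comm, ← add_smul, huv, one_smul]
      rcases hu.eq_or_lt with rfl | hu'
      · have : v = 1 := by linarith
        simpa [this] using hb
      rcases hv.eq_or_lt with rfl | hv'
      · have : u = 1 := by linarith
        simpa [this] using ha
      simp only [Set.mem_ofPred_eq]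
      rw [e, inner_add_left, real_inner_smul_left, real_inner_smul_left]
      rcases ha with rfl | ha <;> rcases hb with rfl | hb
      · left; rw [← add_smul, huv, one_smul]
      · right; rw [sub_self, inner_zero_left]; nlinarith [mul_pos hv' hb]
      · right; rw [sub_self, inner_zero_left]; nlinarith [mul_pos hu' ha]
      · right; have := mul_pos hu' ha; have := mul_pos hv' hb; linarith
  exact (key hp).resolve_left hps

/-- A step from the curve along the outer normal leaves the half plane of the tangent line at once.
-/
lemma trace_disjoint_interior_hull (σ : ConvexCurve r) (hr : 2 ≤ r) (s : ℝ) :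
    σ.toFun s ∉ interior (convexHull ℝ σ.trace) := by
  intro h
  set n := rot90 (deriv σ.toFun s) with hn
  have hn0 : n ≠ 0 := rot90_ne_zero (σ.deriv_ne_zero s)
  have hc : Filter.Tendsto (fun ε : ℝ => σ.toFun s - ε • n) (𝓝[>] 0) (𝓝 (σ.toFun s)) := by
    have : Continuous (fun ε : ℝ => σ.toFun s - ε • n) := by fun_prop
    simpa using (this.tendsto 0).mono_left nhdsWithin_le_nhds
  obtain ⟨ε, hε, hε0⟩ := ((hc.eventually (isOpen_interior.mem_nhds h)).and
    self_mem_nhdsWithin).exists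
  have h1 := σ.hull_support hr (s := s) (interior_subset hε) (by
    intro h; apply hn0
    have : ε • n = 0 := by rw [sub_eq_self] at h; exact h
    exact (smul_eq_zero.1 this).resolve_left (ne_of_gt hε0))
  rw [show σ.toFun s - ε • n - σ.toFun s = -(ε • n) by abel, inner_neg_left, real_inner_smul_left,
    real_inner_self_eq_norm_sq] at h1
  have : 0 < ε * ‖n‖ ^ 2 := mul_pos hε0 (by positivity)
  linarith

/-- A supporting line of the hull at a non-interior point `p` also touches the curve somewhere, and
there it is the tangent line. The hull meets a tangent line only in the point of contact, so `p`
would lie on the curve. -/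
lemma mem_interior_hull (σ : ConvexCurve r) (hr : 2 ≤ r) {p : Plane}
    (hp : p ∈ convexHull ℝ σ.trace) (hpt : p ∉ σ.trace) :
    p ∈ interior (convexHull ℝ σ.trace) := by
  by_contra hint
  have hcv := (convex_convexHull ℝ σ.trace)
  have hne : (interior (convexHull ℝ σ.trace)).Nonempty := by
    rw [(hcv).interior_nonempty_iff_affineSpan_eq_top, affineSpan_convexHull]
    by_contra hspan
    -- otherwise the curve lies on a line
    obtain ⟨f, c, hf0, hfc⟩ : ∃ (n : Plane) (c : ℝ), n ≠ 0 ∧ ∀ t, inner ℝ n (σ.toFun t) = c := by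
      have hlt : affineSpan ℝ σ.trace < ⊤ := lt_top_iff_ne_top.2 hspan
      have hdir : (affineSpan ℝ σ.trace).direction ≠ ⊤ := by
        intro h
        exact hspan ((AffineSubspace.direction_eq_top_iff_of_nonempty
          ((affineSpan_nonempty ℝ).2 σ.trace_nonempty)).1 h)
      obtain ⟨n, hn, hn0⟩ := Submodule.exists_mem_ne_zero_of_ne_bot
        (fun h => hdir ((Submodule.orthogonal_eq_bot_iff).1 h))
      refine ⟨n, inner ℝ n (σ.toFun 0), hn0, fun t => ?_⟩
      have := (Submodule.mem_orthogonal' _ _).1 hn (σ.toFun t - σ.toFun 0)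
        (AffineSubspace.vsub_mem_direction (subset_affineSpan ℝ _ ⟨t, rfl⟩)
          (subset_affineSpan ℝ _ ⟨0, rfl⟩))
      rw [inner_sub_right] at this; linarith
    have hd : ∀ t, inner ℝ f (deriv σ.toFun t) = 0 := by
      intro t
      have h1 := (HasDerivAt.inner ℝ (hasDerivAt_const t f) (σ.hasDerivAt hr t))
      simp only [inner_zero_left, add_zero] at h1
      have h2 : (fun t => inner ℝ f (σ.toFun t)) = fun _ => c := funext hfc
      rw [h2] at h1
      exact h1.unique (hasDerivAt_const t c)
    have hdd : ∀ t, inner ℝ f (deriv (deriv σ.toFun) t) = 0 := by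
      intro t
      have h1 := (HasDerivAt.inner ℝ (hasDerivAt_const t f) (σ.hasDerivAt_deriv hr t))
      simp only [inner_zero_left, add_zero] at h1
      have h2 : (fun t => inner ℝ f (deriv σ.toFun t)) = fun _ => 0 := funext hd
      rw [h2] at h1
      exact h1.unique (hasDerivAt_const t 0)
    have h1 := hd 0
    have h2 := hdd 0
    have h3 := σ.cross_pos 0
    rw [plane_inner] at h1 h2
    rw [cross] at h3
    have e0 : f 0 * cross (deriv σ.toFun 0) (deriv (deriv σ.toFun) 0) = 0 := by
      rw [cross]
      linear_combination (deriv (deriv σ.toFun) 0 1) * h1 - (deriv σ.toFun 0 1) * h2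
    have e1 : f 1 * cross (deriv σ.toFun 0) (deriv (deriv σ.toFun) 0) = 0 := by
      rw [cross]
      linear_combination (deriv σ.toFun 0 0) * h2 - (deriv (deriv σ.toFun) 0 0) * h1
    have h3' := (σ.cross_pos 0).ne'
    exact hf0 (plane_ext (by simpa [h3'] using e0) (by simpa [h3'] using e1))
  obtain ⟨f, hf⟩ := geometric_hahn_banach_open_point (hcv.interior) isOpen_interior hint
  have hf0 : f ≠ 0 := by
    rintro rfl
    obtain ⟨q, hq⟩ := hne
    simpa using hf q hq
  have hfle : ∀ q ∈ convexHull ℝ σ.trace, f q ≤ f p := by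
    intro q hq
    have hcl : q ∈ closure (interior (convexHull ℝ σ.trace)) := by
      rw [hcv.closure_interior_eq_closure_of_nonempty_interior hne]
      exact subset_closure hq
    exact closure_minimal (fun z hz => (hf z hz).le) (isClosed_le f.continuous continuous_const) hcl
  -- `f` attains its maximum on the curve at a single point
  obtain ⟨q, ⟨s, rfl⟩, hq⟩ := σ.isCompact_trace.exists_isMaxOn σ.trace_nonempty f.continuous.continuousOn
  have hps : p ≠ σ.toFun s := fun h => hpt ⟨s, h.symm⟩
  have h1 := σ.hull_support hr hp hps
  have hlm : deriv (fun t => f (σ.toFun t)) s = 0 :=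
    IsLocalMax.deriv_eq_zero (Filter.Eventually.of_forall fun t => hq ⟨t, rfl⟩)
  have hder : f (deriv σ.toFun s) = 0 := by
    rw [← hlm]
    exact ((f.hasFDerivAt.comp_hasDerivAt s (σ.hasDerivAt hr s)).deriv).symm
  have hfp : f p = f (σ.toFun s) := by
    apply le_antisymm _ (hfle _ (subset_convexHull ℝ _ ⟨s, rfl⟩))
    have : convexHull ℝ σ.trace ⊆ {z | f z ≤ f (σ.toFun s)} :=
      convexHull_min (fun z hz => hq hz) (convex_halfSpace_le f.toLinearMap.isLinear _)
    exact this hp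
  -- so `p - σ s` is tangent
  obtain ⟨w, hw⟩ := (InnerProductSpace.toDual ℝ Plane).surjective f
  have hfw : ∀ z, f z = inner ℝ w z := fun z => by rw [← hw]; rfl
  have hw0 : w ≠ 0 := fun h => hf0 (by rw [← hw, h, map_zero])
  rw [inner_rot90, cross] at h1
  have e1 : inner ℝ w (deriv σ.toFun s) = 0 := by rw [← hfw, hder]
  have e2 : inner ℝ w (p - σ.toFun s) = 0 := by
    rw [← hfw, map_sub, hfp, sub_self]
  rw [plane_inner] at e1 e2
  have h1' := h1.ne'
  set d := deriv σ.toFun s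
  set v := p - σ.toFun s
  have a0 : w 0 * (d 0 * v 1 - d 1 * v 0) = 0 := by
    linear_combination (v 1) * e1 - (d 1) * e2
  have a1 : w 1 * (d 0 * v 1 - d 1 * v 0) = 0 := by
    linear_combination (d 0) * e2 - (v 0) * e1
  exact hw0 (plane_ext (by simpa [h1'] using a0) (by simpa [h1'] using a1))

/-- The table is the convex hull of the curve. -/
theorem table_eq (σ : ConvexCurve r) (hr : 2 ≤ r) : σ.table = convexHull ℝ σ.trace := by
  have hopen : IsOpen (convexHull ℝ σ.trace)ᶜ := σ.isCompact_hull.isClosed.isOpen_compl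
  apply Set.Subset.antisymm
  · rintro p (hp | ⟨hp, hb⟩)
    · exact subset_convexHull ℝ _ hp
    by_contra hpK
    obtain ⟨f, u, hf1, hf2⟩ := geometric_hahn_banach_closed_point (convex_convexHull ℝ σ.trace)
      σ.isCompact_hull.isClosed hpK
    obtain ⟨w, hw⟩ := (InnerProductSpace.toDual ℝ Plane).surjective f
    have hfw : ∀ z, f z = inner ℝ w z := fun z => by rw [← hw]; rfl
    have hw0 : w ≠ 0 := by
      rintro rfl
      obtain ⟨q, hq⟩ := σ.trace_nonempty
      have h1 := hf1 q (subset_convexHull ℝ _ hq)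
      rw [hfw, inner_zero_left] at h1 hf2
      linarith
    -- The ray from `p` in the direction of the separating functional avoids the hull, so the
    -- component of `p` is unbounded.
    have hray : (fun t : ℝ => p + t • w) '' Set.Ici 0 ⊆ connectedComponentIn σ.traceᶜ p := by
      apply IsPreconnected.subset_connectedComponentIn
      · exact (isPreconnected_Ici).image _ (by fun_prop)
      · exact ⟨0, Set.self_mem_Ici, by simp⟩
      · rintro _ ⟨t, ht, rfl⟩ hmem
        have h1 := hf1 _ (subset_convexHull ℝ _ hmem)
        rw [hfw] at h1 hf2
        rw [inner_add_right, real_inner_smul_right, real_inner_self_eq_norm_sq] at h1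
        have : 0 ≤ t * ‖w‖ ^ 2 := mul_nonneg ht (by positivity)
        linarith
    obtain ⟨R, hR⟩ := (hb.subset hray).exists_norm_le
    have hR0 := hR _ ⟨(R + ‖p‖ + 1) / ‖w‖, by
      have := (norm_nonneg _).trans (hR _ ⟨0, Set.self_mem_Ici, rfl⟩)
      exact div_nonneg (by positivity) (norm_nonneg _), rfl⟩
    have hwn : 0 < ‖w‖ := norm_pos_iff.2 hw0
    have h2 : ‖((R + ‖p‖ + 1) / ‖w‖) • w‖ = |R + ‖p‖ + 1| := by
      rw [norm_smul, Real.norm_eq_abs, abs_div, abs_norm, div_mul_cancel₀ _ hwn.ne']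
    have h3 := norm_sub_norm_le (((R + ‖p‖ + 1) / ‖w‖) • w) (-p)
    rw [sub_neg_eq_add, norm_neg, h2, add_comm _ p] at h3
    dsimp only at hR0
    have := le_abs_self (R + ‖p‖ + 1)
    linarith
  · intro p hp
    by_cases hpt : p ∈ σ.trace
    · exact Or.inl hpt
    refine Or.inr ⟨hpt, ?_⟩
    refine σ.isCompact_hull.isBounded.subset ?_
    -- The complement of the curve is covered by two disjoint open sets, the interior and the
    -- complement of the hull; a component stays in one of them.
    have h1 : connectedComponentIn σ.traceᶜ p ⊆ interior (convexHull ℝ σ.trace) := by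
      apply isPreconnected_connectedComponentIn.subset_left_of_subset_union isOpen_interior hopen
      · exact Set.disjoint_left.2 fun z hz hz' => hz' (interior_subset hz)
      · intro z hz
        by_cases hzK : z ∈ convexHull ℝ σ.trace
        · exact Or.inl (σ.mem_interior_hull hr hzK (connectedComponentIn_subset _ _ hz))
        · exact Or.inr hzK
      · exact ⟨p, mem_connectedComponentIn hpt, σ.mem_interior_hull hr hp hpt⟩
    exact h1.trans interior_subset

lemma isCompact_table (σ : ConvexCurve r) (hr : 2 ≤ r) : IsCompact σ.table := by
  rw [σ.table_eq hr]; exact σ.isCompact_hull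

lemma convex_table (σ : ConvexCurve r) (hr : 2 ≤ r) : Convex ℝ σ.table := by
  rw [σ.table_eq hr]; exact convex_convexHull ℝ _

lemma trace_subset_table (σ : ConvexCurve r) : σ.trace ⊆ σ.table := Set.subset_union_left

lemma notMem_trace_of_mem_interior (σ : ConvexCurve r) (hr : 2 ≤ r) {p : Plane}
    (hp : p ∈ interior σ.table) : p ∉ σ.trace := by
  rintro ⟨s, rfl⟩
  rw [σ.table_eq hr] at hp
  exact σ.trace_disjoint_interior_hull hr s hp

lemma mem_interior_table (σ : ConvexCurve r) (hr : 2 ≤ r) {p : Plane}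
    (hp : p ∈ σ.table) (hpt : p ∉ σ.trace) : p ∈ interior σ.table := by
  rw [σ.table_eq hr] at hp ⊢
  exact σ.mem_interior_hull hr hp hpt

lemma table_support (σ : ConvexCurve r) (hr : 2 ≤ r) {s : ℝ} {p : Plane}
    (hp : p ∈ σ.table) (hps : p ≠ σ.toFun s) :
    0 < inner ℝ (p - σ.toFun s) (rot90 (deriv σ.toFun s)) := by
  rw [σ.table_eq hr] at hp
  exact σ.hull_support hr hp hps

/-- A boundary point on a segment of the table is an endpoint of it. -/
lemma eq_or_eq_of_mem_segment (σ : ConvexCurve r) (hr : 2 ≤ r) {a b z : Plane}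
    (ha : a ∈ σ.table) (hb : b ∈ σ.table) (hz : z ∈ σ.trace) (h : z ∈ segment ℝ a b) :
    z = a ∨ z = b := by
  obtain ⟨s, rfl⟩ := hz
  by_contra! hne
  obtain ⟨u, v, hu, hv, huv, hz⟩ := h
  have h1 := σ.table_support hr ha hne.1.symm
  have h2 := σ.table_support hr hb hne.2.symm
  set n := rot90 (deriv σ.toFun s)
  have e : u • (a - σ.toFun s) + v • (b - σ.toFun s) = 0 := by
    rw [smul_sub, smul_sub, sub_add_sub_comm, ← add_smul, huv, one_smul, hz, sub_self]
  have h3 : inner ℝ (u • (a - σ.toFun s) + v • (b - σ.toFun s)) n = 0 := by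
    rw [e, inner_zero_left]
  rw [inner_add_left, real_inner_smul_left, real_inner_smul_left] at h3
  rcases hu.eq_or_lt with rfl | hu'
  · have : v = 1 := by linarith
    subst this; linarith
  · have := mul_pos hu' h1
    have := mul_nonneg hv h2.le
    linarith

end ConvexCurve
end

noncomputable section

/-! ### Directions -/

lemma unitDir_neg (p q : Plane) : unitDir q p = -unitDir p q := by
  rw [unitDir, unitDir, norm_sub_rev, ← smul_neg, neg_sub]

lemma norm_unitDir {p q : Plane} (h : p ≠ q) : ‖unitDir p q‖ = 1 := by
  rw [unitDir, norm_smul, norm_inv, norm_norm]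
  exact inv_mul_cancel₀ (norm_ne_zero_iff.2 (sub_ne_zero.2 h.symm))

lemma eq_add_dist_smul_unitDir (p q : Plane) : q = p + dist p q • unitDir p q := by
  rcases eq_or_ne p q with rfl | h
  · simp [unitDir]
  · rw [unitDir, dist_comm, dist_eq_norm, smul_smul,
      mul_inv_cancel₀ (norm_ne_zero_iff.2 (sub_ne_zero.2 h.symm)), one_smul, add_sub_cancel]

lemma unitDir_add_smul {p e : Plane} (he : ‖e‖ = 1) {t : ℝ} (ht : 0 < t) :
    unitDir p (p + t • e) = e := by
  rw [unitDir, add_sub_cancel_left, norm_smul, he, mul_one, Real.norm_of_nonneg ht.le, smul_smul,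
    inv_mul_cancel₀ ht.ne', one_smul]

lemma mem_segment_of_unitDir_eq {p a b : Plane} (h : unitDir p a = unitDir p b)
    (hle : dist p a ≤ dist p b) : a ∈ segment ℝ p b := by
  rw [segment_eq_image']
  rcases eq_or_ne p b with rfl | hb
  · rw [dist_self] at hle
    have : p = a := dist_le_zero.1 hle
    subst this
    exact ⟨0, by simp, by simp⟩
  have hb' : 0 < dist p b := dist_pos.2 hb
  refine ⟨dist p a / dist p b, ⟨by positivity, (div_le_one hb').2 hle⟩, ?_⟩
  dsimp only
  conv_rhs => rw [eq_add_dist_smul_unitDir p a, h]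
  rw [unitDir, dist_comm p b, dist_eq_norm b p, smul_smul, div_eq_mul_inv]

lemma unitDir_eq_of_mem_segment {p a b : Plane} (ha : a ≠ p) (h : a ∈ segment ℝ p b) :
    unitDir p a = unitDir p b := by
  rw [segment_eq_image'] at h
  obtain ⟨t, ⟨ht0, ht1⟩, rfl⟩ := h
  dsimp only at ha ⊢
  have ht : 0 < t := by
    rcases ht0.eq_or_lt with rfl | h
    · simp at ha
    · exact h
  have hb : p ≠ b := by
    rintro rfl; simp at ha
  have : p + t • (b - p) = p + (t * dist p b) • unitDir p b := by
    conv_lhs => rw [eq_add_dist_smul_unitDir p b, add_sub_cancel_left, smul_smul]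
  rw [this, unitDir_add_smul (norm_unitDir hb) (mul_pos ht (dist_pos.2 hb))]

lemma mem_segment_iff_dist {a b z : Plane} : z ∈ segment ℝ a b ↔ dist a z + dist z b = dist a b := by
  rw [dist_add_dist_eq_iff, mem_segment_iff_wbtw]

/-- Two unit vectors with the same component along `d` and on the same side of `d` coincide. -/
lemma eq_of_inner_eq_of_cross_pos {u v d : Plane} (hu : ‖u‖ = 1) (hv : ‖v‖ = 1)
    (hi : inner ℝ u d = inner ℝ v d) (hcu : 0 < cross d u) (hcv : 0 < cross d v) : u = v := by
  have hd : d ≠ 0 := by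
    rintro rfl; simp [cross] at hcu
  have hn : d 0 ^ 2 + d 1 ^ 2 ≠ 0 := by
    rw [← plane_norm_sq]; exact pow_ne_zero 2 (norm_ne_zero_iff.2 hd)
  have e1 := plane_norm_sq u
  have e2 := plane_norm_sq v
  rw [hu] at e1; rw [hv] at e2
  rw [plane_inner, plane_inner] at hi
  -- Pythagoras: for unit vectors the component along `d` determines the component across `d` up to
  -- sign.
  have hsq : cross d u ^ 2 = cross d v ^ 2 := by
    have l1 : cross d u ^ 2 = (d 0 ^ 2 + d 1 ^ 2) * (u 0 ^ 2 + u 1 ^ 2)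
        - (u 0 * d 0 + u 1 * d 1) ^ 2 := by rw [cross]; ring
    have l2 : cross d v ^ 2 = (d 0 ^ 2 + d 1 ^ 2) * (v 0 ^ 2 + v 1 ^ 2)
        - (v 0 * d 0 + v 1 * d 1) ^ 2 := by rw [cross]; ring
    rw [l1, l2, ← e1, ← e2, hi]
  have hc : cross d u = cross d v := by
    rcases sq_eq_sq_iff_eq_or_eq_neg.1 hsq with h | h
    · exact h
    · linarith
  rw [cross, cross] at hc
  apply plane_ext
  · apply mul_left_cancel₀ hn; linear_combination (d 0) * hi - (d 1) * hc
  · apply mul_left_cancel₀ hn; linear_combination (d 1) * hi + (d 0) * hc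

lemma hasDerivAt_dist_left {g : ℝ → Plane} {g' a : Plane} {t : ℝ} (hg : HasDerivAt g g' t)
    (h : g t ≠ a) : HasDerivAt (fun u => dist a (g u)) (inner ℝ (unitDir a (g t)) g') t := by
  have h1 : HasDerivAt (fun u => g u - a) g' t := hg.sub_const a
  have hn : ‖g t - a‖ ≠ 0 := norm_ne_zero_iff.2 (sub_ne_zero.2 h)
  have h2 := h1.norm_sq.sqrt (pow_ne_zero 2 hn)
  have h3 : (fun u => dist a (g u)) = fun u => √(‖g u - a‖ ^ 2) := by
    funext u; rw [Real.sqrt_sq (norm_nonneg _), dist_comm, dist_eq_norm]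
  rw [h3]
  convert h2 using 1
  rw [Real.sqrt_sq (norm_nonneg _), unitDir, real_inner_smul_left]
  field_simp

namespace ConvexCurve
variable {r : ℕ}

/-- Two boundary points on the same ray from a point of the table coincide. -/
lemma eq_of_unitDir_eq (σ : ConvexCurve r) (hr : 2 ≤ r) {p a b : Plane} (hp : p ∈ σ.table)
    (ha : a ∈ σ.trace) (hb : b ∈ σ.trace) (hpa : a ≠ p) (hpb : b ≠ p)
    (h : unitDir p a = unitDir p b) : a = b := by
  rcases le_total (dist p a) (dist p b) with hle | hle
  · exact (σ.eq_or_eq_of_mem_segment hr hp (σ.trace_subset_table hb) ha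
      (mem_segment_of_unitDir_eq h hle)).resolve_left hpa
  · exact ((σ.eq_or_eq_of_mem_segment hr hp (σ.trace_subset_table ha) hb
      (mem_segment_of_unitDir_eq h.symm hle)).resolve_left hpb).symm

lemma trace_infinite (σ : ConvexCurve r) : σ.trace.Infinite := by
  have : (σ.toFun '' Set.Ico 0 1).Infinite := (Set.Ico_infinite one_pos).image σ.injOn
  exact this.mono (Set.image_subset_range _ _)

/-- The path `a, p, b` satisfies the reflection law at the boundary point `p`. -/
def Refl (σ : ConvexCurve r) (a p b : Plane) : Prop :=
  ∃ s, σ.toFun s = p ∧ inner ℝ (unitDir a p) (deriv σ.toFun s) = inner ℝ (unitDir p b) (deriv σ.toFun s)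

lemma deriv_eq_of_eq (σ : ConvexCurve r) {s t : ℝ} (h : σ.toFun s = σ.toFun t) :
    deriv σ.toFun s = deriv σ.toFun t := by
  obtain ⟨k, rfl⟩ := σ.eq_add_int h
  rw [σ.deriv_add_int]

lemma Refl.symm {σ : ConvexCurve r} {a p b : Plane} (h : σ.Refl a p b) : σ.Refl b p a := by
  obtain ⟨s, hs, h⟩ := h
  refine ⟨s, hs, ?_⟩
  rw [unitDir_neg p b, unitDir_neg a p, inner_neg_left, inner_neg_left, h]

lemma cross_unitDir_pos (σ : ConvexCurve r) (hr : 2 ≤ r) {s : ℝ} {b : Plane} (hb : b ∈ σ.table)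
    (hbs : b ≠ σ.toFun s) : 0 < cross (deriv σ.toFun s) (unitDir (σ.toFun s) b) := by
  have := σ.table_support hr hb hbs
  rw [inner_rot90] at this
  rw [unitDir, cross_smul_right]
  exact mul_pos (inv_pos.2 (norm_pos_iff.2 (sub_ne_zero.2 hbs))) this

/-- The reflected direction is determined by the direction of incidence. -/
lemma Refl.unitDir_eq {σ : ConvexCurve r} (hr : 2 ≤ r) {a a' p b b' : Plane} (h : σ.Refl a p b)
    (h' : σ.Refl a' p b') (ha : unitDir p a = unitDir p a') (hb : b ∈ σ.table) (hb' : b' ∈ σ.table)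
    (hpb : b ≠ p) (hpb' : b' ≠ p) : unitDir p b = unitDir p b' := by
  obtain ⟨s, hs, h⟩ := h
  obtain ⟨s', hs', h'⟩ := h'
  rw [σ.deriv_eq_of_eq (hs'.trans hs.symm)] at h'
  subst hs
  refine eq_of_inner_eq_of_cross_pos (norm_unitDir hpb.symm) (norm_unitDir hpb'.symm)
    (d := deriv σ.toFun s) ?_ (σ.cross_unitDir_pos hr hb hpb) (σ.cross_unitDir_pos hr hb' hpb')
  rw [← h, ← h', unitDir_neg _ a, unitDir_neg _ a', ha]

/-- A boundary point that locally maximizes the sum of the distances to `a` and `b` reflects. -/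
lemma refl_of_isLocalMax (σ : ConvexCurve r) (hr : 2 ≤ r) {a b : Plane} {s : ℝ}
    (ha : a ≠ σ.toFun s) (hb : b ≠ σ.toFun s)
    (h : IsLocalMax (fun t => dist a (σ.toFun t) + dist (σ.toFun t) b) s) :
    σ.Refl a (σ.toFun s) b := by
  refine ⟨s, rfl, ?_⟩
  have h1 := hasDerivAt_dist_left (σ.hasDerivAt hr s) ha.symm
  have h2 := hasDerivAt_dist_left (σ.hasDerivAt hr s) hb.symm
  simp_rw [dist_comm b] at h2
  have := h.hasDerivAt_eq_zero (h1.add h2)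
  rw [unitDir_neg _ b, inner_neg_left] at this
  linarith

end ConvexCurve

/-! ### Polygonal paths -/

/-- The length of the polygonal path `P 0, …, P (m + 1)`. -/
def polyLen (m : ℕ) (P : ℕ → Plane) : ℝ := ∑ i ∈ Finset.range (m + 1), dist (P i) (P (i + 1))

lemma polyLen_congr {m : ℕ} {P Q : ℕ → Plane} (h : ∀ i ≤ m + 1, P i = Q i) :
    polyLen m P = polyLen m Q := by
  refine Finset.sum_congr rfl fun i hi => ?_
  rw [Finset.mem_range] at hi
  rw [h i (by omega), h (i + 1) (by omega)]

lemma polyLen_split (m j : ℕ) (hj : j ≤ m + 1) (P : ℕ → Plane) :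
    polyLen m P = ∑ i ∈ Finset.range j, dist (P i) (P (i + 1))
      + ∑ i ∈ Finset.Ico j (m + 1), dist (P i) (P (i + 1)) :=
  (Finset.sum_range_add_sum_Ico _ hj).symm

lemma polyLen_update_zero (m : ℕ) (P : ℕ → Plane) (x : Plane) :
    polyLen m (Function.update P 0 x) = polyLen m P - dist (P 0) (P 1) + dist x (P 1) := by
  rw [polyLen_split m 1 (by omega), polyLen_split m 1 (by omega) P, Finset.sum_range_one,
    Finset.sum_range_one]
  have : ∑ i ∈ Finset.Ico 1 (m + 1), dist (Function.update P 0 x i) (Function.update P 0 x (i + 1))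
      = ∑ i ∈ Finset.Ico 1 (m + 1), dist (P i) (P (i + 1)) := by
    refine Finset.sum_congr rfl fun i hi => ?_
    rw [Finset.mem_Ico] at hi
    rw [Function.update_of_ne (by omega), Function.update_of_ne (by omega)]
  rw [this, Function.update_self, Function.update_of_ne (by omega), zero_add]
  ring

lemma polyLen_update (m j : ℕ) (hj : j < m) (P : ℕ → Plane) (q : Plane) :
    polyLen m (Function.update P (j + 1) q) = polyLen m P
      - (dist (P j) (P (j + 1)) + dist (P (j + 1)) (P (j + 2)))
      + (dist (P j) q + dist q (P (j + 2))) := by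
  have hs : ∀ Q : ℕ → Plane, polyLen m Q = ∑ i ∈ Finset.range j, dist (Q i) (Q (i + 1))
      + (dist (Q j) (Q (j + 1)) + dist (Q (j + 1)) (Q (j + 2)))
      + ∑ i ∈ Finset.Ico (j + 2) (m + 1), dist (Q i) (Q (i + 1)) := by
    intro Q
    rw [polyLen_split m (j + 2) (by omega), Finset.sum_range_succ, Finset.sum_range_succ]
    ring
  rw [hs, hs P]
  have h1 : ∑ i ∈ Finset.range j, dist (Function.update P (j + 1) q i)
      (Function.update P (j + 1) q (i + 1)) = ∑ i ∈ Finset.range j, dist (P i) (P (i + 1)) := by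
    refine Finset.sum_congr rfl fun i hi => ?_
    rw [Finset.mem_range] at hi
    rw [Function.update_of_ne (by omega), Function.update_of_ne (by omega)]
  have h2 : ∑ i ∈ Finset.Ico (j + 2) (m + 1), dist (Function.update P (j + 1) q i)
      (Function.update P (j + 1) q (i + 1))
      = ∑ i ∈ Finset.Ico (j + 2) (m + 1), dist (P i) (P (i + 1)) := by
    refine Finset.sum_congr rfl fun i hi => ?_
    rw [Finset.mem_Ico] at hi
    rw [Function.update_of_ne (by omega), Function.update_of_ne (by omega)]
  rw [h1, h2, Function.update_self, Function.update_of_ne (by omega),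
    Function.update_of_ne (by omega)]
  ring

/-- The reversed path. -/
def polyRev (m : ℕ) (P : ℕ → Plane) : ℕ → Plane := fun i => P (m + 1 - i)

lemma polyLen_polyRev (m : ℕ) (P : ℕ → Plane) : polyLen m (polyRev m P) = polyLen m P := by
  unfold polyLen
  rw [← Finset.sum_range_reflect]
  refine Finset.sum_congr rfl fun i hi => ?_
  rw [Finset.mem_range] at hi
  rw [polyRev, polyRev, dist_comm, show m + 1 - (m + 1 - 1 - i + 1) = i by omega,
    show m + 1 - (m + 1 - 1 - i) = i + 1 by omega]

/-- The path that follows `P` up to the index `j` and `Q` afterwards. -/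
def polySplice (j : ℕ) (P Q : ℕ → Plane) : ℕ → Plane := fun i => if i ≤ j then P i else Q i

lemma polyLen_polySplice {m j : ℕ} (hj : j ≤ m + 1) {P Q : ℕ → Plane} (h : P j = Q j) :
    polyLen m (polySplice j P Q) = ∑ i ∈ Finset.range j, dist (P i) (P (i + 1))
      + ∑ i ∈ Finset.Ico j (m + 1), dist (Q i) (Q (i + 1)) := by
  rw [polyLen_split m j hj]
  congr 1
  · refine Finset.sum_congr rfl fun i hi => ?_
    rw [Finset.mem_range] at hi
    rw [polySplice, polySplice, if_pos (by omega), if_pos (by omega)]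
  · refine Finset.sum_congr rfl fun i hi => ?_
    rw [Finset.mem_Ico] at hi
    have e : ∀ i, j ≤ i → polySplice j P Q i = Q i := by
      intro i hi
      unfold polySplice
      split_ifs with h1
      · rw [show i = j by omega, h]
      · rfl
    rw [e i hi.1, e (i + 1) (by omega)]

/-- The path in which the block from index `i` to index `j` is traversed backwards. -/
def polyRevBlock (i j : ℕ) (P : ℕ → Plane) : ℕ → Plane :=
  fun l => if i ≤ l ∧ l ≤ j then P (i + j - l) else P l

lemma polyLen_polyRevBlock {m i j : ℕ} (hij : i ≤ j) (hj : j ≤ m + 1) {P : ℕ → Plane}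
    (h : P i = P j) : polyLen m (polyRevBlock i j P) = polyLen m P := by
  have e1 : ∀ l, l ≤ i → polyRevBlock i j P l = P l := by
    intro l hl
    unfold polyRevBlock
    split_ifs with h1
    · rw [show l = i by omega, show i + j - i = j by omega, h]
    · rfl
  have e2 : ∀ l, j ≤ l → polyRevBlock i j P l = P l := by
    intro l hl
    unfold polyRevBlock
    split_ifs with h1
    · rw [show l = j by omega, show i + j - j = i by omega, h]
    · rfl
  have hs : ∀ Q : ℕ → Plane, polyLen m Q = ∑ l ∈ Finset.range i, dist (Q l) (Q (l + 1))
      + ∑ l ∈ Finset.Ico i j, dist (Q l) (Q (l + 1))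
      + ∑ l ∈ Finset.Ico j (m + 1), dist (Q l) (Q (l + 1)) := by
    intro Q
    rw [polyLen_split m j hj, ← Finset.sum_range_add_sum_Ico _ hij]
  rw [hs, hs P]
  congr 1
  · congr 1
    · refine Finset.sum_congr rfl fun l hl => ?_
      rw [Finset.mem_range] at hl
      rw [e1 l (by omega), e1 (l + 1) (by omega)]
    · rw [Finset.sum_Ico_eq_sum_range, Finset.sum_Ico_eq_sum_range, ← Finset.sum_range_reflect]
      refine Finset.sum_congr rfl fun l hl => ?_
      rw [Finset.mem_range] at hl
      rw [polyRevBlock, polyRevBlock, if_pos (by omega), if_pos (by omega), dist_comm,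
        show i + j - (i + (j - i - 1 - l) + 1) = i + l by omega,
        show i + j - (i + (j - i - 1 - l)) = i + l + 1 by omega]
  · refine Finset.sum_congr rfl fun l hl => ?_
    rw [Finset.mem_Ico] at hl
    rw [e2 l (by omega), e2 (l + 1) (by omega)]

end

/-! ### Longest polygonal paths and their rigidity -/

noncomputable section

/-- A polygonal path from `x` to `y` with `m` vertices in `S`, continued by the constant `y`. -/
structure IsPolyPath (S : Set Plane) (m : ℕ) (x y : Plane) (P : ℕ → Plane) : Prop where
  zero : P 0 = x
  tail : ∀ i, m + 1 ≤ i → P i = y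
  mem : ∀ i, 1 ≤ i → i ≤ m → P i ∈ S

lemma IsPolyPath.last {S : Set Plane} {m : ℕ} {x y : Plane} {P : ℕ → Plane}
    (h : IsPolyPath S m x y P) : P (m + 1) = y := h.tail _ le_rfl

/-- A longest polygonal path from `x` to `y` with `m` vertices in `S`. -/
structure IsMaxPoly (S : Set Plane) (m : ℕ) (x y : Plane) (P : ℕ → Plane) : Prop
    extends IsPolyPath S m x y P where
  le : ∀ Q, IsPolyPath S m x y Q → polyLen m Q ≤ polyLen m P

lemma continuous_polyLen (m : ℕ) : Continuous (polyLen m) := by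
  unfold polyLen; fun_prop

/-- Paths are sequences indexed by all of `ℕ`. With the coordinates beyond `m` frozen at `y` the
candidates form a product of compact sets, on which the length is continuous. -/
lemma exists_isMaxPoly {S : Set Plane} (hS : IsCompact S) (hne : S.Nonempty) (m : ℕ) (x y : Plane) :
    ∃ P, IsMaxPoly S m x y P := by
  let K : Set (ℕ → Plane) := Set.univ.pi fun i => if i = 0 then {x} else if i ≤ m then S else {y}
  have hK : IsCompact K := isCompact_univ_pi fun i => by
    split_ifs
    · exact isCompact_singleton
    · exact hS
    · exact isCompact_singleton
  obtain ⟨z, hz⟩ := hne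
  have hKne : K.Nonempty := ⟨fun i => if i = 0 then x else if i ≤ m then z else y, fun i _ => by
    dsimp only
    split_ifs
    · rfl
    · exact hz
    · rfl⟩
  obtain ⟨P, hP, hmax⟩ := hK.exists_isMaxOn hKne (continuous_polyLen m).continuousOn
  refine ⟨P, ⟨by simpa using hP 0 trivial, fun i hi => ?_, fun i h1 h2 => ?_⟩, fun Q hQ => ?_⟩
  · have := hP i trivial
    dsimp only at this
    rwa [if_neg (by omega), if_neg (by omega)] at this
  · have := hP i trivial
    dsimp only at this
    rwa [if_neg (by omega), if_pos h2] at this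
  · refine hmax fun i _ => ?_
    dsimp only
    split_ifs with h1 h2
    · subst h1; exact hQ.zero
    · exact hQ.mem i (by omega) h2
    · exact hQ.tail i (by omega)

lemma IsPolyPath.polyRev {S : Set Plane} {m : ℕ} {x y : Plane} {P : ℕ → Plane}
    (h : IsPolyPath S m x y P) : IsPolyPath S m y x (polyRev m P) where
  zero := h.last
  tail i hi := by
    unfold _root_.polyRev; rw [Nat.sub_eq_zero_of_le hi]; exact h.zero
  mem i h1 h2 := h.mem _ (by omega) (by omega)

lemma IsMaxPoly.polyRev {S : Set Plane} {m : ℕ} {x y : Plane} {P : ℕ → Plane}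
    (h : IsMaxPoly S m x y P) : IsMaxPoly S m y x (polyRev m P) where
  toIsPolyPath := h.toIsPolyPath.polyRev
  le Q hQ := by
    rw [polyLen_polyRev, ← polyLen_polyRev m Q]
    exact h.le _ hQ.polyRev

lemma IsMaxPoly.of_len {S : Set Plane} {m : ℕ} {x y : Plane} {P Q : ℕ → Plane}
    (h : IsMaxPoly S m x y P) (hQ : IsPolyPath S m x y Q) (hl : polyLen m P ≤ polyLen m Q) :
    IsMaxPoly S m x y Q :=
  ⟨hQ, fun R hR => (h.le R hR).trans hl⟩

/-- Reversing a closed loop preserves the length. The reversed path obeys its own reflection laws,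
which are then compared with those of `P`. The case `j = m + 1` covers a loop that ends at an end
point lying in `S`. -/
lemma IsMaxPoly.polyRevBlock {S : Set Plane} {m i j : ℕ} {x y : Plane} {P : ℕ → Plane}
    (h : IsMaxPoly S m x y P) (hij : i ≤ j) (hj : j ≤ m + 1) (hi : 1 ≤ i) (he : P i = P j) :
    IsMaxPoly S m x y (polyRevBlock i j P) := by
  refine h.of_len ⟨?_, ?_, ?_⟩ (polyLen_polyRevBlock hij hj he).ge
  · unfold _root_.polyRevBlock; rw [if_neg (by omega)]; exact h.zero
  · intro l hl
    unfold _root_.polyRevBlock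
    split_ifs with h1
    · rw [show i + j - l = i by omega, he]; exact h.tail _ (by omega)
    · exact h.tail l hl
  · intro l h1 h2
    unfold _root_.polyRevBlock
    split_ifs with h3
    · by_cases h4 : i + j - l ≤ m
      · exact h.mem _ (by omega) h4
      · have h5 : l = i := by omega
        rw [h5, show i + j - i = j by omega, ← he]
        exact h.mem i hi (by omega)
    · exact h.mem l h1 h2

namespace IsMaxPoly

variable {r : ℕ} {σ : ConvexCurve r} {m : ℕ} {x y : Plane} {P : ℕ → Plane}

lemma mem_table (h : IsMaxPoly σ.trace m x y P) (hx : x ∈ σ.table) (hy : y ∈ σ.table) (i : ℕ)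
    (hi : i ≤ m + 1) : P i ∈ σ.table := by
  rcases Nat.eq_zero_or_pos i with rfl | h0
  · rw [h.zero]; exact hx
  rcases hi.eq_or_lt with rfl | h1
  · rw [h.last]; exact hy
  · exact σ.trace_subset_table (h.mem i h0 (by omega))

/-- Each vertex of a longest path maximizes the sum of the distances to its neighbours. -/
lemma vertex_le {S : Set Plane} (h : IsMaxPoly S m x y P) {j : ℕ} (hj : j < m) {q : Plane} (hq : q ∈ S) :
    dist (P j) q + dist q (P (j + 2)) ≤ dist (P j) (P (j + 1)) + dist (P (j + 1)) (P (j + 2)) := by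
  have h1 := h.le (Function.update P (j + 1) q) ⟨by
    rw [Function.update_of_ne (by omega)]; exact h.zero, fun i hi => by
    rw [Function.update_of_ne (by omega)]; exact h.tail i hi, fun i h1 h2 => by
      by_cases hi : i = j + 1
      · subst hi; rw [Function.update_self]; exact hq
      · rw [Function.update_of_ne hi]; exact h.mem i h1 h2⟩
  rw [polyLen_update m j hj] at h1
  linarith

/-- If a vertex coincided with a neighbour, maximality would put every boundary point on the segment
between two points of the table. Such a segment contains at most two boundary points. -/
lemma ne_succ (hr : 2 ≤ r) (h : IsMaxPoly σ.trace m x y P) (hx : x ∈ σ.table) (hy : y ∈ σ.table)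
    (hm : 1 ≤ m) {i : ℕ} (hi : i ≤ m) : P i ≠ P (i + 1) := by
  intro he
  -- all boundary points would lie on one segment
  have key : ∀ a b : Plane, a ∈ σ.table → b ∈ σ.table →
      (∀ q ∈ σ.trace, dist a q + dist q b ≤ dist a b) → False := by
    intro a b ha hb hq
    have hsub : σ.trace ⊆ {a, b} := by
      intro q hqS
      have := σ.eq_or_eq_of_mem_segment hr ha hb hqS
        (mem_segment_iff_dist.2 (le_antisymm (hq q hqS) (dist_triangle _ _ _)))
      simpa using this
    exact σ.trace_infinite ((Set.toFinite {a, b}).subset hsub)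
  by_cases h1 : i < m
  · refine key (P i) (P (i + 2)) (h.mem_table hx hy _ (by omega)) (h.mem_table hx hy _ (by omega)) ?_
    intro q hq
    have := h.vertex_le h1 hq
    rwa [← he, dist_self, zero_add] at this
  · obtain ⟨j, rfl⟩ : ∃ j, i = j + 1 := ⟨i - 1, by omega⟩
    refine key (P j) (P (j + 2)) (h.mem_table hx hy _ (by omega)) (h.mem_table hx hy _ (by omega)) ?_
    intro q hq
    have := h.vertex_le (j := j) (by omega) hq
    rw [show P (j + 2) = P (j + 1) from he.symm, dist_self, add_zero] at this
    rw [show P (j + 2) = P (j + 1) from he.symm]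
    exact this

/-- A longest path is maximal in each vertex separately, and a boundary point maximizing the sum of
the distances to its neighbours is a point of reflection. -/
lemma refl (hr : 2 ≤ r) (h : IsMaxPoly σ.trace m x y P) (hx : x ∈ σ.table) (hy : y ∈ σ.table)
    {j : ℕ} (hj : j < m) : σ.Refl (P j) (P (j + 1)) (P (j + 2)) := by
  have h1 := h.ne_succ hr hx hy (by omega) (i := j) (by omega)
  have h2 := h.ne_succ hr hx hy (by omega) (i := j + 1) (by omega)
  obtain ⟨s, hs⟩ := h.mem (j + 1) (by omega) (by omega)
  rw [← hs] at h1 h2 ⊢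
  refine σ.refl_of_isLocalMax hr h1 h2.symm (Filter.Eventually.of_forall fun t => ?_)
  have := h.vertex_le hj (q := σ.toFun t) ⟨t, rfl⟩
  rwa [← hs] at this

/-- Two longest paths that leave their starting points along the same ray to the same first vertex
agree as long as both have vertices. -/
lemma eq_of_first_eq {m' : ℕ} {x' y' : Plane} {Q : ℕ → Plane} (hr : 2 ≤ r)
    (h : IsMaxPoly σ.trace m x y P) (h' : IsMaxPoly σ.trace m' x' y' Q) (hx : x ∈ σ.table)
    (hy : y ∈ σ.table) (hx' : x' ∈ σ.table) (hy' : y' ∈ σ.table) (h1 : P 1 = Q 1)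
    (hd : unitDir (P 1) x = unitDir (P 1) x') {l : ℕ} (hl : l < m) (hl' : l < m') :
    P (l + 1) = Q (l + 1) ∧ unitDir (P (l + 1)) (P (l + 2)) = unitDir (P (l + 1)) (Q (l + 2)) := by
  have step : ∀ l, l < m → l < m' → P (l + 1) = Q (l + 1) →
      unitDir (P (l + 1)) (P l) = unitDir (P (l + 1)) (Q l) →
      unitDir (P (l + 1)) (P (l + 2)) = unitDir (P (l + 1)) (Q (l + 2)) := by
    intro l hl hl' he hd
    have r1 := h.refl hr hx hy hl
    have r2 := h'.refl hr hx' hy' hl'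
    rw [← he] at r2
    have n2 := h'.ne_succ hr hx' hy' (by omega) (i := l + 1) (by omega)
    rw [← he] at n2
    exact r1.unitDir_eq hr r2 hd (h.mem_table hx hy _ (by omega)) (h'.mem_table hx' hy' _ (by omega))
      (h.ne_succ hr hx hy (by omega) (i := l + 1) (by omega)).symm n2.symm
  induction l with
  | zero => exact ⟨h1, step 0 hl hl' h1 (by rw [h.zero, h'.zero]; exact hd)⟩
  | succ l ih =>
    obtain ⟨e, d⟩ := ih (by omega) (by omega)
    have n1 := h.ne_succ hr hx hy (by omega) (i := l + 1) (by omega)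
    have n2 := h'.ne_succ hr hx' hy' (by omega) (i := l + 1) (by omega)
    have e2 : P (l + 2) = Q (l + 2) :=
      σ.eq_of_unitDir_eq hr (h.mem_table hx hy (l + 1) (by omega)) (h.mem _ (by omega) (by omega))
        (h'.mem _ (by omega) (by omega)) n1.symm (by rw [e]; exact n2.symm) d
    refine ⟨e2, step (l + 1) hl hl' e2 ?_⟩
    rw [e]

/-- Moving the starting point of a longest path back along its first segment. -/
lemma slide (h : IsMaxPoly σ.trace m x y P) {x' : Plane} (hseg : x ∈ segment ℝ x' (P 1)) :
    IsMaxPoly σ.trace m x' y (Function.update P 0 x') := by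
  refine ⟨⟨Function.update_self _ _ _, fun i hi => ?_, fun i h1 h2 => ?_⟩, fun Q hQ => ?_⟩
  · rw [Function.update_of_ne (by omega)]; exact h.tail i hi
  · rw [Function.update_of_ne (by omega)]; exact h.mem i h1 h2
  · rw [polyLen_update_zero]
    have hQ' : IsPolyPath σ.trace m x y (Function.update Q 0 x) :=
      ⟨Function.update_self _ _ _, fun i hi => by rw [Function.update_of_ne (by omega)]; exact hQ.tail i hi,
        fun i h1 h2 => by rw [Function.update_of_ne (by omega)]; exact hQ.mem i h1 h2⟩
    have h1 := h.le _ hQ'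
    rw [polyLen_update_zero, hQ.zero] at h1
    -- Starting from `x'` lengthens `P` by exactly `dist x' x`; by the triangle inequality no
    -- competitor gains more.
    have h2 := mem_segment_iff_dist.1 hseg
    rw [h.zero]
    have h3 := dist_triangle x' x (Q 1)
    linarith

/-- After moving back the starting point, the longest path is unique. -/
lemma slide_unique (hr : 2 ≤ r) (h : IsMaxPoly σ.trace m x y P) (hx : x ∈ σ.table)
    (hy : y ∈ σ.table) {x' : Plane} (hx' : x' ∈ σ.table) (hxx : x ≠ x')
    (hseg : x ∈ segment ℝ x' (P 1)) (hxS : x ∉ σ.trace) {Q : ℕ → Plane}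
    (hQ : IsMaxPoly σ.trace m x' y Q) {l : ℕ} (h1 : 1 ≤ l) (hl : l ≤ m) : Q l = P l := by
  have hP' := h.slide hseg
  have hQ' : IsPolyPath σ.trace m x y (Function.update Q 0 x) :=
    ⟨Function.update_self _ _ _, fun i hi => by rw [Function.update_of_ne (by omega)]; exact hQ.tail i hi,
      fun i h1 h2 => by rw [Function.update_of_ne (by omega)]; exact hQ.mem i h1 h2⟩
  have a1 := h.le _ hQ'
  have a2 := hQ.le _ hP'.toIsPolyPath
  rw [polyLen_update_zero] at a1 a2
  rw [hQ.zero] at a1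
  rw [h.zero] at a2
  have a3 := mem_segment_iff_dist.1 hseg
  -- The two maximality statements force equality in the triangle inequality, so the first segment
  -- of `Q` passes through `x` too. Hence both paths start on the same ray, hit the same first
  -- vertex, and are determined from there on by reflection.
  have hsegQ : x ∈ segment ℝ x' (Q 1) := by
    rw [mem_segment_iff_dist]
    exact le_antisymm (by linarith) (dist_triangle _ _ _)
  have hm : 1 ≤ m := h1.trans hl
  have hPS := h.mem 1 le_rfl hm
  have hQS := hQ.mem 1 le_rfl hm
  have ne1 : ∀ z ∈ σ.trace, x ∈ segment ℝ x' z → z ≠ x' := by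
    rintro z hz hs rfl
    rw [segment_same] at hs
    exact hxx hs
  have hd : unitDir x' (P 1) = unitDir x' (Q 1) :=
    (unitDir_eq_of_mem_segment hxx hseg).symm.trans (unitDir_eq_of_mem_segment hxx hsegQ)
  have e1 : P 1 = Q 1 := σ.eq_of_unitDir_eq hr hx' hPS hQS (ne1 _ hPS hseg) (ne1 _ hQS hsegQ) hd
  obtain ⟨k, rfl⟩ : ∃ k, l = k + 1 := ⟨l - 1, by omega⟩
  refine (h.eq_of_first_eq hr hQ hx hy hx' hy e1 ?_ (by omega) (by omega)).1.symm
  exact unitDir_eq_of_mem_segment (fun e => hxS (e ▸ hPS)) (by rw [segment_symm]; exact hseg)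

/-- A longest path that visits a boundary point twice hits the boundary perpendicularly. -/
lemma exists_turn (hr : 2 ≤ r) (hx : x ∈ σ.table) (hy : y ∈ σ.table)
    (h : IsMaxPoly σ.trace m x y P) {i j : ℕ} (hi : 1 ≤ i) (hij : i < j) (hj : j ≤ m)
    (he : P i = P j) : ∃ k, k + 1 ≤ m ∧ P k = P (k + 2) := by
  obtain ⟨n, hn⟩ : ∃ n, j - i = n := ⟨_, rfl⟩
  induction n using Nat.strong_induction_on generalizing i j with
  | _ n ih =>
    have hj2 : i + 2 ≤ j := by
      by_contra hh
      have : j = i + 1 := by omega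
      subst this
      exact h.ne_succ hr hx hy (by omega) (by omega) he
    rcases hj2.eq_or_lt with rfl | hj3
    · exact ⟨i, by omega, he⟩
    -- The path with the loop reversed arrives at the repeated vertex along the same segment, so
    -- reflection forces the same outgoing direction. The second and the last but one point of the
    -- loop therefore coincide, and the loop shrinks at both ends.
    have hrev := h.polyRevBlock (by omega) (by omega) hi he
    obtain ⟨i, rfl⟩ : ∃ k, i = k + 1 := ⟨i - 1, by omega⟩
    have r1 := h.refl hr hx hy (j := i) (by omega)
    have r2 := hrev.refl hr hx hy (j := i) (by omega)
    have e0 : _root_.polyRevBlock (i + 1) j P i = P i := by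
      unfold _root_.polyRevBlock; rw [if_neg (by omega)]
    have e1 : _root_.polyRevBlock (i + 1) j P (i + 1) = P (i + 1) := by
      unfold _root_.polyRevBlock
      rw [if_pos (by omega), show i + 1 + j - (i + 1) = j by omega, he]
    have e2 : _root_.polyRevBlock (i + 1) j P (i + 2) = P (j - 1) := by
      unfold _root_.polyRevBlock
      rw [if_pos (by omega), show i + 1 + j - (i + 2) = j - 1 by omega]
    rw [e0, e1, e2] at r2
    have n1 := h.ne_succ hr hx hy (by omega) (i := i + 1) (by omega)
    have n2 := h.ne_succ hr hx hy (by omega) (i := j - 1) (by omega)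
    rw [show j - 1 + 1 = j by omega, ← he] at n2
    have d := r1.unitDir_eq hr r2 rfl (h.mem_table hx hy _ (by omega))
      (h.mem_table hx hy _ (by omega)) n1.symm n2
    have e3 : P (i + 2) = P (j - 1) :=
      σ.eq_of_unitDir_eq hr (h.mem_table hx hy (i + 1) (by omega)) (h.mem _ (by omega) (by omega))
        (h.mem _ (by omega) (by omega)) n1.symm n2 d
    by_cases h4 : i + 2 < j - 1
    · exact ih (j - 1 - (i + 2)) (by omega) (by omega) h4 (by omega) e3 rfl
    · have : j = i + 3 := by omega
      subst this
      exact ⟨i + 1, by omega, by rw [he]⟩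

end IsMaxPoly
end

noncomputable section

/-! ### Closed sets of pairs without interior -/

/-- `B` is closed and contains no nonempty open subset of `Ω`. -/
def Avoidable {X : Type*} [TopologicalSpace X] (Ω B : Set X) : Prop :=
  IsClosed B ∧ ∀ O ⊆ Ω, IsOpen O → O.Nonempty → (O \ B).Nonempty

lemma Avoidable.exists_open {X : Type*} [TopologicalSpace X] {Ω B O : Set X} (h : Avoidable Ω B)
    (hO : O ⊆ Ω) (ho : IsOpen O) (hne : O.Nonempty) :
    ∃ O' ⊆ O, IsOpen O' ∧ O'.Nonempty ∧ Disjoint O' B :=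
  ⟨O \ B, Set.sdiff_subset, ho.sdiff h.1, h.2 O hO ho hne, Set.disjoint_sdiff_left⟩

lemma Avoidable.exists_open_finset {X ι : Type*} [TopologicalSpace X] {Ω O : Set X} {B : ι → Set X}
    (s : Finset ι) (h : ∀ i ∈ s, Avoidable Ω (B i)) (hO : O ⊆ Ω) (ho : IsOpen O)
    (hne : O.Nonempty) :
    ∃ O' ⊆ O, IsOpen O' ∧ O'.Nonempty ∧ ∀ i ∈ s, Disjoint O' (B i) := by
  classical
  induction s using Finset.induction_on with
  | empty => exact ⟨O, subset_rfl, ho, hne, by simp⟩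
  | insert a s ha ih =>
    obtain ⟨O', h1, h2, h3, h4⟩ := ih fun i hi => h i (Finset.mem_insert_of_mem hi)
    obtain ⟨O'', g1, g2, g3, g4⟩ :=
      (h a (Finset.mem_insert_self a s)).exists_open (h1.trans hO) h2 h3
    refine ⟨O'', g1.trans h1, g2, g3, fun i hi => ?_⟩
    rcases Finset.mem_insert.1 hi with rfl | hi
    · exact g4
    · exact (h4 i hi).mono_left g1

lemma exists_notMem_segment {U : Set Plane} (hU : IsOpen U) (hne : U.Nonempty) (a b : Plane) :
    ∃ z ∈ U, z ∉ segment ℝ a b := by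
  by_contra! hsub
  obtain ⟨z, hz⟩ := hne
  have hmove : ∀ v : Plane, ∃ t > (0 : ℝ), z + t • v ∈ U := by
    intro v
    have hc : Filter.Tendsto (fun t : ℝ => z + t • v) (𝓝[>] 0) (𝓝 z) := by
      have : Continuous (fun t : ℝ => z + t • v) := by fun_prop
      simpa using (this.tendsto 0).mono_left nhdsWithin_le_nhds
    obtain ⟨t, ht, ht0⟩ := ((hc.eventually (hU.mem_nhds hz)).and self_mem_nhdsWithin).exists
    exact ⟨t, ht0, ht⟩
  rcases eq_or_ne a b with rfl | hab
  · obtain ⟨t, ht, h⟩ := hmove (EuclideanSpace.single 0 1)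
    have h1 := hsub _ hz
    have h2 := hsub _ h
    rw [segment_same, Set.mem_singleton_iff] at h1 h2
    rw [h1, add_eq_left, smul_eq_zero] at h2
    rcases h2 with h2 | h2
    · exact ht.ne' h2
    · simpa using congrArg norm h2
  · obtain ⟨t, ht, h⟩ := hmove (rot90 (b - a))
    have hcr : ∀ w ∈ segment ℝ a b, cross (b - a) (w - a) = 0 := by
      intro w hw
      rw [segment_eq_image'] at hw
      obtain ⟨c, -, rfl⟩ := hw
      simp only [add_sub_cancel_left, cross, PiLp.smul_apply, smul_eq_mul]; ring
    have h1 := hcr _ (hsub _ hz)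
    have h2 := hcr _ (hsub _ h)
    rw [show z + t • rot90 (b - a) - a = (z - a) + t • rot90 (b - a) by abel, cross_add_right, h1,
      zero_add, cross_smul_right, ← inner_rot90, real_inner_self_eq_norm_sq, norm_rot90] at h2
    have : 0 < t * ‖b - a‖ ^ 2 :=
      mul_pos ht (pow_pos (norm_pos_iff.2 (sub_ne_zero.2 hab.symm)) 2)
    linarith

namespace ConvexCurve

variable {r : ℕ}

/-- The pairs `(x, y)` joined by longest paths `P` (with `m` vertices) and `Q` (with `m'`
vertices) such that `(P, Q) ∈ C`. -/
def pairSet (σ : ConvexCurve r) (m m' : ℕ) (C : Set ((ℕ → Plane) × (ℕ → Plane))) :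
    Set (Plane × Plane) :=
  {z | z.1 ∈ σ.table ∧ z.2 ∈ σ.table ∧ ∃ P Q, IsMaxPoly σ.trace m z.1 z.2 P ∧
    IsMaxPoly σ.trace m' z.1 z.2 Q ∧ (P, Q) ∈ C}

/-- Maximality is an intersection of closed conditions: each competitor `E q P` has fixed vertices
`q` and borrows only the end points from `P`, so its length depends continuously on `P`. -/
lemma isCompact_isMaxPoly (σ : ConvexCurve r) (hr : 2 ≤ r) (m : ℕ) :
    IsCompact {P : ℕ → Plane | P 0 ∈ σ.table ∧ P (m + 1) ∈ σ.table ∧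
      IsMaxPoly σ.trace m (P 0) (P (m + 1)) P} := by
  have hT := σ.isCompact_table hr
  have hS := σ.isCompact_trace
  have hK : IsCompact (Set.univ.pi fun _ : ℕ => σ.table) := isCompact_univ_pi fun _ => hT
  refine hK.of_isClosed_subset ?_ ?_
  · let E : (ℕ → Plane) → (ℕ → Plane) → (ℕ → Plane) :=
      fun q P i => if i = 0 then P 0 else if i ≤ m then q i else P (m + 1)
    have hE : ∀ q, Continuous (E q) := by
      intro q
      refine continuous_pi fun i => ?_
      simp only [E]
      split_ifs <;> fun_prop
    have heq : {P : ℕ → Plane | P 0 ∈ σ.table ∧ P (m + 1) ∈ σ.table ∧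
        IsMaxPoly σ.trace m (P 0) (P (m + 1)) P} =
        {P | P 0 ∈ σ.table} ∩ {P | P (m + 1) ∈ σ.table} ∩
        (⋂ i, {P | m + 1 ≤ i → P i = P (m + 1)}) ∩ (⋂ i, {P | 1 ≤ i → i ≤ m → P i ∈ σ.trace}) ∩
        (⋂ q : ℕ → σ.trace, {P | polyLen m (E (fun i => q i) P) ≤ polyLen m P}) := by
      ext P
      simp only [Set.mem_inter_iff, Set.mem_iInter, Set.mem_ofPred_eq]
      constructor
      · rintro ⟨h1, h2, h⟩
        refine ⟨⟨⟨⟨h1, h2⟩, h.tail⟩, h.mem⟩, fun q => h.le _ ⟨?_, ?_, ?_⟩⟩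
        · simp [E]
        · intro i hi
          simp only [E]; rw [if_neg (by omega), if_neg (by omega)]
        · intro i h1 h2
          simp only [E]; rw [if_neg (by omega), if_pos h2]; exact (q i).2
      · rintro ⟨⟨⟨⟨h1, h2⟩, h3⟩, h4⟩, h5⟩
        refine ⟨h1, h2, ⟨rfl, h3, h4⟩, fun Q hQ => ?_⟩
        obtain ⟨z, hz⟩ := σ.trace_nonempty
        classical
        have := h5 fun i => if h : 1 ≤ i ∧ i ≤ m then ⟨Q i, hQ.mem i h.1 h.2⟩ else ⟨z, hz⟩
        refine le_trans (polyLen_congr fun i _ => ?_).le this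
        simp only [E]
        split_ifs with a b c
        · subst a; exact hQ.zero
        · rfl
        · omega
        · exact hQ.tail i (by omega)
    rw [heq]
    refine IsClosed.inter (IsClosed.inter (IsClosed.inter (IsClosed.inter ?_ ?_) ?_) ?_) ?_
    · exact hT.isClosed.preimage (continuous_apply 0)
    · exact hT.isClosed.preimage (continuous_apply (m + 1))
    · refine isClosed_iInter fun i => ?_
      by_cases hi : m + 1 ≤ i
      · simp only [hi, true_imp_iff]
        exact isClosed_eq (continuous_apply i) (continuous_apply (m + 1))
      · simp [hi]
    · refine isClosed_iInter fun i => ?_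
      by_cases hi : 1 ≤ i ∧ i ≤ m
      · simp only [hi.1, hi.2, true_imp_iff]
        exact hS.isClosed.preimage (continuous_apply i)
      · by_cases h1 : 1 ≤ i
        · have : ¬ i ≤ m := fun h => hi ⟨h1, h⟩
          simp [this]
        · simp [h1]
    · refine isClosed_iInter fun q => ?_
      exact isClosed_le ((continuous_polyLen m).comp (hE _)) (continuous_polyLen m)
  · rintro P ⟨h1, h2, h⟩ i -
    by_cases hi : i ≤ m + 1
    · exact h.mem_table h1 h2 i hi
    · rw [h.tail i (by omega)]; exact h2

/-- The set is the image of a compact set of pairs of longest paths under the projection to the end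
points. This is why the exceptional sets defined by closed conditions on longest paths are closed.
-/
lemma isClosed_pairSet (σ : ConvexCurve r) (hr : 2 ≤ r) (m m' : ℕ)
    {C : Set ((ℕ → Plane) × (ℕ → Plane))} (hC : IsClosed C) : IsClosed (σ.pairSet m m' C) := by
  have h1 := (σ.isCompact_isMaxPoly hr m).prod (σ.isCompact_isMaxPoly hr m')
  have h2 : IsClosed (C ∩ {p | p.1 0 = p.2 0} ∩
      {p : (ℕ → Plane) × (ℕ → Plane) | p.1 (m + 1) = p.2 (m' + 1)}) :=
    (hC.inter (isClosed_eq (by fun_prop) (by fun_prop))).inter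
      (isClosed_eq (by fun_prop) (by fun_prop))
  have h3 := (h1.inter_right h2).image
    (f := fun p : (ℕ → Plane) × (ℕ → Plane) => (p.1 0, p.1 (m + 1))) (by fun_prop)
  convert h3.isClosed using 1
  ext ⟨x, y⟩
  constructor
  · rintro ⟨hx, hy, P, Q, hP, hQ, hPQ⟩
    refine ⟨(P, Q), ⟨⟨?_, ?_⟩, ⟨hPQ, ?_⟩, ?_⟩, ?_⟩
    · refine ⟨?_, ?_, ?_⟩ <;> simp only [hP.zero, hP.last]
      exacts [hx, hy, hP]
    · refine ⟨?_, ?_, ?_⟩ <;> simp only [hQ.zero, hQ.last]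
      exacts [hx, hy, hQ]
    · exact hP.zero.trans hQ.zero.symm
    · exact hP.last.trans hQ.last.symm
    · exact Prod.ext hP.zero hP.last
  · rintro ⟨⟨P, Q⟩, ⟨⟨⟨a1, a2, a3⟩, ⟨b1, b2, b3⟩⟩, ⟨hC, e1⟩, e2⟩, he⟩
    dsimp only at *
    obtain ⟨rfl, rfl⟩ := Prod.mk.inj he
    refine ⟨a1, a2, P, Q, a3, ?_, hC⟩
    dsimp only
    rw [Set.mem_ofPred_eq] at e1 e2
    dsimp only at e1 e2
    rw [e1, e2]; exact b3

/-- The pairs of interior points. -/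
def interiorPairs (σ : ConvexCurve r) : Set (Plane × Plane) :=
  interior σ.table ×ˢ interior σ.table

lemma isClosed_setOf_mem_segment {X : Type*} [TopologicalSpace X] {f g h : X → Plane}
    (hf : Continuous f) (hg : Continuous g) (hh : Continuous h) :
    IsClosed {p | f p ∈ segment ℝ (g p) (h p)} := by
  simp only [mem_segment_iff_dist]
  exact isClosed_eq (by fun_prop) (by fun_prop)

/-- Pairs with longest paths starting in opposite directions. -/
lemma avoidable_opposite (σ : ConvexCurve r) (hr : 2 ≤ r) (m m' : ℕ) :
    Avoidable σ.interiorPairs (σ.pairSet m m' {p | p.1 0 ∈ segment ℝ (p.1 1) (p.2 1)}) := by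
  refine ⟨σ.isClosed_pairSet hr m m' (isClosed_setOf_mem_segment (by fun_prop) (by fun_prop)
    (by fun_prop)), fun O hO ho hne => ?_⟩
  by_contra hsub
  rw [Set.not_nonempty_iff_eq_empty, Set.sdiff_eq_empty] at hsub
  obtain ⟨⟨x, y⟩, hz⟩ := hne
  obtain ⟨-, -, P, Q, hP, hQ, hc⟩ := hsub hz
  obtain ⟨x', hx', hseg⟩ := exists_notMem_segment (U := {x' | (x', y) ∈ O})
    (ho.preimage (by fun_prop : Continuous fun x' : Plane => (x', y))) ⟨x, hz⟩ (P 1) (Q 1)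
  obtain ⟨-, -, P', Q', hP', hQ', hc'⟩ := hsub hx'
  dsimp only at hP hQ hP' hQ' hc hc'
  rw [Set.mem_ofPred_eq] at hc hc'
  dsimp only at hc hc'
  rw [hP.zero] at hc
  rw [hP'.zero] at hc'
  -- Consider the sum of the two maximal lengths as a function of the starting point. Keeping the
  -- vertices of `P'` and `Q'` shows that it does not grow from `x` to `x'`. Keeping those of `P`
  -- and `Q` shows that it grows at least by the excess of `x'` in the triangle inequality for `P 1`
  -- and `Q 1`. So the excess is zero and `x'` lies on `[P 1, Q 1]`, against its choice.
  have key : ∀ (m : ℕ) (x x' : Plane) (P P' : ℕ → Plane), IsMaxPoly σ.trace m x y P →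
      IsMaxPoly σ.trace m x' y P' →
      polyLen m P - dist x (P 1) + dist x' (P 1) ≤ polyLen m P' := by
    intro m x x' P P' h h'
    have h1 := h'.le (Function.update P 0 x') ⟨Function.update_self _ _ _, fun i hi => by
      rw [Function.update_of_ne (by omega)]; exact h.tail i hi, fun i h1 h2 => by
      rw [Function.update_of_ne (by omega)]; exact h.mem i h1 h2⟩
    rwa [polyLen_update_zero, h.zero] at h1
  have k1 := key m x x' P P' hP hP'
  have k2 := key m' x x' Q Q' hQ hQ'
  have k3 := key m x' x P' P hP' hP
  have k4 := key m' x' x Q' Q hQ' hQ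
  apply hseg
  rw [mem_segment_iff_dist] at hc hc' ⊢
  have t1 := dist_triangle (P 1) x' (Q 1)
  have t2 := dist_triangle (P' 1) x (Q' 1)
  rw [dist_comm (P 1) x] at hc
  rw [dist_comm (P' 1) x'] at hc'
  rw [dist_comm (P' 1) x] at t2
  refine le_antisymm ?_ t1
  rw [dist_comm (P 1) x']
  linarith

/-- Pairs with a longest path that returns along itself at its vertex of index `j + 1`. -/
def perpSet (σ : ConvexCurve r) (m j : ℕ) : Set (Plane × Plane) :=
  σ.pairSet m m {p | p.1 j ∈ segment ℝ (p.1 (j + 1)) (p.1 (j + 2)) ∨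
    p.1 (j + 2) ∈ segment ℝ (p.1 (j + 1)) (p.1 j)}

lemma isClosed_perpSet (σ : ConvexCurve r) (hr : 2 ≤ r) (m j : ℕ) : IsClosed (σ.perpSet m j) :=
  σ.isClosed_pairSet hr m m (IsClosed.union
    (isClosed_setOf_mem_segment (by fun_prop) (by fun_prop) (by fun_prop))
    (isClosed_setOf_mem_segment (by fun_prop) (by fun_prop) (by fun_prop)))

/-- If two distinct points of the segment `[a, b]` lie on a line through `p`, so does `p`. -/
lemma exists_eq_add_smul {a b x p : Plane} {t t' : ℝ} (htt : t ≠ t')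
    (h : x + t • (x - p) ∈ segment ℝ a b) (h' : x + t' • (x - p) ∈ segment ℝ a b) :
    ∃ c : ℝ, p = a + c • (b - a) := by
  rw [segment_eq_image'] at h h'
  obtain ⟨α, -, hα⟩ := h
  obtain ⟨β, -, hβ⟩ := h'
  dsimp only at hα hβ
  have hne : t - t' ≠ 0 := sub_ne_zero.2 htt
  refine ⟨α - (1 + t) / (t - t') * (α - β), ?_⟩
  have e1 : (t - t') • (x - p) = (α - β) • (b - a) := by
    have : (x + t • (x - p)) - (x + t' • (x - p)) = (a + α • (b - a)) - (a + β • (b - a)) := by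
      rw [hα, hβ]
    rw [sub_smul, sub_smul]
    simpa using this
  have e2 : x - p = ((α - β) / (t - t')) • (b - a) := by
    rw [div_eq_inv_mul, mul_smul, ← e1, smul_smul, inv_mul_cancel₀ hne, one_smul]
  have e3 : p = (x + t • (x - p)) - (1 + t) • (x - p) := by module
  rw [e3, ← hα, e2]
  module

lemma mem_segment_slide (x p : Plane) {t : ℝ} (ht : 0 < t) : x ∈ segment ℝ (x + t • (x - p)) p := by
  refine ⟨1 / (1 + t), t / (1 + t), by positivity, by positivity, by field_simp, ?_⟩
  rw [smul_add, smul_smul, smul_sub]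
  have h1 : (1 + t) ≠ 0 := by positivity
  have : x = ((1 / (1 + t)) * (1 + t)) • x := by rw [one_div_mul_cancel h1, one_smul]
  conv_rhs => rw [this]
  module

/-- Two small shifts of the first point of a pair along a line. -/
lemma exists_slides {O : Set (Plane × Plane)} (ho : IsOpen O) {x y : Plane} (hz : (x, y) ∈ O)
    (p : Plane) : ∃ t t' : ℝ, 0 < t ∧ 0 < t' ∧ t ≠ t' ∧ (x + t • (x - p), y) ∈ O ∧
      (x + t' • (x - p), y) ∈ O := by
  have hc : Filter.Tendsto (fun t : ℝ => (x + t • (x - p), y)) (𝓝[>] 0) (𝓝 (x, y)) := by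
    have : Continuous (fun t : ℝ => (x + t • (x - p), y)) := by fun_prop
    simpa using (this.tendsto 0).mono_left nhdsWithin_le_nhds
  have hev := hc.eventually (ho.mem_nhds hz)
  obtain ⟨ε, hε, h⟩ := (mem_nhdsGT_iff_exists_Ioo_subset).1 hev
  have hε' : (0:ℝ) < ε := hε
  exact ⟨ε / 2, ε / 3, by positivity, by positivity, by
    intro h; linarith, h ⟨by positivity, by linarith⟩, h ⟨by positivity, by linarith⟩⟩

/-- Pairs with a longest path that passes through its starting point again. -/
lemma avoidable_return (σ : ConvexCurve r) (hr : 2 ≤ r) {m k : ℕ} (hk1 : 1 ≤ k) (hkm : k ≤ m)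
    (hperp : ∀ j, j < m → Avoidable σ.interiorPairs (σ.perpSet m j)) :
    Avoidable σ.interiorPairs (σ.pairSet m m {p | p.1 0 ∈ segment ℝ (p.1 k) (p.1 (k + 1))}) := by
  refine ⟨σ.isClosed_pairSet hr m m (isClosed_setOf_mem_segment (by fun_prop) (by fun_prop)
    (by fun_prop)), fun O hO ho hne => ?_⟩
  by_contra hsub
  rw [Set.not_nonempty_iff_eq_empty, Set.sdiff_eq_empty] at hsub
  obtain ⟨O', hO', ho', ⟨⟨x, y⟩, hz⟩, hdis⟩ := Avoidable.exists_open_finset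
    (B := fun j => σ.perpSet m j) (Finset.range m)
    (fun j hj => hperp j (Finset.mem_range.1 hj)) hO ho hne
  have hint : ∀ {x y}, (x, y) ∈ O' → x ∈ interior σ.table ∧ y ∈ interior σ.table :=
    fun h => hO (hO' h)
  have noperp : ∀ {x y P j}, (x, y) ∈ O' → IsMaxPoly σ.trace m x y P → j < m →
      ¬ (P j ∈ segment ℝ (P (j + 1)) (P (j + 2)) ∨ P (j + 2) ∈ segment ℝ (P (j + 1)) (P j)) := by
    intro x y P j h hP hj hor
    exact Set.disjoint_left.1 (hdis j (Finset.mem_range.2 hj)) h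
      ⟨interior_subset (hint h).1, interior_subset (hint h).2, P, P, hP, hP, hor⟩
  have hxi := (hint hz).1
  have hyi := (hint hz).2
  have hx := interior_subset hxi
  have hy := interior_subset hyi
  have hxS := σ.notMem_trace_of_mem_interior hr hxi
  have hyS := σ.notMem_trace_of_mem_interior hr hyi
  obtain ⟨P, hP⟩ := exists_isMaxPoly σ.isCompact_trace σ.trace_nonempty m x y
  have hm : 1 ≤ m := hk1.trans hkm
  have hP1 := hP.mem 1 le_rfl hm
  have hxP : x ≠ P 1 := fun e => hxS (e ▸ hP1)
  -- Away from the perpendicular paths no longest path repeats a vertex.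
  have noturn : ∀ i j, 1 ≤ i → i < j → j ≤ m → P i ≠ P j := by
    intro i j hi hij hj he
    obtain ⟨l, hl, hll⟩ := hP.exists_turn hr hx hy hi hij hj he
    refine noperp hz hP (j := l) (by omega) (Or.inl ?_)
    rw [hll]; exact right_mem_segment ℝ _ _
  -- after sliding the starting point, the longest path keeps its vertices
  have hslide : ∀ t : ℝ, 0 < t → (x + t • (x - P 1), y) ∈ O' →
      x + t • (x - P 1) ∈ segment ℝ (P k) (P (k + 1)) := by
    intro t ht hO1
    obtain ⟨-, -, Q, Q₂, hQ, -, hc⟩ := hsub (hO' hO1)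
    rw [Set.mem_ofPred_eq] at hc
    dsimp only at hQ hc
    have hne : x ≠ x + t • (x - P 1) := by
      intro e
      rw [left_eq_add, smul_eq_zero] at e
      exact e.elim ht.ne' (fun h => hxP (sub_eq_zero.1 h))
    have e := fun l h1 h2 => hP.slide_unique hr hx hy (interior_subset (hint hO1).1) hne
      (mem_segment_slide x (P 1) ht) hxS hQ (l := l) h1 h2
    rw [hQ.zero, e k hk1 hkm] at hc
    by_cases hk : k + 1 ≤ m
    · rwa [e (k + 1) (by omega) hk] at hc
    · rwa [hQ.tail (k + 1) (by omega), ← hP.tail (k + 1) (by omega)] at hc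
  -- Two slid starting points lie on the line through `x` and `P 1` and also on the fixed segment
  -- `[P k, P (k + 1)]`, so both lines agree and `P 1` is on the line through `P k` and `P (k + 1)`.
  obtain ⟨t, t', ht, ht', htt, hO1, hO2⟩ := exists_slides ho' hz (P 1)
  have s1 := hslide t ht hO1
  have s2 := hslide t' ht' hO2
  have hPs := hP.slide (mem_segment_slide x (P 1) ht)
  have nofirst : ¬ x + t • (x - P 1) ∈ segment ℝ (P 1) (P 2) := by
    intro h
    refine noperp hO1 hPs (j := 0) (by omega) (Or.inl ?_)
    rw [Function.update_self, Function.update_of_ne (by omega), Function.update_of_ne (by omega)]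
    exact h
  have hk2 : 2 ≤ k := by
    by_contra h
    have : k = 1 := by omega
    subst this
    exact nofirst s1
  obtain ⟨c, hc⟩ := exists_eq_add_smul htt s1 s2
  have hPk := hP.mem k hk1 hkm
  have hTk := hP.mem_table hx hy k (by omega)
  have hTk1 := hP.mem_table hx hy (k + 1) (by omega)
  have hne1k : P 1 ≠ P k := noturn 1 k le_rfl (by omega) hkm
  -- the position of `P 1` on the line through `P k` and `P (k + 1)`
  have hc1 : 1 < c := by
    by_contra! hc1
    rcases lt_or_ge c 0 with hc0 | hc0
    · have : P k ∈ segment ℝ (P 1) (P (k + 1)) := by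
        have h1c : 0 < 1 - c := by linarith
        refine ⟨1 / (1 - c), -c / (1 - c), by positivity, div_nonneg (by linarith) h1c.le,
          by field_simp; ring, ?_⟩
        rw [hc]
        have : P k = ((1 / (1 - c)) * (1 - c)) • P k := by
          rw [one_div_mul_cancel h1c.ne', one_smul]
        conv_rhs => rw [this]
        module
      rcases σ.eq_or_eq_of_mem_segment hr (σ.trace_subset_table hP1) hTk1 hPk this with h | h
      · exact hne1k h.symm
      · exact hP.ne_succ hr hx hy hm hkm h
    · have : P 1 ∈ segment ℝ (P k) (P (k + 1)) := by
        rw [segment_eq_image']; exact ⟨c, ⟨hc0, hc1⟩, hc.symm⟩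
      rcases σ.eq_or_eq_of_mem_segment hr hTk hTk1 hP1 this with h | h
      · exact hne1k h
      · by_cases hk : k + 1 ≤ m
        · exact noturn 1 (k + 1) le_rfl (by omega) hk h
        · rw [hP.tail (k + 1) (by omega)] at h
          exact hyS (h ▸ hP1)
  -- In the remaining position `P (k + 1)` lies between two different boundary points; were it a
  -- vertex, it would coincide with one of them. So it is the end point `y`.
  have hmid : P (k + 1) ∈ segment ℝ (P k) (P 1) := by
    rw [segment_eq_image']
    refine ⟨1 / c, ⟨by positivity, (div_le_one (by linarith)).2 hc1.le⟩, ?_⟩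
    dsimp only
    rw [hc, add_sub_cancel_left, smul_smul, one_div_mul_cancel (by linarith), one_smul,
      add_sub_cancel]
  have hkm' : k = m := by
    by_contra hk
    rcases σ.eq_or_eq_of_mem_segment hr hTk (σ.trace_subset_table hP1)
      (hP.mem (k + 1) (by omega) (by omega)) hmid with h | h
    · exact hP.ne_succ hr hx hy hm hkm h.symm
    · exact noturn 1 (k + 1) le_rfl (by omega) (by omega) h.symm
  subst hkm'
  rw [hP.last] at hmid s1
  -- extend the end point to `P 1` and reverse the loop at `P 1`
  have hrev := hP.polyRev
  have hr1 : polyRev k P 1 = P k := by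
    rw [polyRev, show k + 1 - 1 = k by omega]
  have hsegy : y ∈ segment ℝ (P 1) (polyRev k P 1) := by
    rw [hr1, segment_symm]; exact hmid
  have hext := (hrev.slide hsegy).polyRev
  have hT1 := σ.trace_subset_table hP1
  set R' := polyRev k (Function.update (polyRev k P) 0 (P 1)) with hR'
  have eR : ∀ l, 1 ≤ l → l ≤ k → R' l = P l := by
    intro l h1 h2
    rw [hR', polyRev, Function.update_of_ne (by omega), polyRev,
      show k + 1 - (k + 1 - l) = l by omega]
  have hloop := (hext.polyRevBlock (i := 1) (j := k + 1) (by omega) le_rfl le_rfl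
    (by rw [hext.last, eR 1 le_rfl hk1])).polyRev
  -- Sliding the end point from `y` to `P 1` makes the longest path unique, so it agrees with the
  -- version whose loop at `P 1` is reversed. Comparison of the vertices of index `2` gives `P k = P
  -- 2`.
  have huniq := hrev.slide_unique hr hy hx hT1 (fun e => hyS (e ▸ hP1)) hsegy hyS hloop
    (l := k - 1) (by omega) (by omega)
  rw [polyRev, polyRev, show k + 1 - (k - 1) = 2 by omega, polyRevBlock, if_pos (by omega),
    show 1 + (k + 1) - 2 = k by omega, eR k hk1 le_rfl] at huniq
  have hk2' : k = 2 := by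
    by_contra h
    exact noturn 2 k (by omega) (by omega) le_rfl huniq.symm
  subst hk2'
  apply nofirst
  rw [segment_symm]
  exact (convex_segment (P 2) (P 1)).segment_subset (left_mem_segment ℝ _ _) hmid s1

end ConvexCurve
end

/-! ### Returns to the end point and shared vertices -/

noncomputable section

lemma Avoidable.mono {X : Type*} [TopologicalSpace X] {Ω B B' : Set X} (h : Avoidable Ω B')
    (hB : IsClosed B) (hsub : B ⊆ B') : Avoidable Ω B :=
  ⟨hB, fun O h1 h2 h3 => (h.2 O h1 h2 h3).mono (Set.sdiff_subset_sdiff_right hsub)⟩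

namespace ConvexCurve

variable {r : ℕ}

lemma avoidable_swap {σ : ConvexCurve r} {B : Set (Plane × Plane)}
    (h : Avoidable σ.interiorPairs B) : Avoidable σ.interiorPairs (Prod.swap ⁻¹' B) := by
  refine ⟨h.1.preimage continuous_swap, fun O h1 h2 h3 => ?_⟩
  obtain ⟨⟨x, y⟩, hz, hzO⟩ := h.2 (Prod.swap ⁻¹' O) (fun p hp => ⟨(h1 hp).2, (h1 hp).1⟩)
    (h2.preimage continuous_swap) (by obtain ⟨p, hp⟩ := h3; exact ⟨p.swap, by simpa using hp⟩)
  exact ⟨(y, x), hz, hzO⟩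

/-- Pairs with a longest path that passes through its end point before. -/
lemma avoidable_return_end (σ : ConvexCurve r) (hr : 2 ≤ r) {m k : ℕ} (hkm : k < m)
    (hperp : ∀ j, j < m → Avoidable σ.interiorPairs (σ.perpSet m j)) :
    Avoidable σ.interiorPairs
      (σ.pairSet m m {p | p.1 (m + 1) ∈ segment ℝ (p.1 k) (p.1 (k + 1))}) := by
  refine (avoidable_swap (σ.avoidable_return hr (m := m) (k := m - k) (by omega) (by omega)
    hperp)).mono (σ.isClosed_pairSet hr m m (isClosed_setOf_mem_segment (by fun_prop) (by fun_prop)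
    (by fun_prop))) ?_
  rintro ⟨x, y⟩ ⟨hx, hy, P, Q, hP, hQ, hc⟩
  refine ⟨hy, hx, _, _, hP.polyRev, hQ.polyRev, ?_⟩
  rw [Set.mem_ofPred_eq] at hc ⊢
  dsimp only at hc ⊢
  rw [polyRev, polyRev, polyRev, show m + 1 - (m - k) = k + 1 by omega,
    show m + 1 - (m - k + 1) = k by omega, segment_symm]
  exact hc

/-- If two longest paths to `y` share a vertex of the same index, they start on the same ray. -/
lemma eq_first_of_eq_vertex {σ : ConvexCurve r} (hr : 2 ≤ r) {m j : ℕ} {x x' y : Plane}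
    {Q Q' : ℕ → Plane} (hQ : IsMaxPoly σ.trace m x y Q) (hQ' : IsMaxPoly σ.trace m x' y Q')
    (hx : x ∈ σ.table) (hx' : x' ∈ σ.table) (hy : y ∈ σ.table) (hj1 : 1 ≤ j) (hjm : j ≤ m)
    (he : Q j = Q' j) : Q 1 = Q' 1 ∧ unitDir (Q 1) x = unitDir (Q 1) x' := by
  have hm : 1 ≤ m := hj1.trans hjm
  have hsp : ∀ {x Q x' Q'}, IsMaxPoly σ.trace m x y Q → IsMaxPoly σ.trace m x' y Q' →
      IsPolyPath σ.trace m x y (polySplice j Q Q') := by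
    intro x Q x' Q' h h'
    refine ⟨?_, fun i hi => ?_, fun i h1 h2 => ?_⟩ <;> unfold polySplice
    · rw [if_pos (by omega)]; exact h.zero
    · rw [if_neg (by omega)]; exact h'.tail i hi
    · split_ifs
      · exact h.mem i h1 h2
      · exact h'.mem i h1 h2
  have l1 := hQ.le _ (hsp hQ hQ')
  have l2 := hQ'.le _ (hsp hQ' hQ)
  -- Maximality of both paths shows that the tails after the common vertex are equally long, so the
  -- spliced path is longest as well.
  have hR : IsMaxPoly σ.trace m x y (polySplice j Q Q') := by
    refine hQ.of_len (hsp hQ hQ') ?_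
    rw [polyLen_polySplice (by omega) he] at l1 ⊢
    rw [polyLen_polySplice (by omega) he.symm, polyLen_split m j (by omega) Q'] at l2
    rw [polyLen_split m j (by omega) Q]
    linarith
  obtain ⟨j, rfl⟩ : ∃ i, j = i + 1 := ⟨j - 1, by omega⟩
  have r1 := hQ.refl hr hx hy (j := j) (by omega)
  have r2 := hR.refl hr hx hy (j := j) (by omega)
  have s0 : polySplice (j + 1) Q Q' j = Q j := by unfold polySplice; rw [if_pos (by omega)]
  have s1 : polySplice (j + 1) Q Q' (j + 1) = Q (j + 1) := by
    unfold polySplice; rw [if_pos le_rfl]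
  have s2 : polySplice (j + 1) Q Q' (j + 2) = Q' (j + 2) := by
    unfold polySplice; rw [if_neg (by omega)]
  rw [s0, s1, s2] at r2
  have r3 := hQ'.refl hr hx' hy (j := j) (by omega)
  rw [← he] at r3
  have T := hQ.mem_table hx hy
  have T' := hQ'.mem_table hx' hy
  have n := fun i hi => hQ.ne_succ hr hx hy hm (i := i) hi
  have n' := fun i hi => hQ'.ne_succ hr hx' hy hm (i := i) hi
  have n2 := n' (j + 1) (by omega)
  have n0 := n' j (by omega)
  rw [← he] at n0 n2
  -- `Q` and the spliced path arrive at the vertex together, hence leave it in the same direction.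
  -- The reflection law read backwards then makes the incoming directions of `Q` and `Q'` agree, and
  -- this propagates down to the first vertex.
  have d := r1.unitDir_eq hr r2 rfl (T (j + 2) (by omega)) (T' (j + 2) (by omega))
    (n (j + 1) (by omega)).symm n2.symm
  have d' := r1.symm.unitDir_eq hr r3.symm d (T j (by omega)) (T' j (by omega))
    (n j (by omega)) n0
  have hdown : ∀ l, l ≤ j → Q (l + 1) = Q' (l + 1) →
      unitDir (Q (l + 1)) (Q l) = unitDir (Q (l + 1)) (Q' l) →
      Q 1 = Q' 1 ∧ unitDir (Q 1) (Q 0) = unitDir (Q 1) (Q' 0) := by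
    intro l
    induction l with
    | zero => exact fun _ h1 h2 => ⟨h1, h2⟩
    | succ l ih =>
      intro hl h1 h2
      have k0 := n' (l + 1) (by omega)
      rw [← h1] at k0
      have e1 : Q (l + 1) = Q' (l + 1) :=
        σ.eq_of_unitDir_eq hr (T (l + 2) (by omega)) (hQ.mem _ (by omega) (by omega))
          (hQ'.mem _ (by omega) (by omega)) (n (l + 1) (by omega)) k0 h2
      refine ih (by omega) e1 ?_
      have q1 := hQ.refl hr hx hy (j := l) (by omega)
      have q2 := hQ'.refl hr hx' hy (j := l) (by omega)
      have k1 := n' l (by omega)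
      rw [← e1] at q2 k1
      exact q1.symm.unitDir_eq hr q2.symm (by rw [h1]) (T l (by omega)) (T' l (by omega))
        (n l (by omega)) k1
  have := hdown j le_rfl he d'
  rwa [hQ.zero, hQ'.zero] at this

/-- Pairs with longest paths of different numbers of vertices that share a vertex. -/
lemma avoidable_shared (σ : ConvexCurve r) (hr : 2 ≤ r) {m m' i j : ℕ} (hmm : m < m') (hi1 : 1 ≤ i)
    (him : i ≤ m) (hj1 : 1 ≤ j) (hjm : j ≤ m')
    (hperp : ∀ j, j < m' → Avoidable σ.interiorPairs (σ.perpSet m' j)) :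
    Avoidable σ.interiorPairs (σ.pairSet m m' {p | p.1 i = p.2 j}) := by
  refine ⟨σ.isClosed_pairSet hr m m' (isClosed_eq (by fun_prop) (by fun_prop)),
    fun O hO ho hne => ?_⟩
  by_contra hsub
  rw [Set.not_nonempty_iff_eq_empty, Set.sdiff_eq_empty] at hsub
  obtain ⟨O₁, hO₁, ho₁, hne₁, hd1⟩ := (σ.avoidable_opposite hr m m').exists_open hO ho hne
  obtain ⟨O', hO', ho', ⟨⟨x, y⟩, hz⟩, hd2⟩ :=
    (σ.avoidable_return_end hr hmm hperp).exists_open (hO₁.trans hO) ho₁ hne₁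
  have hint : ∀ {x y}, (x, y) ∈ O' → x ∈ interior σ.table ∧ y ∈ interior σ.table :=
    fun h => hO (hO₁ (hO' h))
  have hxi := (hint hz).1
  have hyi := (hint hz).2
  have hx := interior_subset hxi
  have hy := interior_subset hyi
  have hxS := σ.notMem_trace_of_mem_interior hr hxi
  have hyS := σ.notMem_trace_of_mem_interior hr hyi
  obtain ⟨P, hP⟩ := exists_isMaxPoly σ.isCompact_trace σ.trace_nonempty m x y
  have hm : 1 ≤ m := hi1.trans him
  have hP1 := hP.mem 1 le_rfl hm
  have hxP : x ≠ P 1 := fun e => hxS (e ▸ hP1)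
  have hslide : ∀ t : ℝ, 0 < t → (x + t • (x - P 1), y) ∈ O' →
      ∃ Q, IsMaxPoly σ.trace m' (x + t • (x - P 1)) y Q ∧ Q j = P i := by
    intro t ht hO1
    obtain ⟨-, -, R, Q, hR, hQ, hc⟩ := hsub (hO₁ (hO' hO1))
    rw [Set.mem_ofPred_eq] at hc
    dsimp only at hR hQ hc
    have hne : x ≠ x + t • (x - P 1) := by
      intro e
      rw [left_eq_add, smul_eq_zero] at e
      exact e.elim ht.ne' (fun h => hxP (sub_eq_zero.1 h))
    refine ⟨Q, hQ, hc.symm.trans ?_⟩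
    exact hP.slide_unique hr hx hy (interior_subset (hint hO1).1) hne
      (mem_segment_slide x (P 1) ht) hxS hR hi1 him
  -- Sliding `x` along the first segment of `P` does not move `P i`. So longest paths with `m'`
  -- vertices from two slid positions share a vertex of the same index, hence also the first vertex
  -- and the ray leading to it.
  obtain ⟨t, t', ht, ht', htt, hO1, hO2⟩ := exists_slides ho' hz (P 1)
  obtain ⟨Q, hQ, hQj⟩ := hslide t ht hO1
  obtain ⟨Q', hQ', hQj'⟩ := hslide t' ht' hO2
  have hPs := hP.slide (mem_segment_slide x (P 1) ht)
  set w := x + t • (x - P 1) with hw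
  set w' := x + t' • (x - P 1) with hw'
  have hwi := (hint hO1).1
  have hwT := interior_subset hwi
  have hwT' := interior_subset (hint hO2).1
  have hwS := σ.notMem_trace_of_mem_interior hr hwi
  obtain ⟨e1, hd⟩ := eq_first_of_eq_vertex hr hQ hQ' hwT hwT' hy hj1 hjm (hQj.trans hQj'.symm)
  have hQ1 := hQ.mem 1 le_rfl (by omega)
  have hwQ : w ≠ Q 1 := fun e => hwS (e ▸ hQ1)
  have hwP : w ≠ P 1 := fun e => hwS (e ▸ hP1)
  -- `Q 1` lies on the line through `w` and `P 1`
  have hline : ∃ c : ℝ, Q 1 = w + c • (P 1 - w) := by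
    have a1 := eq_add_dist_smul_unitDir (Q 1) w
    have a2 := eq_add_dist_smul_unitDir (Q 1) w'
    rw [← hd] at a2
    have hne : dist (Q 1) w - dist (Q 1) w' ≠ 0 := by
      intro h
      have : w = w' := by rw [a1, a2, sub_eq_zero.1 h]
      have h2 : (t - t') • (x - P 1) = 0 := by
        rw [sub_smul, sub_eq_zero]; rw [hw, hw'] at this; exact add_left_cancel this
      rcases smul_eq_zero.1 h2 with h3 | h3
      · exact htt (sub_eq_zero.1 h3)
      · exact hxP (sub_eq_zero.1 h3)
    have b1 : (dist (Q 1) w - dist (Q 1) w') • unitDir (Q 1) w = (t - t') • (x - P 1) := by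
      rw [sub_smul, sub_smul]
      have h1 : dist (Q 1) w • unitDir (Q 1) w = w - Q 1 := eq_sub_of_add_eq' a1.symm
      have h2 : dist (Q 1) w' • unitDir (Q 1) w = w' - Q 1 := eq_sub_of_add_eq' a2.symm
      rw [h1, h2, hw, hw']; abel
    have b2 : P 1 - w = -((1 + t) • (x - P 1)) := by rw [hw]; module
    have b3 : unitDir (Q 1) w = (dist (Q 1) w - dist (Q 1) w')⁻¹ • (t - t') • (x - P 1) := by
      rw [← b1, smul_smul, inv_mul_cancel₀ hne, one_smul]
    have b4 : Q 1 = w - dist (Q 1) w • unitDir (Q 1) w := eq_sub_of_add_eq a1.symm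
    have h1t : (1 + t) ≠ 0 := by positivity
    refine ⟨dist (Q 1) w * ((dist (Q 1) w - dist (Q 1) w')⁻¹ * (t - t')) / (1 + t), ?_⟩
    rw [b2, smul_neg, smul_smul, div_mul_cancel₀ _ h1t, ← sub_eq_add_neg]
    refine b4.trans ?_
    rw [b3, smul_smul, smul_smul, mul_assoc]
  obtain ⟨c, hc⟩ := hline
  -- For `c < 0` the paths start in opposite directions. Otherwise `Q` follows the slid path up to
  -- its last vertex and, since `m < m'`, runs through `y` before its own end. Both situations were
  -- excluded by shrinking `O`.
  rcases lt_or_ge c 0 with hc0 | hc0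
  · refine Set.disjoint_left.1 hd1 (hO' hO1) ⟨hwT, interior_subset (hint hO1).2, _, Q, hPs, hQ, ?_⟩
    rw [Set.mem_ofPred_eq]
    dsimp only
    rw [Function.update_self, Function.update_of_ne one_ne_zero]
    have h1c : 0 < 1 - c := by linarith
    refine ⟨-c / (1 - c), 1 / (1 - c), div_nonneg (by linarith) h1c.le, by positivity,
      by field_simp; ring, ?_⟩
    rw [hc]
    have : w = ((1 / (1 - c)) * (1 - c)) • w := by rw [one_div_mul_cancel h1c.ne', one_smul]
    conv_rhs => rw [this]
    module
  · have hc0' : 0 < c := by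
      rcases hc0.eq_or_lt with rfl | h
      · rw [zero_smul, add_zero] at hc; exact absurd hc.symm hwQ
      · exact h
    have hdir : unitDir w (Q 1) = unitDir w (P 1) := by
      have : Q 1 = w + (c * dist w (P 1)) • unitDir w (P 1) := by
        rw [mul_smul, eq_sub_of_add_eq' (eq_add_dist_smul_unitDir w (P 1)).symm]; exact hc
      rw [this, unitDir_add_smul (norm_unitDir hwP) (mul_pos hc0' (dist_pos.2 hwP))]
    have e2 : Q 1 = P 1 := σ.eq_of_unitDir_eq hr hwT hQ1 hP1 hwQ.symm hwP.symm hdir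
    obtain ⟨m, rfl⟩ : ∃ k, m = k + 1 := ⟨m - 1, by omega⟩
    obtain ⟨e3, hd3⟩ := hPs.eq_of_first_eq hr hQ hwT hy hwT hy
      (by rw [Function.update_of_ne one_ne_zero]; exact e2.symm) rfl (l := m) (by omega) (by omega)
    have hlast := hPs.last
    rw [show m + 2 = m + 1 + 1 by rfl, hlast] at hd3
    rw [e3] at hd3
    have hTm := hQ.mem_table hwT hy (m + 1) (by omega)
    have hTm' := hQ.mem_table hwT hy (m + 2) (by omega)
    have hnm := hQ.ne_succ hr hwT hy (by omega) (i := m + 1) (by omega)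
    refine Set.disjoint_left.1 hd2 hO1 ⟨hwT, hy, Q, Q, hQ, hQ, ?_⟩
    rw [Set.mem_ofPred_eq]
    dsimp only
    rw [hQ.last]
    rcases le_total (dist (Q (m + 1)) y) (dist (Q (m + 1)) (Q (m + 2))) with hle | hle
    · exact mem_segment_of_unitDir_eq hd3 hle
    · rcases σ.eq_or_eq_of_mem_segment hr hTm hy (hQ.mem (m + 2) (by omega) (by omega))
        (mem_segment_of_unitDir_eq hd3.symm hle) with h | h
      · exact absurd h.symm hnm
      · rw [show m + 1 + 1 = m + 2 by rfl, h]; exact right_mem_segment ℝ _ _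

end ConvexCurve
end

open scoped NNReal
noncomputable section

/-! ### Longest paths that hit the boundary perpendicularly -/

/-- The image of a set under a relation that is locally a Lipschitz function does not have larger
Hausdorff dimension. -/
lemma dimH_image_rel_le {X Y : Type*} [MetricSpace X] [MetricSpace Y] [SecondCountableTopology X]
    [SecondCountableTopology Y] {R : X → Y → Prop}
    (hR : ∀ a b, R a b → ∃ N ∈ 𝓝 (a, b), ∃ C : ℝ≥0, ∀ p ∈ N, ∀ q ∈ N, R p.1 p.2 → R q.1 q.2 →
      dist p.2 q.2 ≤ C * dist p.1 q.1) (Z : Set X) :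
    dimH {b | ∃ a ∈ Z, R a b} ≤ dimH Z := by
  classical
  choose! N hN C hC using hR
  -- Countably many of the neighbourhoods cover the relation, and inside each of them it is the
  -- graph of a Lipschitz function on a subset of `X`.
  obtain ⟨T, hT, hTc, hcov⟩ := TopologicalSpace.countable_cover_nhdsWithin
    (s := {p : X × Y | R p.1 p.2}) (f := fun p => N p.1 p.2)
    (fun p hp => mem_nhdsWithin_of_mem_nhds (hN p.1 p.2 hp))
  have hsub : {b | ∃ a ∈ Z, R a b} ⊆ ⋃ p ∈ T, {b | ∃ a ∈ Z, R a b ∧ (a, b) ∈ N p.1 p.2} := by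
    rintro b ⟨a, ha, hab⟩
    obtain ⟨p, hp, hpN⟩ := Set.mem_iUnion₂.1 (hcov (show (a, b) ∈ _ from hab))
    exact Set.mem_iUnion₂.2 ⟨p, hp, a, ha, hab, hpN⟩
  refine (dimH_mono hsub).trans ?_
  rw [dimH_bUnion hTc]
  refine iSup₂_le fun p hp => ?_
  rcases isEmpty_or_nonempty Y with hY | ⟨⟨y0⟩⟩
  · rw [Set.eq_empty_of_isEmpty {b | ∃ a ∈ Z, R a b ∧ (a, b) ∈ N p.1 p.2}, dimH_empty]
    exact zero_le
  let A : Set X := {a ∈ Z | ∃ b, R a b ∧ (a, b) ∈ N p.1 p.2}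
  let g : X → Y := fun a => if h : ∃ b, R a b ∧ (a, b) ∈ N p.1 p.2 then h.choose else y0
  have hg : ∀ a ∈ A, R a (g a) ∧ (a, g a) ∈ N p.1 p.2 := by
    rintro a ⟨-, h⟩
    simp only [g, dif_pos h]
    exact h.choose_spec
  have hp' : R p.1 p.2 := hT hp
  have himg : {b | ∃ a ∈ Z, R a b ∧ (a, b) ∈ N p.1 p.2} ⊆ g '' A := by
    rintro b ⟨a, ha, hab, hN'⟩
    have haA : a ∈ A := ⟨ha, b, hab, hN'⟩
    refine ⟨a, haA, ?_⟩
    have := hC p.1 p.2 hp' (a, g a) (hg a haA).2 (a, b) hN' (hg a haA).1 hab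
    dsimp only at this
    rw [dist_self, mul_zero] at this
    exact dist_le_zero.1 this
  have hlip : LipschitzOnWith (C p.1 p.2) g A := LipschitzOnWith.of_dist_le_mul fun a ha b hb =>
    hC p.1 p.2 hp' (a, g a) (hg a ha).2 (b, g b) (hg b hb).2 (hg a ha).1 (hg b hb).1
  exact (dimH_mono himg).trans (hlip.dimH_image_le.trans (dimH_mono fun a ha => ha.1))

/-- Near a point where the derivative in the last variable does not vanish, the zero set is the
graph of a Lipschitz function over a subset. -/
lemma exists_lipschitz_zeros {X : Type*} [NormedAddCommGroup X] [NormedSpace ℝ X] {G : X × ℝ → ℝ}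
    {G' : X × ℝ →L[ℝ] ℝ} {z : X} {s : ℝ} (hG : HasStrictFDerivAt G G' (z, s))
    (h1 : G' (0, 1) ≠ 0) : ∃ N ∈ 𝓝 (z, s), ∃ C : ℝ≥0, ∀ p ∈ N, ∀ q ∈ N, G p = 0 → G q = 0 →
      dist p.2 q.2 ≤ C * dist p.1 q.1 := by
  set k := |G' (0, 1)| with hk
  have hk0 : 0 < k := abs_pos.2 h1
  have ho := hG.isLittleO.def (half_pos hk0)
  rw [nhds_prod_eq] at ho
  obtain ⟨N, hN, hNo⟩ := Filter.eventually_prod_self_iff (r := fun a b =>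
    ‖G a - G b - G' (a - b)‖ ≤ k / 2 * ‖a - b‖).1 ho
  refine ⟨N, hN, Real.toNNReal (2 / k * (‖G'‖ + k / 2)), fun p hp q hq hp0 hq0 => ?_⟩
  have h2 := hNo p hp q hq
  rw [hp0, hq0, sub_zero, zero_sub, norm_neg] at h2
  have e : p - q = ((p.1 - q.1, (0:ℝ)) : X × ℝ) + (p.2 - q.2) • ((0, 1) : X × ℝ) := by
    ext <;> simp
  -- Between two zeros the linear part is at most `k / 2` times the distance, while the last
  -- variable contributes with slope `k`; half of this slope absorbs the error.
  have h3 : ‖G' (p - q)‖ ≥ |p.2 - q.2| * k - ‖G'‖ * ‖p.1 - q.1‖ := by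
    rw [e, map_add, map_smul]
    have a1 : ‖G' (p.1 - q.1, (0:ℝ))‖ ≤ ‖G'‖ * ‖p.1 - q.1‖ := by
      refine (G'.le_opNorm _).trans ?_
      rw [Prod.norm_mk, norm_zero, max_eq_left (norm_nonneg _)]
    have a2 : ‖(p.2 - q.2) • G' (0, 1)‖ = |p.2 - q.2| * k := by
      rw [norm_smul, Real.norm_eq_abs, Real.norm_eq_abs]
    have a3 := norm_sub_norm_le ((p.2 - q.2) • G' (0, 1)) (-G' (p.1 - q.1, (0:ℝ)))
    rw [norm_neg, sub_neg_eq_add, add_comm ((p.2 - q.2) • G' (0, 1))] at a3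
    linarith
  have h4 : ‖p - q‖ ≤ ‖p.1 - q.1‖ + |p.2 - q.2| := by
    rw [Prod.norm_def, ← Real.norm_eq_abs]
    exact max_le_add_of_nonneg (norm_nonneg _) (norm_nonneg _)
  rw [Real.dist_eq, dist_eq_norm]
  have h5 : |p.2 - q.2| * k ≤ 2 * (‖G'‖ + k / 2) * ‖p.1 - q.1‖ := by nlinarith
  rw [Real.coe_toNNReal _ (by positivity), show 2 / k * (‖G'‖ + k / 2) * ‖p.1 - q.1‖ = 2 * (‖G'‖ + k / 2) * ‖p.1 - q.1‖ / k by ring,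
    le_div_iff₀ hk0]
  exact h5

/-- A positive multiple of the reflection of `v` in the line spanned by `τ`. -/
def reflectVec (τ v : Plane) : Plane := (2 * inner ℝ v τ) • τ - (inner ℝ τ τ) • v

lemma contDiff_cross {X : Type*} [NormedAddCommGroup X] [NormedSpace ℝ X] {n : WithTop ℕ∞}
    {f g : X → Plane} (hf : ContDiff ℝ n f) (hg : ContDiff ℝ n g) :
    ContDiff ℝ n fun x => cross (f x) (g x) := by
  simp only [← inner_rot90]
  exact hg.inner ℝ (contDiff_rot90.comp hf)

namespace ConvexCurve

variable {r : ℕ}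

/-- One step of the billiard: `z = (s, v)` stands for the ray from `σ s` in the direction `v`. -/
def Step (σ : ConvexCurve r) (z z' : ℝ × Plane) : Prop :=
  cross (σ.toFun z'.1 - σ.toFun z.1) z.2 = 0 ∧ cross (deriv σ.toFun z'.1) z.2 ≠ 0 ∧
    z'.2 = reflectVec (deriv σ.toFun z'.1) z.2

/-- Transversality at the new boundary point makes its parameter a locally Lipschitz function of the
ray, and the new direction is a `C¹` function of both. `Step` is only a relation, which the starting
point of the ray may also satisfy; for estimates of dimension this does no harm. -/
lemma step_locally_lipschitz (σ : ConvexCurve r) (hr : 2 ≤ r) {a b : ℝ × Plane} (h : σ.Step a b) :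
    ∃ N ∈ 𝓝 (a, b), ∃ C : ℝ≥0, ∀ p ∈ N, ∀ q ∈ N, σ.Step p.1 p.2 → σ.Step q.1 q.2 →
      dist p.2 q.2 ≤ C * dist p.1 q.1 := by
  have hσ : ContDiff ℝ 1 σ.toFun := (σ.contDiff_two hr).of_le (by norm_num)
  have hσ' := σ.contDiff_deriv hr
  let G : (ℝ × Plane) × ℝ → ℝ := fun p => cross (σ.toFun p.2 - σ.toFun p.1.1) p.1.2
  have hGc : ContDiff ℝ 1 G := contDiff_cross (by fun_prop) (by fun_prop)
  have hG := hGc.contDiffAt.hasStrictFDerivAt (x := (a, b.1)) one_ne_zero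
  have hG1 : fderiv ℝ G (a, b.1) (0, 1) = cross (deriv σ.toFun b.1) a.2 := by
    have h1 : HasDerivAt (fun t : ℝ => ((a, t) : (ℝ × Plane) × ℝ)) (0, 1) b.1 :=
      (hasDerivAt_const _ _).prodMk (hasDerivAt_id _)
    have h2 := hG.hasFDerivAt.comp_hasDerivAt b.1 h1
    have h3 : HasDerivAt (fun t : ℝ => cross (σ.toFun t - σ.toFun a.1) a.2)
        (cross (deriv σ.toFun b.1) a.2) b.1 := by
      have h4 := ((σ.hasDerivAt hr b.1).sub_const (σ.toFun a.1)).cross_right a.2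
      have e : ∀ u v : Plane, cross u v = -cross v u := by
        intro u v; simp only [cross]; ring
      rw [e]
      simp_rw [e _ a.2]
      exact h4.neg
    exact h2.unique h3
  obtain ⟨N₀, hN₀, C₀, hC₀⟩ := exists_lipschitz_zeros hG (by rw [hG1]; exact h.2.1)
  let K : (ℝ × Plane) × ℝ → ℝ × Plane := fun p => (p.2, reflectVec (deriv σ.toFun p.2) p.1.2)
  have hK : ContDiff ℝ 1 K := by
    have h1 : ContDiff ℝ 1 fun p : (ℝ × Plane) × ℝ => deriv σ.toFun p.2 := by fun_prop
    have h2 : ContDiff ℝ 1 fun p : (ℝ × Plane) × ℝ => p.1.2 := by fun_prop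
    exact contDiff_snd.prodMk (((contDiff_const.mul (h2.inner ℝ h1)).smul h1).sub
      ((h1.inner ℝ h1).smul h2))
  obtain ⟨CK, M, hM, hL⟩ := hK.contDiffAt.exists_lipschitzOnWith (x := (a, b.1))
  have hcont : Continuous fun p : (ℝ × Plane) × (ℝ × Plane) => (p.1, p.2.1) := by fun_prop
  refine ⟨_, hcont.continuousAt.preimage_mem_nhds (x := (a, b)) (Filter.inter_mem hN₀ hM),
    CK * max 1 C₀, fun p hp q hq h1 h2 => ?_⟩
  have e : ∀ {p : (ℝ × Plane) × (ℝ × Plane)}, σ.Step p.1 p.2 → p.2 = K (p.1, p.2.1) :=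
    fun h => Prod.ext rfl h.2.2
  have d0 := hC₀ _ hp.1 _ hq.1 h1.1 h2.1
  dsimp only at d0
  rw [e h1, e h2]
  refine (hL.dist_le_mul _ hp.2 _ hq.2).trans ?_
  rw [NNReal.coe_mul, mul_assoc]
  refine mul_le_mul_of_nonneg_left ?_ CK.2
  rw [Prod.dist_eq, NNReal.coe_max, NNReal.coe_one]
  refine max_le ?_ (d0.trans ?_)
  · exact le_mul_of_one_le_left dist_nonneg (le_max_left _ _)
  · exact mul_le_mul_of_nonneg_right (le_max_right _ _) dist_nonneg

/-- The image of a set of rays with labels under one step. -/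
def stepImg (σ : ConvexCurve r) {W : Type*} (Z : Set ((ℝ × Plane) × W)) : Set ((ℝ × Plane) × W) :=
  {b | ∃ a ∈ Z, σ.Step a.1 b.1 ∧ b.2 = a.2}

/-- The label in `W` is carried along untouched; it allows the two arms of a path to be developed
one after the other. -/
lemma dimH_stepImg_le (σ : ConvexCurve r) (hr : 2 ≤ r) {W : Type*} [MetricSpace W]
    [SecondCountableTopology W] (Z : Set ((ℝ × Plane) × W)) : dimH (σ.stepImg Z) ≤ dimH Z := by
  refine dimH_image_rel_le (R := fun a b : (ℝ × Plane) × W => σ.Step a.1 b.1 ∧ b.2 = a.2) ?_ Z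
  rintro a b ⟨h, -⟩
  obtain ⟨N, hN, C, hC⟩ := σ.step_locally_lipschitz hr h
  have hcont : Continuous fun p : ((ℝ × Plane) × W) × ((ℝ × Plane) × W) => (p.1.1, p.2.1) := by
    fun_prop
  refine ⟨_, hcont.continuousAt.preimage_mem_nhds (x := (a, b)) hN, max 1 C,
    fun p hp q hq h1 h2 => ?_⟩
  have d := hC _ hp _ hq h1.1 h2.1
  rw [Prod.dist_eq, h1.2, h2.2, NNReal.coe_max, NNReal.coe_one]
  refine max_le (d.trans ?_) ?_
  · exact mul_le_mul (le_max_right _ _) (le_max_left _ _) dist_nonneg (by positivity)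
  · exact (le_max_right _ _).trans (le_mul_of_one_le_left (le_max_of_le_left dist_nonneg)
      (le_max_left _ _))

lemma dimH_stepImg_iterate_le (σ : ConvexCurve r) (hr : 2 ≤ r) {W : Type*} [MetricSpace W]
    [SecondCountableTopology W] (k : ℕ) (Z : Set ((ℝ × Plane) × W)) :
    dimH (σ.stepImg^[k] Z) ≤ dimH Z := by
  induction k with
  | zero => exact le_rfl
  | succ k ih =>
    rw [Function.iterate_succ_apply']
    exact (σ.dimH_stepImg_le hr _).trans ih

/-- The reflection law in terms of `reflectVec`. -/
lemma Refl.reflectVec_eq {σ : ConvexCurve r} (hr : 2 ≤ r) {a b : Plane} {s : ℝ}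
    (h : σ.Refl a (σ.toFun s) b) (ha : a ∈ σ.table) (hb : b ∈ σ.table) (has : a ≠ σ.toFun s)
    (hbs : b ≠ σ.toFun s) : reflectVec (deriv σ.toFun s) (unitDir a (σ.toFun s)) =
      ‖deriv σ.toFun s‖ ^ 2 • unitDir (σ.toFun s) b := by
  obtain ⟨s', hs', h⟩ := h
  rw [σ.deriv_eq_of_eq hs'] at h
  set τ := deriv σ.toFun s with hτ
  have hτ0 : 0 < ‖τ‖ := norm_pos_iff.2 (σ.deriv_ne_zero s)
  have h1 := σ.cross_unitDir_pos hr ha has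
  have h2 := σ.cross_unitDir_pos hr hb hbs
  rw [← hτ] at h1 h2
  set e := unitDir a (σ.toFun s) with he
  have hen : ‖e‖ = 1 := norm_unitDir has
  rw [unitDir_neg a (σ.toFun s), ← he] at h1
  have hττ : inner ℝ τ τ = ‖τ‖ ^ 2 := real_inner_self_eq_norm_sq τ
  have hrn : ‖reflectVec τ e‖ = ‖τ‖ ^ 2 := by
    have : ‖reflectVec τ e‖ ^ 2 = (‖τ‖ ^ 2) ^ 2 := by
      rw [plane_norm_sq, reflectVec, plane_norm_sq]
      have e1 := plane_norm_sq e
      rw [hen] at e1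
      simp only [PiLp.sub_apply, PiLp.smul_apply, smul_eq_mul, plane_inner]
      linear_combination (-(τ 0 ^ 2 + τ 1 ^ 2) ^ 2) * e1
    exact (sq_eq_sq₀ (norm_nonneg _) (by positivity)).1 this
  have key : (‖τ‖ ^ 2)⁻¹ • reflectVec τ e = unitDir (σ.toFun s) b := by
    refine eq_of_inner_eq_of_cross_pos (d := τ) ?_ (norm_unitDir hbs.symm) ?_ ?_ h2
    · rw [norm_smul, hrn, norm_inv, Real.norm_of_nonneg (by positivity)]
      exact inv_mul_cancel₀ (by positivity)
    · rw [← h, reflectVec, inner_smul_left, inner_sub_left, inner_smul_left, inner_smul_left, hττ]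
      simp only [RCLike.conj_to_real]
      field_simp
      ring
    · rw [cross_smul_right]
      refine mul_pos (by positivity) ?_
      have : cross τ (reflectVec τ e) = ‖τ‖ ^ 2 * cross τ (-e) := by
        rw [reflectVec, plane_norm_sq]
        simp only [cross, PiLp.sub_apply, PiLp.smul_apply, PiLp.neg_apply, smul_eq_mul, plane_inner]
        ring
      rw [this]
      exact mul_pos (by positivity) h1
  rw [← key, smul_smul, mul_inv_cancel₀ (by positivity), one_smul]

/-- A billiard path is followed by iterating `stepImg`. -/
lemma exists_mem_stepImg_iterate (σ : ConvexCurve r) (hr : 2 ≤ r) (W : Type*) {p : ℕ → Plane} {k : ℕ} (hS : ∀ l ≤ k, p l ∈ σ.trace)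
    (hT : ∀ l ≤ k + 1, p l ∈ σ.table) (hne : ∀ l ≤ k, p l ≠ p (l + 1))
    (hrefl : ∀ l < k, σ.Refl (p l) (p (l + 1)) (p (l + 2))) {s : ℝ} {c : ℝ} (hc : 0 < c)
    (hs : σ.toFun s = p 0) :
    ∃ (s' : ℝ) (c' : ℝ), 0 < c' ∧ σ.toFun s' = p k ∧ ∀ (Z : Set ((ℝ × Plane) × W)) (w : W),
      ((s, c • unitDir (p 0) (p 1)), w) ∈ Z →
        ((s', c' • unitDir (p k) (p (k + 1))), w) ∈ σ.stepImg^[k] Z := by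
  induction k with
  | zero => exact ⟨s, c, hc, hs, fun Z w h => h⟩
  | succ k ih =>
    obtain ⟨s₁, c, hc, hs, hmem⟩ := ih (fun l hl => hS l (by omega)) (fun l hl => hT l (by omega))
      (fun l hl => hne l (by omega)) (fun l hl => hrefl l (by omega))
    obtain ⟨s', hs'⟩ := hS (k + 1) le_rfl
    have n0 := hne k (by omega)
    have n1 := hne (k + 1) le_rfl
    have hr' := hrefl k (by omega)
    rw [← hs'] at n0 n1 hr'
    have hcp := σ.cross_unitDir_pos hr (hT k (by omega)) n0
    -- `reflectVec` multiplies lengths by the squared speed; only the positive factor in front of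
    -- the direction changes.
    refine ⟨s', c * ‖deriv σ.toFun s'‖ ^ 2, by
      have := norm_pos_iff.2 (σ.deriv_ne_zero s'); positivity, hs', fun Z w hw => ?_⟩
    rw [Function.iterate_succ_apply']
    refine ⟨_, hmem Z w hw, ⟨?_, ?_, ?_⟩, rfl⟩
    · dsimp only
      rw [hs, hs', cross_smul_right, unitDir, cross_smul_right]
      simp only [cross]; ring
    · dsimp only
      rw [cross_smul_right, ← hs', unitDir_neg _ (p k)]
      have : cross (deriv σ.toFun s') (-unitDir (σ.toFun s') (p k)) =
        -cross (deriv σ.toFun s') (unitDir (σ.toFun s') (p k)) := by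
          simp only [cross, PiLp.neg_apply]; ring
      rw [this]
      exact mul_ne_zero hc.ne' (neg_ne_zero.2 hcp.ne')
    · dsimp only
      rw [← hs', mul_smul, ← hr'.reflectVec_eq hr (hT k (by omega)) (hT (k + 2) (by omega)) n0
        n1.symm]
      simp only [reflectVec, inner_smul_left, RCLike.conj_to_real]
      module

/-- Both arms of such a path leave the vertex along the normal. The path is thus determined by the
foot of the normal and by how far each arm runs beyond its last vertex. These are three parameters,
and billiard steps do not raise the Hausdorff dimension, so the end points lie in a set of dimension
at most three in a space of dimension four. -/
lemma avoidable_perpSet (σ : ConvexCurve r) (hr : 2 ≤ r) {m j : ℕ} (hj : j < m) :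
    Avoidable σ.interiorPairs (σ.perpSet m j) := by
  refine ⟨σ.isClosed_perpSet hr m j, fun O hO ho hne => ?_⟩
  have hσ : ContDiff ℝ 1 σ.toFun := (σ.contDiff_two hr).of_le (by norm_num)
  have hσ' := σ.contDiff_deriv hr
  -- The normal ray is stored twice: one copy is developed towards `x` while the other waits in the
  -- label. `f₁` exchanges the copies before the arm towards `y` is developed, and `f₂` runs off the
  -- two final distances.
  let f₀ : ℝ × ℝ × ℝ → (ℝ × Plane) × ((ℝ × Plane) × (ℝ × ℝ)) := fun q =>
    ((q.1, rot90 (deriv σ.toFun q.1)), (q.1, rot90 (deriv σ.toFun q.1)), q.2)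
  have hf₀ : ContDiff ℝ 1 f₀ := by
    have : ContDiff ℝ 1 fun q : ℝ × ℝ × ℝ => rot90 (deriv σ.toFun q.1) :=
      contDiff_rot90.comp (by fun_prop)
    unfold f₀
    fun_prop
  let f₁ : (ℝ × Plane) × ((ℝ × Plane) × (ℝ × ℝ)) → (ℝ × Plane) × ((ℝ × Plane) × (ℝ × ℝ)) :=
    fun z => (z.2.1, z.1, z.2.2)
  have hf₁ : ContDiff ℝ 1 f₁ := by unfold f₁; fun_prop
  let f₂ : (ℝ × Plane) × ((ℝ × Plane) × (ℝ × ℝ)) → Plane × Plane :=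
    fun z => (σ.toFun z.2.1.1 + z.2.2.1 • z.2.1.2, σ.toFun z.1.1 + z.2.2.2 • z.1.2)
  have hf₂ : ContDiff ℝ 1 f₂ := by unfold f₂; fun_prop
  let Z₁ := σ.stepImg^[j] (Set.range f₀)
  let Z₂ := σ.stepImg^[m - 1 - j] (f₁ '' Z₁)
  have hd : dimH (f₂ '' Z₂) < (Module.finrank ℝ (Plane × Plane) : ℕ) := by
    calc dimH (f₂ '' Z₂) ≤ dimH Z₂ :=
          hf₂.contDiffOn.dimH_image_le convex_univ (Set.subset_univ _)
      _ ≤ dimH (f₁ '' Z₁) := σ.dimH_stepImg_iterate_le hr _ _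
      _ ≤ dimH Z₁ := hf₁.contDiffOn.dimH_image_le convex_univ (Set.subset_univ _)
      _ ≤ dimH (Set.range f₀) := σ.dimH_stepImg_iterate_le hr _ _
      _ ≤ (Module.finrank ℝ (ℝ × ℝ × ℝ) : ℕ) := hf₀.dimH_range_le
      _ < (Module.finrank ℝ (Plane × Plane) : ℕ) := by
          rw [Nat.cast_lt]; simp
  obtain ⟨⟨x, y⟩, hz, hzc⟩ := (dense_compl_of_dimH_lt_finrank hd).inter_open_nonempty O ho hne
  refine ⟨(x, y), hz, fun hperp => hzc ?_⟩
  obtain ⟨hx, hy, P, P', hP, -, hc⟩ := hperp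
  dsimp only at hx hy hP
  rw [Set.mem_ofPred_eq] at hc
  dsimp only at hc
  obtain ⟨s, hs⟩ := hP.mem (j + 1) (by omega) (by omega)
  have hm : 1 ≤ m := by omega
  have T := hP.mem_table hx hy
  have n := fun i hi => hP.ne_succ hr hx hy hm (i := i) hi
  have n0 := n j (by omega)
  have n1 := n (j + 1) (by omega)
  -- Overlapping segments leave the vertex in one direction, and the reflection law makes this
  -- direction normal to the curve.
  have hd : unitDir (P (j + 1)) (P j) = unitDir (P (j + 1)) (P (j + 2)) := by
    rcases hc with hc | hc
    · exact unitDir_eq_of_mem_segment n0 hc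
    · exact (unitDir_eq_of_mem_segment n1.symm hc).symm
  obtain ⟨s', hs', hrf⟩ := hP.refl hr hx hy hj
  rw [σ.deriv_eq_of_eq (hs'.trans hs.symm), unitDir_neg (P (j + 1)) (P j), ← hd,
    inner_neg_left] at hrf
  set τ := deriv σ.toFun s with hτ
  have hperp : inner ℝ (unitDir (P (j + 1)) (P j)) τ = 0 := by linarith
  have hτ0 : 0 < ‖τ‖ := norm_pos_iff.2 (σ.deriv_ne_zero s)
  have hnorm : unitDir (P (j + 1)) (P j) = ‖τ‖⁻¹ • rot90 τ := by
    refine eq_of_inner_eq_of_cross_pos (d := τ) (norm_unitDir n0.symm) ?_ ?_ ?_ ?_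
    · rw [norm_smul, norm_inv, norm_norm, norm_rot90, inv_mul_cancel₀ hτ0.ne']
    · rw [hperp, inner_smul_left, plane_inner, rot90_apply_zero, rot90_apply_one]
      ring
    · have := σ.cross_unitDir_pos hr (s := s) (T j (by omega)) (by rw [hs]; exact n0)
      rwa [hs] at this
    · rw [cross_smul_right]
      have : cross τ (rot90 τ) = ‖τ‖ ^ 2 := by
        rw [plane_norm_sq, cross, rot90_apply_zero, rot90_apply_one]; ring
      rw [this]; positivity
  have hrot : rot90 τ = ‖τ‖ • unitDir (P (j + 1)) (P j) := by
    rw [hnorm, smul_smul, mul_inv_cancel₀ hτ0.ne', one_smul]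
  -- The arm towards `x` visits the vertices in decreasing order, which needs the symmetry of the
  -- reflection law.
  obtain ⟨sx, cx, hcx, hsx, h1⟩ := σ.exists_mem_stepImg_iterate hr
    ((ℝ × Plane) × (ℝ × ℝ)) (k := j)
    (p := fun l => P (j + 1 - l)) (s := s) (c := ‖τ‖)
    (fun l hl => hP.mem _ (by omega) (by omega)) (fun l hl => T _ (by omega))
    (fun l hl => by
      have := n (j - l) (by omega)
      rw [show j - l + 1 = j + 1 - l by omega] at this
      rw [show j + 1 - (l + 1) = j - l by omega]
      exact this.symm)
    (fun l hl => by
      have := (hP.refl hr hx hy (j := j - 1 - l) (by omega)).symm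
      rwa [show j + 1 - l = j - 1 - l + 2 by omega, show j + 1 - (l + 1) = j - 1 - l + 1 by omega,
        show j + 1 - (l + 2) = j - 1 - l by omega])
    hτ0 hs
  rw [show j + 1 - j = 1 by omega] at hsx h1
  rw [show j + 1 - (j + 1) = 0 by omega, hP.zero, show j + 1 - 0 = j + 1 by omega,
    show j + 1 - 1 = j by omega, ← hrot] at h1
  obtain ⟨sy, cy, hcy, hsy, h2⟩ := σ.exists_mem_stepImg_iterate hr
    ((ℝ × Plane) × (ℝ × ℝ)) (k := m - 1 - j) (p := fun l => P (j + 1 + l)) (s := s) (c := ‖τ‖)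
    (fun l hl => hP.mem _ (by omega) (by omega)) (fun l hl => T _ (by omega))
    (fun l hl => n (j + 1 + l) (by omega))
    (fun l hl => hP.refl hr hx hy (j := j + 1 + l) (by omega))
    hτ0 hs
  rw [show j + 1 + (m - 1 - j) = m by omega] at hsy h2
  rw [show j + 1 + (m - 1 - j + 1) = m + 1 by omega, hP.last, Nat.add_zero,
    show j + 1 + 1 = j + 2 by omega, ← hd, ← hrot] at h2
  refine ⟨_, h2 (f₁ '' Z₁) _ ⟨_, h1 (Set.range f₀) ((s, rot90 τ), (dist (P 1) x / cx,
    dist (P m) y / cy)) ⟨(s, _, _), rfl⟩, rfl⟩, ?_⟩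
  simp only [f₂]
  rw [hsx, hsy, smul_smul, smul_smul, div_mul_cancel₀ _ hcx.ne', div_mul_cancel₀ _ hcy.ne',
    ← eq_add_dist_smul_unitDir, ← eq_add_dist_smul_unitDir]

end ConvexCurve
end

/-! ### Generic pairs of end points -/

noncomputable section

namespace ConvexCurve

variable {r : ℕ}

lemma avoidable_diagonal (σ : ConvexCurve r) :
    Avoidable σ.interiorPairs {p : Plane × Plane | p.1 = p.2} := by
  refine ⟨isClosed_eq (by fun_prop) (by fun_prop), fun O _ ho hne => ?_⟩
  obtain ⟨⟨x, y⟩, hz⟩ := hne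
  obtain ⟨x', hx', hseg⟩ := exists_notMem_segment (U := {x' | (x', y) ∈ O})
    (ho.preimage (by fun_prop : Continuous fun x' : Plane => (x', y))) ⟨x, hz⟩ y y
  rw [segment_same] at hseg
  exact ⟨(x', y), hx', hseg⟩

/-- A generic pair of points is joined by longest paths with `1, …, n` vertices that have no common
or repeated vertices and do not return to the end points. -/
lemma exists_generic_pair (σ : ConvexCurve r) (hr : 2 ≤ r) (n : ℕ) {O : Set (Plane × Plane)}
    (hO : O ⊆ σ.interiorPairs) (ho : IsOpen O) (hne : O.Nonempty) :
    ∃ x y, (x, y) ∈ O ∧ x ≠ y ∧ ∃ P : ℕ → ℕ → Plane,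
      (∀ i, IsMaxPoly σ.trace (i + 1) x y (P i)) ∧
      (∀ i < n, ∀ j < n, ∀ k ≤ i, ∀ l ≤ j, P i (k + 1) = P j (l + 1) → i = j ∧ k = l) ∧
      (∀ i < n, ∀ k ≤ i, x ∉ segment ℝ (P i (k + 1)) (P i (k + 2))) ∧
      (∀ i < n, ∀ k ≤ i, y ∉ segment ℝ (P i k) (P i (k + 1))) := by
  have hperp : ∀ m j, j < m → Avoidable σ.interiorPairs (σ.perpSet m j) :=
    fun m j hj => σ.avoidable_perpSet hr hj
  -- The exceptional sets are removed from `O` one kind after the other, always leaving a nonempty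
  -- open set. An index `i` stands for the path with `i + 1` vertices.
  obtain ⟨O₁, h1, o1, n1, d1⟩ := Avoidable.exists_open_finset
    (B := fun q : ℕ × ℕ => σ.perpSet (q.1 + 1) q.2)
    ((Finset.range n ×ˢ Finset.range n).filter fun q => q.2 ≤ q.1)
    (fun q hq => hperp _ _ (by have := (Finset.mem_filter.1 hq).2; omega)) hO ho hne
  obtain ⟨O₂, h2, o2, n2, d2⟩ := Avoidable.exists_open_finset
    (B := fun q : ℕ × ℕ => σ.pairSet (q.1 + 1) (q.1 + 1)
      {p | p.1 0 ∈ segment ℝ (p.1 (q.2 + 1)) (p.1 (q.2 + 1 + 1))})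
    ((Finset.range n ×ˢ Finset.range n).filter fun q => q.2 ≤ q.1)
    (fun q hq => σ.avoidable_return hr (by omega)
      (by have := (Finset.mem_filter.1 hq).2; omega) (hperp _)) (h1.trans hO) o1 n1
  obtain ⟨O₃, h3, o3, n3, d3⟩ := Avoidable.exists_open_finset
    (B := fun q : ℕ × ℕ => σ.pairSet (q.1 + 1) (q.1 + 1)
      {p | p.1 (q.1 + 1 + 1) ∈ segment ℝ (p.1 q.2) (p.1 (q.2 + 1))})
    ((Finset.range n ×ˢ Finset.range n).filter fun q => q.2 ≤ q.1)
    (fun q hq => σ.avoidable_return_end hr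
      (by have := (Finset.mem_filter.1 hq).2; omega) (hperp _)) ((h2.trans h1).trans hO) o2 n2
  obtain ⟨O₄, h4, o4, n4, d4⟩ := Avoidable.exists_open_finset
    (B := fun q : (ℕ × ℕ) × (ℕ × ℕ) => σ.pairSet (q.1.1 + 1) (q.2.1 + 1)
      {p | p.1 (q.1.2 + 1) = p.2 (q.2.2 + 1)})
    (((Finset.range n ×ˢ Finset.range n) ×ˢ (Finset.range n ×ˢ Finset.range n)).filter
      fun q => q.1.1 < q.2.1 ∧ q.1.2 ≤ q.1.1 ∧ q.2.2 ≤ q.2.1)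
    (fun q hq => by
      have := (Finset.mem_filter.1 hq).2
      exact σ.avoidable_shared hr (by omega) (by omega) (by omega) (by omega) (by omega) (hperp _))
    (((h3.trans h2).trans h1).trans hO) o3 n3
  obtain ⟨O₅, h5, o5, ⟨⟨x, y⟩, hz⟩, d5⟩ :=
    σ.avoidable_diagonal.exists_open ((((h4.trans h3).trans h2).trans h1).trans hO) o4 n4
  have z4 := h5 hz
  have z3 := h4 z4
  have z2 := h3 z3
  have z1 := h2 z2
  have hx := interior_subset (hO (h1 z1)).1
  have hy := interior_subset (hO (h1 z1)).2
  choose P hP using fun i : ℕ => exists_isMaxPoly σ.isCompact_trace σ.trace_nonempty (i + 1) x y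
  refine ⟨x, y, h1 z1, fun e => Set.disjoint_left.1 d5 hz e, P, hP, ?_, ?_, ?_⟩
  · have hlt : ∀ i < n, ∀ j < n, ∀ k ≤ i, ∀ l ≤ j, i < j → P i (k + 1) ≠ P j (l + 1) := by
      intro i hi j hj k hk l hl hij he
      refine Set.disjoint_left.1 (d4 ((i, k), (j, l)) ?_) z4 ⟨hx, hy, P i, P j, hP i, hP j, he⟩
      simp only [Finset.mem_filter, Finset.mem_product, Finset.mem_range]
      omega
    have heq : ∀ i < n, ∀ k ≤ i, ∀ l ≤ i, k < l → P i (k + 1) ≠ P i (l + 1) := by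
      intro i hi k hk l hl hkl he
      obtain ⟨c, hc, hcc⟩ := (hP i).exists_turn hr hx hy (by omega) (by omega) (by omega) he
      refine Set.disjoint_left.1 (d1 (i, c) ?_) z1 ⟨hx, hy, P i, P i, hP i, hP i, Or.inl ?_⟩
      · simp only [Finset.mem_filter, Finset.mem_product, Finset.mem_range]
        omega
      · dsimp only
        rw [hcc]; exact right_mem_segment ℝ _ _
    intro i hi j hj k hk l hl he
    rcases lt_trichotomy i j with h | rfl | h
    · exact absurd he (hlt i hi j hj k hk l hl h)
    · rcases lt_trichotomy k l with h | rfl | h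
      · exact absurd he (heq i hi k hk l hl h)
      · exact ⟨rfl, rfl⟩
      · exact absurd he.symm (heq i hi l hl k hk h)
    · exact absurd he.symm (hlt j hj i hi l hl k hk h)
  · intro i hi k hk hs
    refine Set.disjoint_left.1 (d2 (i, k) ?_) z2 ⟨hx, hy, P i, P i, hP i, hP i, ?_⟩
    · simp only [Finset.mem_filter, Finset.mem_product, Finset.mem_range]
      omega
    · rw [Set.mem_ofPred_eq]
      dsimp only
      rw [(hP i).zero]; exact hs
  · intro i hi k hk hs
    refine Set.disjoint_left.1 (d3 (i, k) ?_) z3 ⟨hx, hy, P i, P i, hP i, hP i, ?_⟩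
    · simp only [Finset.mem_filter, Finset.mem_product, Finset.mem_range]
      omega
    · rw [Set.mem_ofPred_eq]
      dsimp only
      rw [(hP i).last]; exact hs

end ConvexCurve
end

noncomputable section

/-! ### Stability of convex curves -/

namespace ConvexCurve

variable {r : ℕ}

lemma continuous_deriv_deriv (σ : ConvexCurve r) (hr : 2 ≤ r) :
    Continuous (deriv (deriv σ.toFun)) :=
  (σ.contDiff_deriv hr).continuous_deriv le_rfl

lemma periodic_deriv {f : ℝ → Plane} (hf : Function.Periodic f 1) :
    Function.Periodic (deriv f) 1 := by
  intro s
  rw [← deriv_comp_add_const]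
  congr 1
  funext t
  exact hf t

/-- Points of the curve with distant parameters are distant. -/
lemma exists_le_norm_sub (σ : ConvexCurve r) {η : ℝ} (hη0 : 0 < η) :
    ∃ μ > 0, ∀ s ∈ Set.Icc (0:ℝ) 1, ∀ t ∈ Set.Icc (0:ℝ) 1,
      η ≤ t - s → t - s ≤ 1 - η → μ ≤ ‖σ.toFun t - σ.toFun s‖ := by
  have hcont : Continuous fun p : ℝ × ℝ => ‖σ.toFun p.2 - σ.toFun p.1‖ := by
    have := σ.continuous
    fun_prop
  let K : Set (ℝ × ℝ) := {p | (p.1 ∈ Set.Icc (0:ℝ) 1 ∧ p.2 ∈ Set.Icc (0:ℝ) 1) ∧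
    η ≤ p.2 - p.1 ∧ p.2 - p.1 ≤ 1 - η}
  have hcl : IsClosed {p : ℝ × ℝ | η ≤ p.2 - p.1 ∧ p.2 - p.1 ≤ 1 - η} := by
    have a1 : IsClosed {p : ℝ × ℝ | η ≤ p.2 - p.1} := isClosed_le (by fun_prop) (by fun_prop)
    have a2 : IsClosed {p : ℝ × ℝ | p.2 - p.1 ≤ 1 - η} := isClosed_le (by fun_prop) (by fun_prop)
    exact a1.inter a2
  have hKc : IsCompact K := (isCompact_Icc.prod isCompact_Icc).inter_right hcl
  have hmem : ∀ s ∈ Set.Icc (0:ℝ) 1, ∀ t ∈ Set.Icc (0:ℝ) 1, η ≤ t - s → t - s ≤ 1 - η →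
      (s, t) ∈ K := fun s hs t ht h1 h2 => ⟨⟨hs, ht⟩, h1, h2⟩
  rcases K.eq_empty_or_nonempty with he | hne
  · refine ⟨1, one_pos, fun s hs t ht h1 h2 => ?_⟩
    have := hmem s hs t ht h1 h2
    rw [he] at this
    exact absurd this (Set.notMem_empty _)
  · obtain ⟨p, hp, hmin⟩ := hKc.exists_isMinOn hne hcont.continuousOn
    have hm := isMinOn_iff.1 hmin
    refine ⟨‖σ.toFun p.2 - σ.toFun p.1‖, ?_, fun s hs t ht h1 h2 => ?_⟩
    swap
    · have := hm (s, t) (hmem s hs t ht h1 h2)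
      exact this
    refine norm_pos_iff.2 (sub_ne_zero.2 fun he => ?_)
    obtain ⟨k, hk⟩ := σ.eq_add_int he
    have h1 := hp.2.1
    have h2 := hp.2.2
    have h3 : (-1 : ℝ) < k := by linarith
    have h4 : (k : ℝ) < 0 := by linarith
    have h5 : -1 < k := by exact_mod_cast h3
    have h6 : k < 0 := by exact_mod_cast h4
    omega

/-- Positive curvature is an open condition along the compact set of pairs of first and second
derivatives. For injectivity, parameters at most `η` apart are separated because the velocity stays
within half the speed of a fixed vector. Parameters further apart modulo `1` are separated because
their points on `σ` have distance at least `μ`. -/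
lemma exists_stability (σ : ConvexCurve r) (hr : 2 ≤ r) : ∃ ε > 0, ∀ f : ℝ → Plane,
    ContDiff ℝ 2 f → Function.Periodic f 1 → (∀ s, ‖f s - σ.toFun s‖ < ε) →
    (∀ s, ‖deriv f s - deriv σ.toFun s‖ < ε) →
    (∀ s, ‖deriv (deriv f) s - deriv (deriv σ.toFun) s‖ < ε) →
    Set.InjOn f (Set.Ico 0 1) ∧ ∀ s, 0 < inner ℝ (deriv (deriv f) s) (rot90 (deriv f s)) := by
  have hc1 := σ.continuous_deriv hr
  have hc2 := σ.continuous_deriv_deriv hr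
  have hp1 := σ.deriv_periodic
  have hp2 : Function.Periodic (deriv (deriv σ.toFun)) 1 := periodic_deriv hp1
  -- curvature
  have hK : IsCompact (Set.range fun s => (deriv σ.toFun s, deriv (deriv σ.toFun) s)) :=
    Function.Periodic.compact_of_continuous (c := 1) (fun s => by
      rw [hp1 s, hp2 s]) one_ne_zero (hc1.prodMk hc2)
  have hopen : IsOpen {p : Plane × Plane | 0 < inner ℝ p.2 (rot90 p.1)} := by
    have := continuous_rot90
    exact isOpen_lt continuous_const (by fun_prop)
  obtain ⟨ε₁, hε₁, hth⟩ := hK.exists_thickening_subset_open hopen (by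
    rintro _ ⟨s, rfl⟩
    exact σ.curv_pos s)
  -- pairs of parameters at small distance
  obtain ⟨c, hc, hspeed⟩ := σ.const_speed
  obtain ⟨C, hC⟩ := (Function.Periodic.compact_of_continuous hp2 one_ne_zero hc2).isBounded.exists_norm_le
  have hC' : ∀ s, ‖deriv (deriv σ.toFun) s‖ ≤ C := fun s => hC _ ⟨s, rfl⟩
  have hC0 : 0 ≤ C := (norm_nonneg _).trans (hC' 0)
  have hlip : ∀ s t, ‖deriv σ.toFun t - deriv σ.toFun s‖ ≤ C * ‖t - s‖ := fun s t =>
    Convex.norm_image_sub_le_of_norm_deriv_le (s := Set.univ)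
      (fun x _ => (σ.hasDerivAt_deriv hr x).differentiableAt) (fun x _ => hC' x) convex_univ trivial
      trivial
  set η : ℝ := min (1 / 2) (c / (4 * (C + 1))) with hη
  have hη0 : 0 < η := by positivity
  have hη1 : C * η ≤ c / 4 := by
    have h1 : C * η ≤ C * (c / (4 * (C + 1))) := mul_le_mul_of_nonneg_left (min_le_right _ _) hC0
    have h2 : C * (c / (4 * (C + 1))) ≤ c / 4 := by
      rw [mul_div_assoc', div_le_div_iff₀ (by positivity) (by positivity)]
      nlinarith
    linarith
  -- pairs of parameters at large distance
  obtain ⟨μ, hμ, hfar⟩ := σ.exists_le_norm_sub hη0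
  refine ⟨min ε₁ (min (c / 4) (μ / 2)), by positivity, fun f hf hfp h0 h1 h2 => ⟨?_, fun s => ?_⟩⟩
  · have hnear : ∀ s t, s < t → t - s ≤ η → f t ≠ f s := by
      intro s t hst hts he
      have hd : ∀ w ∈ Set.Icc s t, ‖deriv f w - deriv σ.toFun s‖ ≤ c / 2 := by
        intro w hw
        have a1 := h1 w
        have a2 := hlip s w
        have a3 : ‖w - s‖ ≤ η := by
          rw [Real.norm_eq_abs, abs_of_nonneg (by linarith [hw.1])]; linarith [hw.2]
        have a4 := norm_add_le (deriv f w - deriv σ.toFun w) (deriv σ.toFun w - deriv σ.toFun s)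
        rw [sub_add_sub_cancel] at a4
        have a5 : C * ‖w - s‖ ≤ C * η := mul_le_mul_of_nonneg_left a3 hC0
        have a6 : min ε₁ (min (c / 4) (μ / 2)) ≤ c / 4 := (min_le_right _ _).trans (min_le_left _ _)
        linarith
      have hdiff : ∀ w, HasDerivAt (fun w => f w - w • deriv σ.toFun s)
          (deriv f w - deriv σ.toFun s) w := by
        intro w
        have := ((hf.differentiable (by norm_num)) w).hasDerivAt.sub
          ((hasDerivAt_id w).smul_const (deriv σ.toFun s))
        simp only [id, one_smul] at this
        exact this
      have hb := Convex.norm_image_sub_le_of_norm_hasDerivWithin_le (s := Set.Icc s t)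
        (fun w _ => (hdiff w).hasDerivWithinAt) hd (convex_Icc s t) (Set.left_mem_Icc.2 hst.le)
        (Set.right_mem_Icc.2 hst.le)
      rw [he, sub_sub_sub_cancel_left, ← sub_smul, norm_smul, hspeed, norm_sub_rev s t] at hb
      have : 0 < ‖t - s‖ := norm_pos_iff.2 (sub_ne_zero.2 hst.ne')
      nlinarith
    have hlt : ∀ s ∈ Set.Ico (0:ℝ) 1, ∀ t ∈ Set.Ico (0:ℝ) 1, s < t → f t ≠ f s := by
      intro s hs t ht hst he
      by_cases c1 : t - s ≤ η
      · exact hnear s t hst c1 he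
      -- Parameters that are close only modulo `1`: `t` is compared with `s + 1`.
      by_cases c2 : 1 - η ≤ t - s
      · refine hnear t (s + 1) (by linarith [ht.2, hs.1]) (by linarith) ?_
        rw [hfp s, he]
      · have h3 := hfar s ⟨hs.1, hs.2.le⟩ t ⟨ht.1, ht.2.le⟩ (by linarith) (by linarith)
        have b1 := h0 s
        have b2 := h0 t
        have b3 : min ε₁ (min (c / 4) (μ / 2)) ≤ μ / 2 :=
          (min_le_right _ _).trans (min_le_right _ _)
        have b4 : ‖σ.toFun t - σ.toFun s‖ ≤ ‖f s - σ.toFun s‖ + ‖f t - σ.toFun t‖ := by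
          rw [← he]
          have := norm_sub_le (f t - σ.toFun s) (f t - σ.toFun t)
          rwa [sub_sub_sub_cancel_left] at this
        linarith
    intro s hs t ht he
    rcases lt_trichotomy s t with h | h | h
    · exact absurd he.symm (hlt s hs t ht h)
    · exact h
    · exact absurd he (hlt t ht s hs h)
  · have : (deriv f s, deriv (deriv f) s) ∈ Metric.thickening ε₁
        (Set.range fun s => (deriv σ.toFun s, deriv (deriv σ.toFun) s)) := by
      rw [Metric.mem_thickening_iff]
      refine ⟨_, ⟨s, rfl⟩, ?_⟩
      rw [Prod.dist_eq, dist_eq_norm, dist_eq_norm]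
      exact max_lt ((h1 s).trans_le (min_le_left _ _)) ((h2 s).trans_le (min_le_left _ _))
    exact hth this

end ConvexCurve

/-! ### Families of functions with jointly continuous derivatives -/

section JointCk

variable {X : Type*} [TopologicalSpace X]

/-- The functions `Q c` have derivatives up to the order `n` that are jointly continuous. -/
def JointCk {W : Type*} [NormedAddCommGroup W] [NormedSpace ℝ W] : ℕ → (X → ℝ → W) → Prop
  | 0, Q => Continuous fun p : X × ℝ => Q p.1 p.2
  | n + 1, Q => (Continuous fun p : X × ℝ => Q p.1 p.2) ∧
      ∃ Q' : X → ℝ → W, (∀ c s, HasDerivAt (Q c) (Q' c s) s) ∧ JointCk n Q'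

variable {W : Type*} [NormedAddCommGroup W] [NormedSpace ℝ W]
  {W₁ : Type*} [NormedAddCommGroup W₁] [NormedSpace ℝ W₁]
  {W₂ : Type*} [NormedAddCommGroup W₂] [NormedSpace ℝ W₂]

namespace JointCk

lemma continuous {n : ℕ} {Q : X → ℝ → W} (h : JointCk n Q) :
    Continuous fun p : X × ℝ => Q p.1 p.2 := by
  cases n with
  | zero => exact h
  | succ n => exact h.1

lemma of_succ {n : ℕ} {Q : X → ℝ → W} (h : JointCk (n + 1) Q) : JointCk n Q := by
  induction n generalizing Q with
  | zero => exact h.1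
  | succ n ih =>
    obtain ⟨h1, Q', h2, h3⟩ := h
    exact ⟨h1, Q', h2, ih h3⟩

lemma of_le {n m : ℕ} {Q : X → ℝ → W} (h : JointCk n Q) (hm : m ≤ n) : JointCk m Q := by
  induction n, hm using Nat.le_induction with
  | base => exact h
  | succ n _ ih => exact ih h.of_succ

lemma add {n : ℕ} {P Q : X → ℝ → W} (hP : JointCk n P) (hQ : JointCk n Q) :
    JointCk n fun c s => P c s + Q c s := by
  induction n generalizing P Q with
  | zero => exact Continuous.add hP hQ
  | succ n ih =>
    obtain ⟨P', hP', hP''⟩ := hP.2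
    obtain ⟨Q', hQ', hQ''⟩ := hQ.2
    exact ⟨hP.1.add hQ.1, _, fun c s => (hP' c s).add (hQ' c s), ih hP'' hQ''⟩

lemma bilin (B : W →L[ℝ] W₁ →L[ℝ] W₂) {n : ℕ} {P : X → ℝ → W} {Q : X → ℝ → W₁}
    (hP : JointCk n P) (hQ : JointCk n Q) : JointCk n fun c s => B (P c s) (Q c s) := by
  have hcont : ∀ {P : X → ℝ → W} {Q : X → ℝ → W₁}, (Continuous fun p : X × ℝ => P p.1 p.2) →
      (Continuous fun p : X × ℝ => Q p.1 p.2) →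
      Continuous fun p : X × ℝ => B (P p.1 p.2) (Q p.1 p.2) :=
    fun h1 h2 => B.continuous₂.comp (h1.prodMk h2)
  induction n generalizing P Q with
  | zero => exact hcont hP hQ
  | succ n ih =>
    obtain ⟨P', hP', hP''⟩ := hP.2
    obtain ⟨Q', hQ', hQ''⟩ := hQ.2
    refine ⟨hcont hP.1 hQ.1, _, fun c s => ?_, (ih hP.of_succ hQ'').add (ih hP'' hQ.of_succ)⟩
    exact B.hasDerivAt_of_bilinear (fun _ => hP' c s) (fun _ => hQ' c s)

lemma mul {n : ℕ} {P Q : X → ℝ → ℝ} (hP : JointCk n P) (hQ : JointCk n Q) :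
    JointCk n fun c s => P c s * Q c s := hP.bilin (ContinuousLinearMap.mul ℝ ℝ) hQ

lemma smul {n : ℕ} {P : X → ℝ → ℝ} {Q : X → ℝ → W} (hP : JointCk n P) (hQ : JointCk n Q) :
    JointCk n fun c s => P c s • Q c s := hP.bilin (ContinuousLinearMap.lsmul ℝ ℝ) hQ

lemma inner_plane {n : ℕ} {P Q : X → ℝ → Plane} (hP : JointCk n P) (hQ : JointCk n Q) :
    JointCk n fun c s => inner ℝ (P c s) (Q c s) := hP.bilin (innerSL ℝ) hQ

lemma const {f : X → W} (hf : Continuous f) (n : ℕ) : JointCk n fun c (_ : ℝ) => f c := by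
  induction n generalizing f with
  | zero => exact hf.comp continuous_fst
  | succ n ih =>
    exact ⟨hf.comp continuous_fst, fun _ _ => 0, fun c s => hasDerivAt_const _ _,
      ih continuous_const⟩

lemma comp {n : ℕ} {K : X → ℝ → W} {h : X → ℝ → ℝ} (hK : JointCk n K) (hh : JointCk n h) :
    JointCk n fun c s => K c (h c s) := by
  have hcont : ∀ {K : X → ℝ → W}, (Continuous fun p : X × ℝ => K p.1 p.2) →
      Continuous fun p : X × ℝ => K p.1 (h p.1 p.2) :=
    fun h1 => h1.comp (continuous_fst.prodMk hh.continuous)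
  induction n generalizing K with
  | zero => exact hcont hK
  | succ n ih =>
    obtain ⟨K', hK', hK''⟩ := hK.2
    obtain ⟨h', hh', hh''⟩ := hh.2
    exact ⟨hcont hK.1, _, fun c s => (hK' c (h c s)).scomp s (hh' c s),
      hh''.smul (ih hK'' hh.of_succ)⟩

/-- The derivative of `‖D‖⁻¹` is `-‖D‖⁻³ ⟪D, D'⟫`, again a product of `‖D‖⁻¹`, `D` and `D'`, so the
induction closes. -/
lemma inv_norm {n : ℕ} {D : X → ℝ → Plane} (hD : JointCk n D) (h0 : ∀ c s, D c s ≠ 0) :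
    JointCk n fun c s => ‖D c s‖⁻¹ := by
  have hcont : ∀ {D : X → ℝ → Plane}, (Continuous fun p : X × ℝ => D p.1 p.2) →
      (∀ c s, D c s ≠ 0) → Continuous fun p : X × ℝ => ‖D p.1 p.2‖⁻¹ :=
    fun h1 h2 => h1.norm.inv₀ fun p => norm_ne_zero_iff.2 (h2 _ _)
  induction n with
  | zero => exact hcont hD h0
  | succ n ih =>
    obtain ⟨D', hD', hD''⟩ := hD.2
    have hw := ih hD.of_succ
    refine ⟨hcont hD.1 h0, _, fun c s => ?_, ((const (continuous_const (y := (-1 : ℝ))) n).mul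
      ((hw.mul (hw.mul hw)).mul (hD.of_succ.inner_plane hD'')))⟩
    have hn : ‖D c s‖ ≠ 0 := norm_ne_zero_iff.2 (h0 c s)
    have h2 := ((hD' c s).norm_sq.sqrt (pow_ne_zero 2 hn)).inv
      (by rw [Real.sqrt_sq (norm_nonneg _)]; exact hn)
    have h3 : (fun u => ‖D c u‖⁻¹) = (fun u => √(‖D c u‖ ^ 2))⁻¹ := by
      funext u; rw [Pi.inv_apply, Real.sqrt_sq (norm_nonneg _)]
    change HasDerivAt (fun u => ‖D c u‖⁻¹) _ s
    rw [h3]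
    refine h2.congr_deriv ?_
    rw [Real.sqrt_sq (norm_nonneg _)]
    field_simp

lemma contDiff {n : ℕ} {Q : X → ℝ → W} (h : JointCk n Q) (c : X) : ContDiff ℝ n (Q c) := by
  induction n generalizing Q with
  | zero =>
    exact contDiff_zero.2 (h.continuous.comp (Continuous.prodMk_right c))
  | succ n ih =>
    obtain ⟨-, Q', hQ', hQ''⟩ := h
    push_cast
    rw [contDiff_succ_iff_deriv]
    refine ⟨fun s => (hQ' c s).differentiableAt, by simp, ?_⟩
    rw [show deriv (Q c) = Q' c from funext fun s => (hQ' c s).deriv]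
    exact ih hQ''

lemma deriv {n : ℕ} {Q : X → ℝ → W} (h : JointCk (n + 1) Q) :
    JointCk n fun c s => deriv (Q c) s := by
  obtain ⟨-, Q', hQ', hQ''⟩ := h
  rwa [show (fun c s => _root_.deriv (Q c) s) = Q' from
    funext fun c => funext fun s => (hQ' c s).deriv]

lemma continuous_iteratedDeriv {n j : ℕ} {Q : X → ℝ → W} (h : JointCk n Q) (hj : j ≤ n) :
    Continuous fun p : X × ℝ => iteratedDeriv j (Q p.1) p.2 := by
  induction j generalizing n Q with
  | zero => simpa using h.continuous
  | succ j ih =>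
    obtain ⟨n, rfl⟩ : ∃ k, n = k + 1 := ⟨n - 1, by omega⟩
    simp only [iteratedDeriv_succ']
    exact ih h.deriv (by omega)

/-- `JointCk` controls derivatives in the curve variable only. Arc length involves the derivative of
`F` in that variable, so a constant speed parametrization may lose a derivative in the parameter
`c`, but it loses none in `s`. -/
lemma of_contDiff {E : Type*} [NormedAddCommGroup E] [NormedSpace ℝ E] {n : ℕ} {F : E × ℝ → W}
    (hF : ContDiff ℝ n F) : JointCk n fun c s => F (c, s) := by
  induction n generalizing F with
  | zero => exact hF.continuous
  | succ n ih =>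
    refine ⟨hF.continuous, fun c s => fderiv ℝ F (c, s) (0, 1), fun c s => ?_,
      ih (F := fun p => fderiv ℝ F p (0, 1)) ?_⟩
    · have h1 : HasDerivAt (fun t : ℝ => ((c, t) : E × ℝ)) (0, 1) s :=
        (hasDerivAt_const _ _).prodMk (hasDerivAt_id _)
      exact ((hF.differentiable (by simp)) (c, s)).hasFDerivAt.comp_hasDerivAt s h1
    · exact (hF.fderiv_right (m := n) (by push_cast; exact le_rfl)).clm_apply contDiff_const

lemma comp_left {Y : Type*} [TopologicalSpace Y] {n : ℕ} {Q : X → ℝ → W} (h : JointCk n Q)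
    {f : Y → X} (hf : Continuous f) : JointCk n fun c s => Q (f c) s := by
  have hcont : ∀ {Q : X → ℝ → W}, (Continuous fun p : X × ℝ => Q p.1 p.2) →
      Continuous fun p : Y × ℝ => Q (f p.1) p.2 :=
    fun h1 => h1.comp ((hf.comp continuous_fst).prodMk continuous_snd)
  induction n generalizing Q with
  | zero => exact hcont h
  | succ n ih =>
    obtain ⟨h1, Q', h2, h3⟩ := h
    exact ⟨hcont h1, _, fun c s => h2 _ _, ih h3⟩

end JointCk

end JointCk
end

noncomputable section

/-! ### Constant speed parametrizations of families of curves -/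

lemma ckDistFun_nonneg (k : ℕ) (f g : ℝ → Plane) : 0 ≤ ckDistFun k f g :=
  Real.iSup_nonneg fun _ => Real.iSup_nonneg fun _ => norm_nonneg _

lemma ckDist_le {r k : ℕ} (σ τ : ConvexCurve r) (s₀ : ℝ) :
    ckDist k σ τ ≤ ckDistFun k (fun s => σ.toFun (s + s₀)) τ.toFun :=
  ciInf_le ⟨0, by rintro _ ⟨s, rfl⟩; exact ckDistFun_nonneg _ _ _⟩ s₀

lemma ckDistFun_le {k : ℕ} {f g : ℝ → Plane} {ε : ℝ}
    (h : ∀ j ≤ k, ∀ s, ‖iteratedDeriv j f s - iteratedDeriv j g s‖ ≤ ε) : ckDistFun k f g ≤ ε := by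
  have : Nonempty (Set.Icc (0:ℝ) 1) := ⟨⟨0, by simp⟩⟩
  exact ciSup_le fun j => ciSup_le fun s => h j (by omega) s

lemma periodic_iteratedDeriv {f : ℝ → Plane} (hf : Function.Periodic f 1) (j : ℕ) :
    Function.Periodic (iteratedDeriv j f) 1 := by
  induction j with
  | zero => simpa using hf
  | succ j ih => rw [iteratedDeriv_succ]; exact ConvexCurve.periodic_deriv ih

/-- Jointly continuous families of periodic functions converge uniformly with their derivatives. -/
lemma JointCk.eventually_close {X : Type*} [TopologicalSpace X] {n : ℕ} {Q : X → ℝ → Plane}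
    (hQ : JointCk n Q) (hper : ∀ c, Function.Periodic (Q c) 1) (c₀ : X) {ε : ℝ} (hε : 0 < ε) :
    ∀ᶠ c in 𝓝 c₀, ∀ j ≤ n, ∀ s, ‖iteratedDeriv j (Q c) s - iteratedDeriv j (Q c₀) s‖ < ε := by
  have key : ∀ j ≤ n, ∀ᶠ c in 𝓝 c₀, ∀ s,
      ‖iteratedDeriv j (Q c) s - iteratedDeriv j (Q c₀) s‖ < ε := by
    intro j hj
    have hc := hQ.continuous_iteratedDeriv hj
    have hc' : Continuous fun p : X × ℝ => iteratedDeriv j (Q c₀) p.2 :=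
      hc.comp (continuous_const.prodMk continuous_snd)
    have h1 : ∀ᶠ c in 𝓝 c₀, ∀ s ∈ Set.Icc (0:ℝ) 1,
        ‖iteratedDeriv j (Q c) s - iteratedDeriv j (Q c₀) s‖ < ε := by
      refine isCompact_Icc.eventually_forall_of_forall_eventually fun s _ => ?_
      refine (hc.sub hc').norm.continuousAt.eventually_lt continuousAt_const ?_
      simpa using hε
    filter_upwards [h1] with c hc s
    have h2 := hc (Int.fract s) ⟨Int.fract_nonneg s, (Int.fract_lt_one s).le⟩
    have e : ∀ c, iteratedDeriv j (Q c) (Int.fract s) = iteratedDeriv j (Q c) s := by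
      intro c
      have := (periodic_iteratedDeriv (hper c) j).sub_int_mul_eq (x := s) ⌊s⌋
      rwa [mul_one] at this
    rwa [e, e] at h2
  have h2 := (Finset.eventually_all (Finset.range (n + 1))).2 fun j hj =>
    key j (by have := Finset.mem_range.1 hj; omega)
  filter_upwards [h2] with c hc j hj
  exact hc j (Finset.mem_range.2 (by omega))

/-- The inverse functions of a jointly continuous family of increasing functions. -/
lemma continuous_inverse_family {X : Type*} [TopologicalSpace X] {g h : X → ℝ → ℝ}
    (hg : Continuous fun p : X × ℝ => g p.1 p.2) (hmono : ∀ c, StrictMono (g c))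
    (hgh : ∀ c s, g c (h c s) = s) : Continuous fun p : X × ℝ => h p.1 p.2 := by
  rw [continuous_iff_continuousAt]
  rintro ⟨c, s⟩
  refine Metric.tendsto_nhds.2 fun ε hε => ?_
  set t := h c s with ht
  have hl : ∀ u : ℝ, Continuous fun p : X × ℝ => g p.1 u :=
    fun u => hg.comp (continuous_fst.prodMk continuous_const)
  have h1 : ∀ᶠ p : X × ℝ in 𝓝 (c, s), g p.1 (t - ε) < p.2 :=
    (hl _).continuousAt.eventually_lt continuous_snd.continuousAt (by
      have := hmono c (show t - ε < t by linarith)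
      rw [ht, hgh] at this
      exact this)
  have h2 : ∀ᶠ p : X × ℝ in 𝓝 (c, s), p.2 < g p.1 (t + ε) :=
    continuous_snd.continuousAt.eventually_lt (hl _).continuousAt (by
      have := hmono c (show t < t + ε by linarith)
      rw [ht, hgh] at this
      exact this)
  filter_upwards [h1, h2] with p hp1 hp2
  rw [← hgh p.1 p.2] at hp1 hp2
  have a1 := (hmono p.1).lt_iff_lt.1 hp1
  have a2 := (hmono p.1).lt_iff_lt.1 hp2
  rw [Real.dist_eq, abs_lt]
  constructor <;> linarith

/-- The inverse of the normalized arc length. -/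
lemma exists_arclength_inverse {X : Type*} [TopologicalSpace X] {k : ℕ} {F : X → ℝ → Plane}
    (hF : JointCk (k + 1) F) (hper : ∀ c, Function.Periodic (F c) 1)
    (hreg : ∀ c s, deriv (F c) s ≠ 0) :
    ∃ (g h : X → ℝ → ℝ) (ℓ : X → ℝ), JointCk (k + 1) h ∧ (∀ c, 0 < ℓ c) ∧
      (∀ c s, h c (g c s) = s) ∧ (∀ c s, h c (s + 1) = h c s + 1) ∧
      (∀ c s, HasDerivAt (h c) (ℓ c * ‖deriv (F c) (h c s)‖⁻¹) s) ∧
      ∀ c v, 0 < v → (∀ s, ‖deriv (F c) s‖ = v) → ∀ s, h c s = s := by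
  have hD : JointCk k fun c s => deriv (F c) s := hF.deriv
  have hw := hD.inv_norm hreg
  have hDc : Continuous fun p : X × ℝ => deriv (F p.1) p.2 := hD.continuous
  obtain ⟨sp, hspdef⟩ : ∃ sp : X → ℝ → ℝ, ∀ c s, sp c s = ‖deriv (F c) s‖ := ⟨_, fun _ _ => rfl⟩
  have hsp : Continuous fun p : X × ℝ => sp p.1 p.2 := by
    simp only [hspdef]
    exact hDc.norm
  have hsp1 : ∀ c, Continuous (sp c) := fun c => hsp.comp (Continuous.prodMk_right c)
  have hpos : ∀ c s, 0 < sp c s := fun c s => by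
    rw [hspdef]; exact norm_pos_iff.2 (hreg c s)
  obtain ⟨G, hGdef⟩ : ∃ G : X → ℝ → ℝ, ∀ c s, G c s = ∫ t in (0:ℝ)..s, sp c t :=
    ⟨_, fun _ _ => rfl⟩
  have hG : Continuous fun p : X × ℝ => G p.1 p.2 := by
    have : Continuous (Function.uncurry fun (p : X × ℝ) (t : ℝ) => sp p.1 t) :=
      hsp.comp ((continuous_fst.comp continuous_fst).prodMk continuous_snd)
    simp only [hGdef]
    exact intervalIntegral.continuous_parametric_intervalIntegral_of_continuous this continuous_snd
  have hGd : ∀ c s, HasDerivAt (G c) (sp c s) s := fun c s => by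
    rw [show G c = fun s => ∫ t in (0:ℝ)..s, sp c t from funext (hGdef c)]
    exact intervalIntegral.integral_hasDerivAt_right ((hsp1 c).intervalIntegrable _ _)
      ((hsp1 c).stronglyMeasurableAtFilter _ _) (hsp1 c).continuousAt
  have hGm : ∀ c, StrictMono (G c) := fun c => strictMono_of_deriv_pos fun s => by
    rw [(hGd c s).deriv]; exact hpos c s
  have hG0 : ∀ c, G c 0 = 0 := fun c => by
    rw [hGdef, intervalIntegral.integral_same]
  obtain ⟨ℓ, hℓdef⟩ : ∃ ℓ : X → ℝ, ∀ c, ℓ c = G c 1 := ⟨_, fun _ => rfl⟩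
  have hℓ : Continuous ℓ := by
    rw [show ℓ = fun c => G c 1 from funext hℓdef]
    exact hG.comp (continuous_id.prodMk continuous_const)
  have hℓ0 : ∀ c, 0 < ℓ c := fun c => by
    have := hGm c (show (0:ℝ) < 1 from one_pos); rwa [hG0, ← hℓdef] at this
  have hG1 : ∀ c s, G c (s + 1) = G c s + ℓ c := by
    intro c s
    have h1 : ∀ a b, IntervalIntegrable (sp c) MeasureTheory.volume a b :=
      fun a b => (hsp1 c).intervalIntegrable a b
    have hp : Function.Periodic (sp c) 1 := fun t => by
      rw [hspdef, hspdef, ConvexCurve.periodic_deriv (hper c) t]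
    have := hp.intervalIntegral_add_eq 0 s
    rw [zero_add] at this
    rw [hℓdef, hGdef, hGdef, hGdef, this, intervalIntegral.integral_add_adjacent_intervals (h1 _ _) (h1 _ _)]
  obtain ⟨g, hgdef⟩ : ∃ g : X → ℝ → ℝ, ∀ c s, g c s = G c s / ℓ c := ⟨_, fun _ _ => rfl⟩
  have hg : Continuous fun p : X × ℝ => g p.1 p.2 := by
    simp only [hgdef]
    exact hG.div (hℓ.comp continuous_fst) fun p => (hℓ0 p.1).ne'
  have hgm : ∀ c, StrictMono (g c) := fun c a b hab => by
    rw [hgdef, hgdef]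
    exact div_lt_div_of_pos_right (hGm c hab) (hℓ0 c)
  have hgd : ∀ c s, HasDerivAt (g c) (sp c s / ℓ c) s := fun c s => by
    rw [show g c = fun s => G c s / ℓ c from funext (hgdef c)]
    exact (hGd c s).div_const _
  have hg1 : ∀ c s, g c (s + 1) = g c s + 1 := by
    intro c s
    rw [hgdef, hgdef, hG1, add_div, div_self (hℓ0 c).ne']
  -- Normalized arc length fixes the integers; with the intermediate value theorem this gives
  -- surjectivity.
  have hgn : ∀ c (n : ℤ), g c n = n := by
    intro c n
    have hper' : Function.Periodic (fun s => g c s - s) 1 := fun s => by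
      dsimp only; rw [hg1]; ring
    have := hper'.int_mul_eq n
    rw [mul_one] at this
    simp only [hgdef, hG0, zero_div, sub_zero] at this
    rw [hgdef]
    exact sub_eq_zero.1 this
  have hsurj : ∀ c, Function.Surjective (g c) := by
    intro c s
    have hc : Continuous (g c) := hg.comp (Continuous.prodMk_right c)
    have := intermediate_value_Icc (a := ((⌊s⌋ : ℤ) : ℝ)) (b := ((⌊s⌋ + 1 : ℤ) : ℝ))
      (by push_cast; linarith) hc.continuousOn
    rw [hgn, hgn] at this
    obtain ⟨u, -, hu⟩ := this ⟨Int.floor_le s, by push_cast; exact (Int.lt_floor_add_one s).le⟩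
    exact ⟨u, hu⟩
  choose h hgh using hsurj
  have hhg : ∀ c s, h c (g c s) = s := fun c s => (hgm c).injective (hgh c _)
  have hhc : Continuous fun p : X × ℝ => h p.1 p.2 := continuous_inverse_family hg hgm hgh
  have hh1 : ∀ c s, h c (s + 1) = h c s + 1 := fun c s => (hgm c).injective (by
    rw [hgh, hg1, hgh])
  have hhd : ∀ c s, HasDerivAt (h c) (ℓ c * ‖deriv (F c) (h c s)‖⁻¹) s := by
    intro c s
    have hc : ContinuousAt (h c) s := (hhc.comp (Continuous.prodMk_right c)).continuousAt
    have := HasDerivAt.of_local_left_inverse hc (hgd c (h c s))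
      (div_pos (hpos c _) (hℓ0 c)).ne' (Filter.Eventually.of_forall fun u => hgh c u)
    rwa [inv_div, div_eq_mul_inv, hspdef] at this
  -- Bootstrapping from `h' = ℓ / ‖F'(h)‖`: regularity of order `n` of `h` gives order `n + 1` as
  -- long as `F'` has order `n`.
  have hhC : ∀ n ≤ k + 1, JointCk n h := by
    intro n hn
    induction n with
    | zero => exact hhc
    | succ n ih =>
      exact ⟨hhc, _, hhd, (JointCk.const hℓ n).mul
        ((hw.of_le (by omega : n ≤ k)).comp (ih (by omega)))⟩
  refine ⟨g, h, ℓ, hhC _ le_rfl, hℓ0, hhg, hh1, hhd, fun c v hv hspeed s => ?_⟩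
  have e1 : ∀ s, G c s = s * v := by
    intro s
    rw [hGdef]
    simp only [hspdef, hspeed]
    rw [intervalIntegral.integral_const, sub_zero, smul_eq_mul]
  have e2 : g c (h c s) = h c s := by
    rw [hgdef, hℓdef, e1, e1, one_mul, mul_div_cancel_right₀ _ hv.ne']
  rw [← e2, hgh]

namespace ConvexCurve

variable {r : ℕ}

/-- At `c₀` the reparametrization is the identity, so the constant speed versions of the curves
converge to `σ` uniformly with `r` derivatives. Simplicity and positive curvature then come from
`exists_stability`. -/
lemma eventually_exists_curve_of_jointCk (σ : ConvexCurve r) (hr : 2 ≤ r) {X : Type*}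
    [TopologicalSpace X] {F : X → ℝ → Plane} (hF : JointCk r F)
    (hper : ∀ c, Function.Periodic (F c) 1) (hreg : ∀ c s, deriv (F c) s ≠ 0) {c₀ : X}
    (h0 : F c₀ = σ.toFun) {ε : ℝ} (hε : 0 < ε) :
    ∀ᶠ c in 𝓝 c₀, ∃ τ : ConvexCurve r, τ.trace = Set.range (F c) ∧ ckDist r σ τ < ε := by
  obtain ⟨k, rfl⟩ : ∃ k, r = k + 1 := ⟨r - 1, by omega⟩
  obtain ⟨g, h, ℓ, hhC, hℓ0, hhg, hh1, hhd, hid⟩ := exists_arclength_inverse hF hper hreg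
  have hFd : ∀ c s, HasDerivAt (F c) (deriv (F c) s) s := fun c s =>
    ((hF.contDiff c).differentiable (by simp) s).hasDerivAt
  let Q : X → ℝ → Plane := fun c s => F c (h c s)
  have hQ : JointCk (k + 1) Q := hF.comp hhC
  have hQp : ∀ c, Function.Periodic (Q c) 1 := fun c s => by
    simp only [Q]; rw [hh1, hper c]
  have hQd : ∀ c s, HasDerivAt (Q c) ((ℓ c * ‖deriv (F c) (h c s)‖⁻¹) • deriv (F c) (h c s)) s :=
    fun c s => (hFd c (h c s)).scomp s (hhd c s)
  have hQs : ∀ c s, ‖deriv (Q c) s‖ = ℓ c := by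
    intro c s
    rw [(hQd c s).deriv, norm_smul, norm_mul, norm_inv, norm_norm,
      Real.norm_of_nonneg (hℓ0 c).le, mul_assoc, inv_mul_cancel₀ (norm_pos_iff.2 (hreg c _)).ne', mul_one]
  have hQ0 : Q c₀ = σ.toFun := by
    obtain ⟨v, hv, hspeed⟩ := σ.const_speed
    funext s
    simp only [Q]
    rw [hid c₀ v hv (by rw [h0]; exact hspeed), h0]
  obtain ⟨ε₁, hε₁, hstab⟩ := σ.exists_stability hr
  filter_upwards [hQ.eventually_close hQp c₀ (lt_min hε₁ (half_pos hε))] with c hc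
  rw [hQ0] at hc
  have hc2 := hQ.contDiff c
  obtain ⟨hinj, hcurv⟩ := hstab (Q c) (hc2.of_le (by exact_mod_cast hr)) (hQp c)
    (fun s => by simpa using (hc 0 (by omega) s).trans_le (min_le_left _ _))
    (fun s => by simpa using (hc 1 (by omega) s).trans_le (min_le_left _ _))
    (fun s => by simpa [iteratedDeriv_succ'] using (hc 2 hr s).trans_le (min_le_left _ _))
  let τ : ConvexCurve (k + 1) := ⟨Q c, hc2, hQp c, hinj, ⟨ℓ c, hℓ0 c, hQs c⟩, hcurv⟩
  refine ⟨τ, ?_, ?_⟩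
  · ext z
    constructor
    · rintro ⟨s, rfl⟩; exact ⟨h c s, rfl⟩
    · rintro ⟨s, rfl⟩
      exact ⟨g c s, by simp only [τ, Q]; rw [hhg]⟩
  · refine lt_of_le_of_lt (ckDist_le σ τ 0) (lt_of_le_of_lt (ckDistFun_le (ε := ε / 2) ?_)
      (half_lt_self hε))
    intro j hj s
    simp only [add_zero]
    rw [norm_sub_rev]
    exact ((hc j hj s).trans_le (min_le_right _ _)).le

/-- Small deformations of a convex curve are convex curves that are close to it. -/
theorem eventually_exists_curve (σ : ConvexCurve r) (hr : 2 ≤ r) {E : Type*} [NormedAddCommGroup E]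
    [NormedSpace ℝ E] {F : E × ℝ → Plane} (hF : ContDiff ℝ r F)
    (hper : ∀ c, Function.Periodic (fun s => F (c, s)) 1) {c₀ : E}
    (h0 : ∀ s, F (c₀, s) = σ.toFun s) {ε : ℝ} (hε : 0 < ε) :
    ∀ᶠ c in 𝓝 c₀, ∃ τ : ConvexCurve r, τ.trace = Set.range (fun s => F (c, s)) ∧
      ckDist r σ τ < ε := by
  have hJ := JointCk.of_contDiff hF
  have h0' : (fun s => F (c₀, s)) = σ.toFun := funext h0
  obtain ⟨v, hv, hspeed⟩ := σ.const_speed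
  have hreg : ∀ᶠ c in 𝓝 c₀, ∀ s, deriv (fun s => F (c, s)) s ≠ 0 := by
    filter_upwards [hJ.eventually_close hper c₀ hv] with c hc s hs
    have h1 := hc 1 (by omega) s
    rw [iteratedDeriv_one, iteratedDeriv_one, hs, h0', zero_sub, norm_neg, hspeed] at h1
    exact lt_irrefl _ h1
  -- Nonvanishing speed is known only near `c₀`, so the family is restricted to the regular
  -- parameters, which form a neighbourhood of `c₀`.
  let X := {c : E // ∀ s, deriv (fun s => F (c, s)) s ≠ 0}
  have h1 := σ.eventually_exists_curve_of_jointCk hr (X := X) (F := fun c s => F (c.1, s))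
    (hJ.comp_left continuous_subtype_val) (fun c => hper c.1) (fun c => c.2)
    (c₀ := ⟨c₀, hreg.self_of_nhds⟩) h0' hε
  have h2 := map_nhds_subtype_coe_eq_nhds hreg.self_of_nhds hreg
  rw [← h2, Filter.eventually_map]
  exact h1

end ConvexCurve
end

noncomputable section

/-! ### Configurations of polygonal paths -/

/-- The path from `x` to `y` with the vertices `q`, continued by the constant `y`. -/
def toPath (x y : Plane) {m : ℕ} (q : Fin m → Plane) (k : ℕ) : Plane :=
  if h : 1 ≤ k ∧ k ≤ m then q ⟨k - 1, by omega⟩ else if k = 0 then x else y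

lemma toPath_zero (x y : Plane) {m : ℕ} (q : Fin m → Plane) : toPath x y q 0 = x := by
  simp [toPath]

lemma toPath_succ (x y : Plane) {m : ℕ} (q : Fin m → Plane) {k : ℕ} (hk : k < m) :
    toPath x y q (k + 1) = q ⟨k, hk⟩ := by
  rw [toPath, dif_pos (by omega)]; rfl

lemma toPath_tail (x y : Plane) {m : ℕ} (q : Fin m → Plane) {k : ℕ} (hk : m + 1 ≤ k) :
    toPath x y q k = y := by
  rw [toPath, dif_neg (by omega), if_neg (by omega)]

lemma IsPolyPath.eq_toPath {S : Set Plane} {m : ℕ} {x y : Plane} {P : ℕ → Plane}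
    (h : IsPolyPath S m x y P) : P = toPath x y fun k : Fin m => P (k + 1) := by
  funext k
  rcases Nat.eq_zero_or_pos k with rfl | hk
  · rw [toPath_zero, h.zero]
  · obtain ⟨k, rfl⟩ : ∃ l, k = l + 1 := ⟨k - 1, by omega⟩
    by_cases hm : k < m
    · rw [toPath_succ _ _ _ hm]
    · rw [toPath_tail _ _ _ (by omega), h.tail _ (by omega)]

lemma isPolyPath_toPath {S : Set Plane} {m : ℕ} (x y : Plane) {q : Fin m → Plane}
    (hq : ∀ k, q k ∈ S) : IsPolyPath S m x y (toPath x y q) where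
  zero := toPath_zero x y q
  tail _ hi := toPath_tail x y q hi
  mem i h1 h2 := by
    obtain ⟨i, rfl⟩ : ∃ l, i = l + 1 := ⟨i - 1, by omega⟩
    rw [toPath_succ x y q (by omega)]; exact hq _

lemma toPath_update (x y : Plane) {m : ℕ} (q : Fin m → Plane) (k : Fin m) (z : Plane) :
    toPath x y (Function.update q k z) = Function.update (toPath x y q) (k + 1) z := by
  funext l
  rcases Nat.eq_zero_or_pos l with rfl | hl
  · rw [toPath_zero, Function.update_of_ne (by omega), toPath_zero]
  · obtain ⟨l, rfl⟩ : ∃ j, l = j + 1 := ⟨l - 1, by omega⟩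
    by_cases hm : l < m
    · rw [toPath_succ _ _ _ hm]
      by_cases he : l = k
      · subst he
        rw [Function.update_self, Function.update_self]
      · rw [Function.update_of_ne (by intro h; exact he (congrArg Fin.val h)),
          Function.update_of_ne (by omega), toPath_succ _ _ _ hm]
    · rw [toPath_tail _ _ _ (by omega), Function.update_of_ne (by omega),
        toPath_tail _ _ _ (by omega)]

lemma continuous_toPath {m : ℕ} (k : ℕ) :
    Continuous fun p : (Plane × Plane) × (Fin m → Plane) => toPath p.1.1 p.1.2 p.2 k := by
  unfold toPath
  split_ifs <;> fun_prop

lemma dist_toPath_le {m : ℕ} {x y x' y' : Plane} {q q' : Fin m → Plane} {δ : ℝ} (hx : dist x x' ≤ δ)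
    (hy : dist y y' ≤ δ) (hq : ∀ k, dist (q k) (q' k) ≤ δ) (k : ℕ) :
    dist (toPath x y q k) (toPath x' y' q' k) ≤ δ := by
  unfold toPath
  split_ifs
  exacts [hq _, hx, hy]

lemma polyLen_le_add {m : ℕ} {P Q : ℕ → Plane} {δ : ℝ} (h : ∀ k, dist (P k) (Q k) ≤ δ) :
    polyLen m P ≤ polyLen m Q + 2 * (m + 1) * δ := by
  have : ∀ i ∈ Finset.range (m + 1), dist (P i) (P (i + 1)) ≤ dist (Q i) (Q (i + 1)) + 2 * δ := by
    intro i _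
    have h1 := dist_triangle4 (P i) (Q i) (Q (i + 1)) (P (i + 1))
    have h2 := h i
    have h3 := h (i + 1)
    rw [dist_comm (P (i + 1))] at h3
    linarith
  refine (Finset.sum_le_sum this).trans ?_
  rw [Finset.sum_add_distrib, Finset.sum_const, Finset.card_range, polyLen, nsmul_eq_mul]
  push_cast
  linarith

/-- The vertices of `n` paths; the path with index `i` has `i + 1` vertices. -/
abbrev Vtx (n : ℕ) : Type := (i : Fin n) × Fin (i.1 + 1)

/-- The path with index `i` of a configuration. -/
def pathOf (x y : Plane) {n : ℕ} (q : Vtx n → Plane) (i : Fin n) : ℕ → Plane :=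
  toPath x y fun k : Fin (i.1 + 1) => q ⟨i, k⟩

/-- The segments of a configuration. -/
abbrev Seg (n : ℕ) : Type := (i : Fin n) × Fin (i.1 + 2)

def segOf (x y : Plane) {n : ℕ} (q : Vtx n → Plane) (s : Seg n) : Set Plane :=
  segment ℝ (pathOf x y q s.1 s.2) (pathOf x y q s.1 (s.2 + 1))

/-- The label of the `k`-th point of the path with index `i`: a vertex, or one of the end points
`x` (`false`) and `y` (`true`). -/
def label {n : ℕ} (i : Fin n) (k : ℕ) : Vtx n ⊕ Bool :=
  if h : 1 ≤ k ∧ k ≤ i.1 + 1 then Sum.inl ⟨i, ⟨k - 1, by omega⟩⟩ else Sum.inr (decide (k ≠ 0))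

/-- The point with a given label. -/
def labelPt (x y : Plane) {n : ℕ} (q : Vtx n → Plane) : Vtx n ⊕ Bool → Plane
  | Sum.inl v => q v
  | Sum.inr b => if b then y else x

lemma pathOf_eq_labelPt (x y : Plane) {n : ℕ} (q : Vtx n → Plane) (i : Fin n) (k : ℕ) :
    pathOf x y q i k = labelPt x y q (label i k) := by
  unfold pathOf toPath label
  by_cases h : 1 ≤ k ∧ k ≤ i.1 + 1
  · rw [dif_pos h, dif_pos h]; rfl
  · rw [dif_neg h, dif_neg h]
    by_cases h0 : k = 0
    · simp [labelPt, h0]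
    · simp [labelPt, h0]

lemma continuous_pathOf {n : ℕ} (i : Fin n) (k : ℕ) :
    Continuous fun p : (Plane × Plane) × (Vtx n → Plane) => pathOf p.1.1 p.1.2 p.2 i k :=
  (continuous_toPath k).comp (continuous_fst.prodMk
    (continuous_pi fun l => by fun_prop))

/-- Two segments without common labels of end points. -/
def SegDisj {n : ℕ} (s t : Seg n) : Prop :=
  label s.1 s.2 ≠ label t.1 t.2 ∧ label s.1 s.2 ≠ label t.1 (t.2 + 1) ∧
    label s.1 (s.2 + 1) ≠ label t.1 t.2 ∧ label s.1 (s.2 + 1) ≠ label t.1 (t.2 + 1)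

/-- The vertices are distinct, and the paths do not return to their end points. -/
structure IsGeneric (x y : Plane) {n : ℕ} (q : Vtx n → Plane) : Prop where
  inj : Function.Injective q
  start_notMem : ∀ i : Fin n, ∀ k ≤ i.1,
    x ∉ segment ℝ (pathOf x y q i (k + 1)) (pathOf x y q i (k + 2))
  end_notMem : ∀ i : Fin n, ∀ k ≤ i.1,
    y ∉ segment ℝ (pathOf x y q i k) (pathOf x y q i (k + 1))

/-- No three segments without common end points have a common point. -/
def NoTriple (x y : Plane) {n : ℕ} (q : Vtx n → Plane) : Prop :=
  ∀ s₁ s₂ s₃ : Seg n, SegDisj s₁ s₂ → SegDisj s₁ s₃ → SegDisj s₂ s₃ →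
    ¬ ∃ z, z ∈ segOf x y q s₁ ∧ z ∈ segOf x y q s₂ ∧ z ∈ segOf x y q s₃

lemma isOpen_isGeneric (n : ℕ) :
    IsOpen {p : (Plane × Plane) × (Vtx n → Plane) | IsGeneric p.1.1 p.1.2 p.2} := by
  have heq : {p : (Plane × Plane) × (Vtx n → Plane) | IsGeneric p.1.1 p.1.2 p.2} =
      (⋂ v : {v : Vtx n × Vtx n // v.1 ≠ v.2}, {p | p.2 v.1.1 = p.2 v.1.2}ᶜ) ∩
      (⋂ v : Vtx n, {p | p.1.1 ∈ segment ℝ (pathOf p.1.1 p.1.2 p.2 v.1 (v.2 + 1))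
        (pathOf p.1.1 p.1.2 p.2 v.1 (v.2 + 2))}ᶜ) ∩
      (⋂ v : Vtx n, {p | p.1.2 ∈ segment ℝ (pathOf p.1.1 p.1.2 p.2 v.1 v.2)
        (pathOf p.1.1 p.1.2 p.2 v.1 (v.2 + 1))}ᶜ) := by
    ext p
    simp only [Set.mem_inter_iff, Set.mem_iInter, Set.mem_compl_iff, Set.mem_ofPred_eq]
    constructor
    · intro h
      exact ⟨⟨fun v hv => v.2 (h.inj hv), fun v => h.start_notMem v.1 v.2 (by omega)⟩,
        fun v => h.end_notMem v.1 v.2 (by omega)⟩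
    · rintro ⟨⟨h1, h2⟩, h3⟩
      exact ⟨fun v w hvw => by_contra fun hne => h1 ⟨(v, w), hne⟩ hvw,
        fun i k hk => h2 ⟨i, ⟨k, by omega⟩⟩, fun i k hk => h3 ⟨i, ⟨k, by omega⟩⟩⟩
  rw [heq]
  refine ((isOpen_iInter_of_finite fun v => ?_).inter (isOpen_iInter_of_finite fun v => ?_)).inter
    (isOpen_iInter_of_finite fun v => ?_)
  · exact (isClosed_eq (by fun_prop) (by fun_prop)).isOpen_compl
  · exact (ConvexCurve.isClosed_setOf_mem_segment (by fun_prop) (continuous_pathOf _ _)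
      (continuous_pathOf _ _)).isOpen_compl
  · exact (ConvexCurve.isClosed_setOf_mem_segment (by fun_prop) (continuous_pathOf _ _)
      (continuous_pathOf _ _)).isOpen_compl

/-- The common point is described by its position in `[0, 1]` on the first segment, and projection
along a compact factor is a closed map. -/
lemma isClosed_triple {X : Type*} [TopologicalSpace X] {a₁ b₁ a₂ b₂ a₃ b₃ : X → Plane}
    (ha₁ : Continuous a₁) (hb₁ : Continuous b₁) (ha₂ : Continuous a₂) (hb₂ : Continuous b₂)
    (ha₃ : Continuous a₃) (hb₃ : Continuous b₃) :
    IsClosed {p | ∃ z, z ∈ segment ℝ (a₁ p) (b₁ p) ∧ z ∈ segment ℝ (a₂ p) (b₂ p) ∧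
      z ∈ segment ℝ (a₃ p) (b₃ p)} := by
  let I := Set.Icc (0:ℝ) 1
  let f : (X → Plane) → (X → Plane) → X × I → Plane :=
    fun a b w => a w.1 + (w.2 : ℝ) • (b w.1 - a w.1)
  have hf : ∀ {a b : X → Plane}, Continuous a → Continuous b → Continuous (f a b) := by
    intro a b ha hb
    simp only [f]
    fun_prop
  have hcl : IsClosed {w : X × I | f a₁ b₁ w ∈ segment ℝ (a₂ w.1) (b₂ w.1) ∧
      f a₁ b₁ w ∈ segment ℝ (a₃ w.1) (b₃ w.1)} :=
    (ConvexCurve.isClosed_setOf_mem_segment (hf ha₁ hb₁) (by fun_prop) (by fun_prop)).inter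
      (ConvexCurve.isClosed_setOf_mem_segment (hf ha₁ hb₁) (by fun_prop) (by fun_prop))
  convert isClosedMap_fst_of_compactSpace _ hcl using 1
  ext p
  constructor
  · rintro ⟨z, h1, h2, h3⟩
    rw [segment_eq_image'] at h1
    obtain ⟨t, ht, rfl⟩ := h1
    exact ⟨(p, ⟨t, ht⟩), ⟨h2, h3⟩, rfl⟩
  · rintro ⟨⟨p, t⟩, ⟨h2, h3⟩, rfl⟩
    refine ⟨_, ?_, h2, h3⟩
    rw [segment_eq_image']
    exact ⟨t, t.2, rfl⟩

lemma isOpen_noTriple (n : ℕ) :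
    IsOpen {p : (Plane × Plane) × (Vtx n → Plane) | NoTriple p.1.1 p.1.2 p.2} := by
  classical
  have heq : {p : (Plane × Plane) × (Vtx n → Plane) | NoTriple p.1.1 p.1.2 p.2} =
      ⋂ s : {s : Seg n × Seg n × Seg n // SegDisj s.1 s.2.1 ∧ SegDisj s.1 s.2.2 ∧
        SegDisj s.2.1 s.2.2}, {p | ∃ z, z ∈ segOf p.1.1 p.1.2 p.2 s.1.1 ∧
          z ∈ segOf p.1.1 p.1.2 p.2 s.1.2.1 ∧ z ∈ segOf p.1.1 p.1.2 p.2 s.1.2.2}ᶜ := by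
    ext p
    simp only [Set.mem_iInter, Set.mem_compl_iff, Set.mem_ofPred_eq, NoTriple]
    exact ⟨fun h s => h _ _ _ s.2.1 s.2.2.1 s.2.2.2,
      fun h s₁ s₂ s₃ h1 h2 h3 => h ⟨(s₁, s₂, s₃), h1, h2, h3⟩⟩
  rw [heq]
  refine isOpen_iInter_of_finite fun s => ?_
  exact (isClosed_triple (continuous_pathOf _ _) (continuous_pathOf _ _) (continuous_pathOf _ _)
    (continuous_pathOf _ _) (continuous_pathOf _ _) (continuous_pathOf _ _)).isOpen_compl

/-- The existence of longest paths in a neighbourhood of a configuration in general position; this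
property is stable under small changes of all data. -/
def Robust (n : ℕ) (S : Set Plane) (x y : Plane) : Prop :=
  ∃ (p q₀ : Vtx n → Plane) (ρ : ℝ), (∀ v, q₀ v ∈ S) ∧ dist q₀ p < ρ ∧
    (∀ q ∈ Metric.closedBall p ρ, IsGeneric x y q ∧ NoTriple x y q) ∧
    ∀ (i : Fin n) (q : Fin (i.1 + 1) → Plane), (∀ k, q k ∈ S) → dist q (fun k => p ⟨i, k⟩) = ρ →
      polyLen (i.1 + 1) (toPath x y q) < polyLen (i.1 + 1) (pathOf x y q₀ i)

/-- On the compact sphere the distances to `S` plus the deficit in length have a positive lower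
bound, so configurations close to `S` cannot reach the length of `q₀` there. Only the position of
the point set matters, not its derivatives. -/
lemma Robust.stable {n : ℕ} {S : Set Plane} {x y : Plane} (hS : IsClosed S)
    (h : Robust n S x y) : ∃ δ > 0, ∀ (S' : Set Plane) (x' y' : Plane),
      (∀ z ∈ S', ∃ w ∈ S, dist z w ≤ δ) → (∀ w ∈ S, ∃ z ∈ S', dist z w ≤ δ) →
      dist x' x ≤ δ → dist y' y ≤ δ → Robust n S' x' y' := by
  obtain ⟨p, q₀, ρ, hq₀, hball, hgp, hmax⟩ := h
  -- general position
  have e1 : ∀ᶠ z : Plane × Plane in 𝓝 (x, y), ∀ q ∈ Metric.closedBall p ρ,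
      IsGeneric z.1 z.2 q ∧ NoTriple z.1 z.2 q := by
    refine (isCompact_closedBall p ρ).eventually_forall_of_forall_eventually fun q hq => ?_
    exact ((isOpen_isGeneric n).eventually_mem (show ((x, y), q) ∈ _ from (hgp q hq).1)).and
      ((isOpen_noTriple n).eventually_mem (show ((x, y), q) ∈ _ from (hgp q hq).2))
  obtain ⟨δ₁, hδ₁, e1⟩ := Metric.eventually_nhds_iff_ball.1 e1
  -- lengths
  have e2 : ∀ i : Fin n, ∃ η > 0, ∀ q ∈ Metric.sphere (fun k : Fin (i.1 + 1) => p ⟨i, k⟩) ρ,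
      η ≤ ∑ k, Metric.infDist (q k) S +
        max 0 (polyLen (i.1 + 1) (pathOf x y q₀ i) - polyLen (i.1 + 1) (toPath x y q)) := by
    intro i
    have hc : Continuous fun q : Fin (i.1 + 1) → Plane => toPath x y q :=
      continuous_pi fun k => (continuous_toPath (m := i.1 + 1) k).comp
        ((continuous_const (y := (x, y))).prodMk continuous_id)
    have hc2 := (continuous_polyLen (i.1 + 1)).comp hc
    have hcont : Continuous fun q : Fin (i.1 + 1) → Plane => ∑ k, Metric.infDist (q k) S +
        max 0 (polyLen (i.1 + 1) (pathOf x y q₀ i) - polyLen (i.1 + 1) (toPath x y q)) := by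
      refine Continuous.add ?_ (continuous_const.max (continuous_const.sub hc2))
      exact continuous_finsetSum _ fun k _ =>
        (Metric.continuous_infDist_pt S).comp (continuous_apply k)
    refine (isCompact_sphere _ ρ).exists_forall_le' hcont.continuousOn fun q hq => ?_
    by_contra! hle
    have h1 : ∀ k, 0 ≤ Metric.infDist (q k) S := fun k => Metric.infDist_nonneg
    have h2 := Finset.sum_nonneg fun k (_ : k ∈ Finset.univ) => h1 k
    have h3 := le_max_left 0
      (polyLen (i.1 + 1) (pathOf x y q₀ i) - polyLen (i.1 + 1) (toPath x y q))
    have h4 := le_max_right 0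
      (polyLen (i.1 + 1) (pathOf x y q₀ i) - polyLen (i.1 + 1) (toPath x y q))
    have h5 : ∑ k, Metric.infDist (q k) S = 0 := by linarith
    have h6 := (Finset.sum_eq_zero_iff_of_nonneg fun k _ => h1 k).1 h5
    have h7 := hmax i q (fun k => (hS.mem_iff_infDist_zero ⟨_, hq₀ ⟨i, k⟩⟩).2
      (h6 k (Finset.mem_univ k))) hq
    linarith
  choose η hη e2 using e2
  -- The constant `5`: the distances to `S` sum to at most `(i + 1) δ`, and each of the two lengths
  -- changes by at most `2 (i + 2) δ`.
  have hsmall : ∀ᶠ δ : ℝ in 𝓝[>] 0, δ < δ₁ ∧ δ < ρ - dist q₀ p ∧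
      ∀ i : Fin n, (5 * (i.1 + 2) : ℝ) * δ < η i := by
    have hev : ∀ (C b : ℝ), 0 < b → ∀ᶠ δ : ℝ in 𝓝[>] 0, C * δ < b := by
      intro C b hb
      have : Filter.Tendsto (fun δ : ℝ => C * δ) (𝓝[>] 0) (𝓝 0) := by
        have h : Continuous fun δ : ℝ => C * δ := by fun_prop
        simpa using (h.tendsto 0).mono_left nhdsWithin_le_nhds
      exact this.eventually_lt_const hb
    have a1 := hev 1 δ₁ hδ₁
    have a2 := hev 1 (ρ - dist q₀ p) (by linarith)
    have a3 := Filter.eventually_all.2 fun i : Fin n => hev (5 * (i.1 + 2) : ℝ) (η i) (hη i)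
    filter_upwards [a1, a2, a3] with δ b1 b2 b3
    exact ⟨by linarith, by linarith, b3⟩
  obtain ⟨δ, ⟨hd1, hd2, hd3⟩, hδ⟩ := (hsmall.and self_mem_nhdsWithin).exists
  have hδ0 : (0:ℝ) < δ := hδ
  refine ⟨δ, hδ0, fun S' x' y' hS1 hS2 hx hy => ?_⟩
  choose q₁ hq₁ hd using fun v => hS2 (q₀ v) (hq₀ v)
  refine ⟨p, q₁, ρ, hq₁, ?_, ?_, ?_⟩
  · have : dist q₁ q₀ ≤ δ := (dist_pi_le_iff hδ0.le).2 hd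
    have := dist_triangle q₁ q₀ p
    linarith
  · exact e1 (x', y') (by
      rw [Metric.mem_ball, Prod.dist_eq]; exact max_lt (by linarith) (by linarith))
  · intro i q hq hqρ
    have h1 := e2 i q hqρ
    have h2 : ∑ k, Metric.infDist (q k) S ≤ (i.1 + 1) * δ := by
      have : ∀ k ∈ Finset.univ, Metric.infDist (q k) S ≤ δ := by
        intro k _
        obtain ⟨w, hw, hwd⟩ := hS1 (q k) (hq k)
        exact (Metric.infDist_le_dist_of_mem hw).trans hwd
      refine (Finset.sum_le_card_nsmul _ _ _ this).trans ?_
      rw [Finset.card_univ, Fintype.card_fin, nsmul_eq_mul]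
      push_cast; exact le_rfl
    have h3 := polyLen_le_add (m := i.1 + 1) (δ := δ) fun k => dist_toPath_le (q := q) (q' := q)
      hx hy (fun k => by rw [dist_self]; exact hδ0.le) k
    have h4 : polyLen (i.1 + 1) (pathOf x y q₀ i) ≤ polyLen (i.1 + 1) (pathOf x' y' q₁ i) +
        2 * ((i.1 + 1 : ℕ) + 1) * δ :=
      polyLen_le_add fun k => dist_toPath_le (by rw [dist_comm]; exact hx)
        (by rw [dist_comm]; exact hy) (fun k => by rw [dist_comm]; exact hd _) k
    have h5 := hd3 i
    push_cast at h3 h4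
    rcases max_cases 0
      (polyLen (i.1 + 1) (pathOf x y q₀ i) - polyLen (i.1 + 1) (toPath x y q)) with h6 | h6
    · have : (0:ℝ) ≤ i.1 := Nat.cast_nonneg _
      nlinarith
    · nlinarith

end

noncomputable section

/-! ### Billiard paths from robust configurations -/

namespace ConvexCurve

variable {r : ℕ}

/-- A longest configuration near a robust one. -/
lemma exists_refl_of_robust (σ : ConvexCurve r) (hr : 2 ≤ r) {n : ℕ} {x y : Plane}
    (h : Robust n σ.trace x y) : ∃ q : Vtx n → Plane, (∀ v, q v ∈ σ.trace) ∧ IsGeneric x y q ∧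
      NoTriple x y q ∧ ∀ i : Fin n, ∀ k ≤ i.1,
        pathOf x y q i k ≠ pathOf x y q i (k + 1) → pathOf x y q i (k + 1) ≠ pathOf x y q i (k + 2) →
        σ.Refl (pathOf x y q i k) (pathOf x y q i (k + 1)) (pathOf x y q i (k + 2)) := by
  obtain ⟨p, q₀, ρ, hq₀, hball, hgp, hmax⟩ := h
  have hρ : 0 < ρ := dist_nonneg.trans_lt hball
  -- A maximum over the part of the closed ball with vertices on the curve is at least as long as
  -- `q₀`, hence not on the sphere. It is therefore a local maximum in each vertex.
  have hex : ∀ i : Fin n, ∃ q : Fin (i.1 + 1) → Plane, (∀ k, q k ∈ σ.trace) ∧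
      dist q (fun k => p ⟨i, k⟩) < ρ ∧ ∀ q' : Fin (i.1 + 1) → Plane, (∀ k, q' k ∈ σ.trace) →
        dist q' (fun k => p ⟨i, k⟩) ≤ ρ →
        polyLen (i.1 + 1) (toPath x y q') ≤ polyLen (i.1 + 1) (toPath x y q) := by
    intro i
    have hK : IsCompact ((Set.univ.pi fun _ : Fin (i.1 + 1) => σ.trace) ∩
        Metric.closedBall (fun k => p ⟨i, k⟩) ρ) :=
      (isCompact_univ_pi fun _ => σ.isCompact_trace).inter_right Metric.isClosed_closedBall
    have hd₀ : dist (fun k => q₀ ⟨i, k⟩) (fun k => p ⟨i, k⟩) ≤ ρ :=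
      (dist_pi_le_iff hρ.le).2 fun k => (dist_le_pi_dist q₀ p ⟨i, k⟩).trans hball.le
    have hc : Continuous fun q : Fin (i.1 + 1) → Plane => polyLen (i.1 + 1) (toPath x y q) :=
      (continuous_polyLen _).comp (continuous_pi fun k => (continuous_toPath (m := i.1 + 1) k).comp
        ((continuous_const (y := (x, y))).prodMk continuous_id))
    obtain ⟨q, ⟨hq1, hq2⟩, hqm⟩ := hK.exists_isMaxOn
      ⟨fun k => q₀ ⟨i, k⟩, fun k _ => hq₀ _, hd₀⟩ hc.continuousOn
    have hqm' := isMaxOn_iff.1 hqm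
    refine ⟨q, fun k => hq1 k trivial, lt_of_le_of_ne hq2 fun he => ?_, fun q' h1 h2 =>
      hqm' q' ⟨fun k _ => h1 k, h2⟩⟩
    have h1 := hmax i q (fun k => hq1 k trivial) he
    have h2 := hqm' (fun k => q₀ ⟨i, k⟩) ⟨fun k _ => hq₀ _, hd₀⟩
    exact absurd h1 (not_lt.2 h2)
  choose q hqS hqρ hqm using hex
  have hqb : (fun v : Vtx n => q v.1 v.2) ∈ Metric.closedBall p ρ :=
    Metric.mem_closedBall.2 ((dist_pi_le_iff hρ.le).2 fun v =>
      (dist_le_pi_dist (q v.1) (fun k => p ⟨v.1, k⟩) v.2).trans (hqρ v.1).le)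
  refine ⟨fun v => q v.1 v.2, fun v => hqS _ _, (hgp _ hqb).1, (hgp _ hqb).2, ?_⟩
  intro i k hk hne1 hne2
  have hP : pathOf x y (fun v : Vtx n => q v.1 v.2) i = toPath x y (q i) := rfl
  rw [hP] at hne1 hne2 ⊢
  set P := toPath x y (q i) with hPdef
  have hPk : P (k + 1) = q i ⟨k, by omega⟩ := toPath_succ x y (q i) (by omega)
  obtain ⟨s, hs⟩ := hqS i ⟨k, by omega⟩
  rw [hPk, ← hs] at hne1 hne2 ⊢
  refine σ.refl_of_isLocalMax hr hne1 hne2.symm ?_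
  have hct : Continuous fun t => Function.update (q i) ⟨k, by omega⟩ (σ.toFun t) :=
    (continuous_const (y := q i)).update _ σ.continuous
  have hnear : ∀ᶠ t in 𝓝 s, dist (Function.update (q i) ⟨k, by omega⟩ (σ.toFun t))
      (fun k => p ⟨i, k⟩) < ρ := by
    refine (hct.dist continuous_const).continuousAt.eventually_lt continuousAt_const ?_
    rw [hs, Function.update_eq_self]
    exact hqρ i
  filter_upwards [hnear] with t ht
  have h1 := hqm i (Function.update (q i) ⟨k, by omega⟩ (σ.toFun t)) (fun l => by
    by_cases hl : l = ⟨k, by omega⟩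
    · subst hl; rw [Function.update_self]; exact ⟨t, rfl⟩
    · rw [Function.update_of_ne hl]; exact hqS i l) ht.le
  rw [toPath_update, polyLen_update _ k (by omega), ← hPdef, hPk, ← hs] at h1
  linarith

/-- The reflection law in terms of the angle of incidence. -/
lemma Refl.exists_angle {σ : ConvexCurve r} (hr : 2 ≤ r) {a p b : Plane} (h : σ.Refl a p b)
    (ha : a ∈ σ.table) (hb : b ∈ σ.table) (hap : a ≠ p) (hbp : b ≠ p) :
    ∃ s α : ℝ, σ.toFun s = p ∧ α ∈ Set.Ioo 0 Real.pi ∧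
      unitDir a p = Real.cos α • σ.T s - Real.sin α • σ.N s ∧
      unitDir p b = Real.cos α • σ.T s + Real.sin α • σ.N s := by
  obtain ⟨s, rfl, h⟩ := h
  have hd0 : 0 < ‖deriv σ.toFun s‖ := norm_pos_iff.2 (σ.deriv_ne_zero s)
  set T := σ.T s with hT
  have hTn : ‖T‖ = 1 := by
    rw [hT, ConvexCurve.T, norm_smul, norm_inv, norm_norm, inv_mul_cancel₀ hd0.ne']
  have hT2 := plane_norm_sq T
  rw [hTn] at hT2
  have hi : inner ℝ (unitDir a (σ.toFun s)) T = inner ℝ (unitDir (σ.toFun s) b) T := by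
    rw [hT, ConvexCurve.T, inner_smul_right, inner_smul_right, h]
  have hc : ∀ c ∈ σ.table, c ≠ σ.toFun s → 0 < cross T (unitDir (σ.toFun s) c) := by
    intro c hc hcs
    rw [hT, ConvexCurve.T, cross_smul_left]
    exact mul_pos (inv_pos.2 hd0) (σ.cross_unitDir_pos hr hc hcs)
  have hca := hc a ha hap
  have hcb := hc b hb hbp
  have hN : σ.N s = rot90 T := rfl
  rw [unitDir_neg a (σ.toFun s)] at hca
  set e := unitDir a (σ.toFun s)
  set f := unitDir (σ.toFun s) b
  have hen : ‖e‖ = 1 := norm_unitDir hap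
  have hfn : ‖f‖ = 1 := norm_unitDir hbp.symm
  have he2 := plane_norm_sq e
  have hf2 := plane_norm_sq f
  rw [hen] at he2
  rw [hfn] at hf2
  rw [plane_inner, plane_inner] at hi
  have hsq : (f 0 * T 0 + f 1 * T 1) ^ 2 + cross T f ^ 2 = 1 := by
    rw [cross]; linear_combination (-(f 0 ^ 2 + f 1 ^ 2)) * hT2 - hf2
  set c := f 0 * T 0 + f 1 * T 1 with hcdef
  have hc1 : -1 < c := by nlinarith [sq_nonneg (c - 1), sq_nonneg (c + 1)]
  have hc2 : c < 1 := by nlinarith [sq_nonneg (c - 1), sq_nonneg (c + 1)]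
  have hcos : Real.cos (Real.arccos c) = c := Real.cos_arccos hc1.le hc2.le
  have hsin : Real.sin (Real.arccos c) = cross T f := by
    rw [Real.sin_arccos, show 1 - c ^ 2 = cross T f ^ 2 by linarith, Real.sqrt_sq hcb.le]
  have hce : cross T (-e) = cross T f := by
    have hsq' : cross T (-e) ^ 2 = cross T f ^ 2 := by
      have : (e 0 * T 0 + e 1 * T 1) ^ 2 + cross T (-e) ^ 2 = 1 := by
        simp only [cross, PiLp.neg_apply]
        linear_combination (-(e 0 ^ 2 + e 1 ^ 2)) * hT2 - he2
      rw [hi] at this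
      linarith
    exact (sq_eq_sq₀ hca.le hcb.le).1 hsq'
  refine ⟨s, Real.arccos c, rfl, ⟨Real.arccos_pos.2 hc2, ?_⟩, ?_, ?_⟩
  · refine lt_of_le_of_ne (Real.arccos_le_pi c) fun h => ?_
    rw [h, Real.cos_pi] at hcos
    linarith
  · rw [hcos, hsin, ← hce, hN, ← hi]
    apply plane_ext
    · simp only [PiLp.sub_apply, PiLp.smul_apply, smul_eq_mul, rot90_apply_zero, cross,
        PiLp.neg_apply]
      linear_combination (e 0) * hT2
    · simp only [PiLp.sub_apply, PiLp.smul_apply, smul_eq_mul, rot90_apply_one, cross,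
        PiLp.neg_apply]
      linear_combination (e 1) * hT2
  · rw [hcos, hsin, hN]
    apply plane_ext
    · simp only [PiLp.add_apply, PiLp.smul_apply, smul_eq_mul, rot90_apply_zero, cross]
      linear_combination (f 0) * hT2
    · simp only [PiLp.add_apply, PiLp.smul_apply, smul_eq_mul, rot90_apply_one, cross]
      linear_combination (f 1) * hT2

end ConvexCurve

lemma pathOf_zero (x y : Plane) {n : ℕ} (q : Vtx n → Plane) (i : Fin n) : pathOf x y q i 0 = x :=
  toPath_zero _ _ _

lemma pathOf_succ (x y : Plane) {n : ℕ} (q : Vtx n → Plane) (i : Fin n) {k : ℕ} (hk : k ≤ i.1) :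
    pathOf x y q i (k + 1) = q ⟨i, ⟨k, by omega⟩⟩ := toPath_succ _ _ _ _

lemma pathOf_tail (x y : Plane) {n : ℕ} (q : Vtx n → Plane) (i : Fin n) {k : ℕ}
    (hk : i.1 + 2 ≤ k) : pathOf x y q i k = y := toPath_tail _ _ _ hk

namespace IsGeneric

variable {x y : Plane} {n : ℕ} {q : Vtx n → Plane}

lemma vertex_ne_start (h : IsGeneric x y q) (v : Vtx n) : q v ≠ x := by
  intro e
  refine h.start_notMem v.1 v.2 (by omega) ?_
  rw [pathOf_succ x y q v.1 (by omega : v.2.1 ≤ v.1.1)]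
  exact e ▸ left_mem_segment ℝ _ _

lemma vertex_ne_end (h : IsGeneric x y q) (v : Vtx n) : q v ≠ y := by
  intro e
  refine h.end_notMem v.1 v.2 (by omega) ?_
  rw [pathOf_succ x y q v.1 (by omega : v.2.1 ≤ v.1.1)]
  exact e ▸ right_mem_segment ℝ _ _

lemma eq_of_pathOf_eq (h : IsGeneric x y q) {i j : Fin n} {k l : ℕ} (hk : k ≤ i.1) (hl : l ≤ j.1)
    (he : pathOf x y q i (k + 1) = pathOf x y q j (l + 1)) : i = j ∧ k = l := by
  rw [pathOf_succ x y q i hk, pathOf_succ x y q j hl] at he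
  have := h.inj he
  obtain ⟨rfl, h2⟩ := Sigma.mk.inj this
  exact ⟨rfl, congrArg Fin.val (eq_of_heq h2)⟩

lemma ne_succ (h : IsGeneric x y q) (i : Fin n) {k : ℕ} (hk : k ≤ i.1 + 1) :
    pathOf x y q i k ≠ pathOf x y q i (k + 1) := by
  rcases Nat.eq_zero_or_pos k with rfl | h0
  · rw [pathOf_zero, pathOf_succ x y q i (Nat.zero_le _)]
    exact (h.vertex_ne_start _).symm
  · obtain ⟨k, rfl⟩ : ∃ l, k = l + 1 := ⟨k - 1, by omega⟩
    by_cases h1 : k + 1 ≤ i.1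
    · intro he
      have := (h.eq_of_pathOf_eq (by omega) h1 he).2
      omega
    · rw [pathOf_tail x y q i (k := k + 1 + 1) (by omega), pathOf_succ x y q i (k := k) (by omega)]
      exact h.vertex_ne_end _

end IsGeneric

lemma mem_segment_or_of_common {a p b z : Plane} (h1 : z ∈ segment ℝ p a) (h2 : z ∈ segment ℝ p b)
    (hz : z ≠ p) : a ∈ segment ℝ p b ∨ b ∈ segment ℝ p a := by
  have hd := (unitDir_eq_of_mem_segment hz h1).symm.trans (unitDir_eq_of_mem_segment hz h2)
  rcases le_total (dist p a) (dist p b) with hle | hle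
  · exact Or.inl (mem_segment_of_unitDir_eq hd hle)
  · exact Or.inr (mem_segment_of_unitDir_eq hd.symm hle)

namespace ConvexCurve

variable {r : ℕ}

section

variable {σ : ConvexCurve r} {x y : Plane} {n : ℕ} {q : Vtx n → Plane}

lemma pathOf_mem_table (hx : x ∈ σ.table) (hy : y ∈ σ.table) (hq : ∀ v, q v ∈ σ.trace) (i : Fin n)
    (k : ℕ) : pathOf x y q i k ∈ σ.table := by
  rcases Nat.eq_zero_or_pos k with rfl | h0
  · rw [pathOf_zero]; exact hx
  · obtain ⟨k, rfl⟩ : ∃ l, k = l + 1 := ⟨k - 1, by omega⟩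
    by_cases h1 : k ≤ i.1
    · rw [pathOf_succ x y q i h1]; exact σ.trace_subset_table (hq _)
    · rw [pathOf_tail x y q i (by omega)]; exact hy

/-- Consecutive segments meet only in their common vertex. -/
lemma eq_of_mem_adjacent (hr : 2 ≤ r) (hx : x ∈ interior σ.table) (hy : y ∈ interior σ.table)
    (hq : ∀ v, q v ∈ σ.trace) (hg : IsGeneric x y q) (i : Fin n) {k : ℕ} (hk : k ≤ i.1) {z : Plane}
    (h1 : z ∈ segment ℝ (pathOf x y q i k) (pathOf x y q i (k + 1)))
    (h2 : z ∈ segment ℝ (pathOf x y q i (k + 1)) (pathOf x y q i (k + 2))) :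
    z = pathOf x y q i (k + 1) := by
  by_contra hz
  have hxS := σ.notMem_trace_of_mem_interior hr hx
  have hyS := σ.notMem_trace_of_mem_interior hr hy
  have hT := pathOf_mem_table (interior_subset hx) (interior_subset hy) hq i
  have n1 := hg.ne_succ i (k := k) (by omega)
  have n2 := hg.ne_succ i (k := k + 1) (by omega)
  have n3 : pathOf x y q i k ∈ σ.trace → pathOf x y q i (k + 2) ∈ σ.trace →
      pathOf x y q i k ≠ pathOf x y q i (k + 2) := by
    intro a1 a2 he
    have b1 : k ≠ 0 := by
      rintro rfl; rw [pathOf_zero] at a1; exact hxS a1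
    have b2 : k + 1 ≤ i.1 := by
      by_contra hc; rw [pathOf_tail x y q i (by omega)] at a2; exact hyS a2
    obtain ⟨k, rfl⟩ : ∃ l, k = l + 1 := ⟨k - 1, by omega⟩
    have := (hg.eq_of_pathOf_eq (by omega) (by omega) he).2
    omega
  rw [segment_symm] at h1
  -- Overlapping segments would put the outer end of one on the other. An end on the boundary would
  -- then be an end of that segment too, and `x` and `y` are excluded by genericity.
  rcases mem_segment_or_of_common h1 h2 hz with h | h
  · rcases Nat.eq_zero_or_pos k with rfl | h0
    · rw [pathOf_zero] at h
      exact hg.start_notMem i 0 (by omega) h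
    · have hS : pathOf x y q i k ∈ σ.trace := by
        obtain ⟨l, rfl⟩ : ∃ l, k = l + 1 := ⟨k - 1, by omega⟩
        rw [pathOf_succ x y q i (by omega)]; exact hq _
      rcases σ.eq_or_eq_of_mem_segment hr (hT _) (hT _) hS h with h3 | h3
      · exact n1 h3
      · exact n3 hS (h3 ▸ hS) h3
  · by_cases hl : k = i.1
    · rw [pathOf_tail x y q i (k := k + 2) (by omega), segment_symm] at h
      exact hg.end_notMem i k (by omega) h
    · have hS : pathOf x y q i (k + 2) ∈ σ.trace := by
        rw [pathOf_succ x y q i (k := k + 1) (by omega)]; exact hq _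
      rcases σ.eq_or_eq_of_mem_segment hr (hT _) (hT _) hS h with h3 | h3
      · exact n2 h3.symm
      · exact n3 (h3 ▸ hS) hS h3.symm

lemma label_eq_inl {i : Fin n} {k : ℕ} {v : Vtx n} (h : label i k = Sum.inl v) :
    i = v.1 ∧ k = v.2.1 + 1 := by
  unfold label at h
  split_ifs at h with h1
  cases h
  exact ⟨rfl, by simp only; omega⟩

lemma label_eq_inr {i : Fin n} {k : ℕ} {b : Bool} (h : label i k = Sum.inr b) :
    (b = false ∧ k = 0) ∨ (b = true ∧ i.1 + 2 ≤ k) := by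
  unfold label at h
  split_ifs at h with h1
  have h2 := Sum.inr.inj h
  by_cases h0 : k = 0
  · left; rw [← h2]; simp [h0]
  · right; rw [← h2]; refine ⟨by simp [h0], by omega⟩

/-- If three segments meet in a point other than `x` and `y`, they have no common end points. -/
lemma segDisj_of_triple (hr : 2 ≤ r) (hx : x ∈ interior σ.table) (hy : y ∈ interior σ.table)
    (hq : ∀ v, q v ∈ σ.trace) (hg : IsGeneric x y q) {s t u : Seg n} (hst : s ≠ t) (hsu : u ≠ s)
    (htu : u ≠ t) {z : Plane} (hzx : z ≠ x) (hzy : z ≠ y) (hs : z ∈ segOf x y q s)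
    (ht : z ∈ segOf x y q t) (hu : z ∈ segOf x y q u) : SegDisj s t := by
  have hT := fun i k => pathOf_mem_table (interior_subset hx) (interior_subset hy) hq (n := n) i k
  obtain ⟨i, k⟩ := s
  obtain ⟨j, l⟩ := t
  -- a common label is impossible
  have key : ∀ a b : ℕ, (a = k ∨ a = k + 1) → (b = l ∨ b = l + 1) → label i a ≠ label j b := by
    intro a b ha hb he
    obtain hv | ⟨c, hc⟩ : (∃ v, label i a = Sum.inl v) ∨ ∃ c, label i a = Sum.inr c := by
      rcases label i a with v | c
      · exact Or.inl ⟨v, rfl⟩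
      · exact Or.inr ⟨c, rfl⟩
    · obtain ⟨v, hv⟩ := hv
      obtain ⟨hi, hav⟩ := label_eq_inl hv
      obtain ⟨hj, hbv⟩ := label_eq_inl (he ▸ hv)
      obtain ⟨i', w⟩ := v
      dsimp only at hi hj hav hbv
      obtain rfl : j = i := hj.trans hi.symm
      subst hi
      rename' j => i
      have hkl : (k : ℕ) ≠ l := fun h => hst (by rw [Fin.ext h])
      -- Two segments with a common vertex are consecutive and meet only there. A third segment
      -- through this boundary point has it as an end, and so is one of the two.
      have hz : z = pathOf x y q i (w.1 + 1) := by
        have hlt : ∀ k l : Fin (i.1 + 2), (k : ℕ) < l → z ∈ segOf x y q ⟨i, k⟩ →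
            z ∈ segOf x y q ⟨i, l⟩ → w.1 + 1 = k + 1 → w.1 + 1 = l →
            z = pathOf x y q i (w.1 + 1) := by
          intro k l _ h1 h2 e1 e2
          unfold segOf at h1 h2
          dsimp only at h1 h2
          rw [← e2] at h2
          rw [← e1, show (k : ℕ) = w.1 by omega] at h1
          exact eq_of_mem_adjacent hr hx hy hq hg i (by omega) h1 h2
        rcases lt_or_gt_of_ne hkl with h | h
        · exact hlt k l h hs ht (by omega) (by omega)
        · exact hlt l k h ht hs (by omega) (by omega)
      have hzS : z ∈ σ.trace := by
        rw [hz, pathOf_succ x y q i (by omega)]; exact hq _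
      -- the third segment
      obtain ⟨c, e⟩ := u
      have hend : ∃ d : ℕ, (d = e ∨ d = e + 1) ∧ z = pathOf x y q c d := by
        rcases σ.eq_or_eq_of_mem_segment hr (hT _ _) (hT _ _) hzS hu with h | h
        · exact ⟨e, Or.inl rfl, h⟩
        · exact ⟨e + 1, Or.inr rfl, h⟩
      obtain ⟨d, hd, hzd⟩ := hend
      have hd0 : d ≠ 0 := by
        rintro rfl; rw [pathOf_zero] at hzd; exact hzx hzd
      have hd1 : d ≤ c.1 + 1 := by
        by_contra hcon; rw [pathOf_tail x y q c (by omega)] at hzd; exact hzy hzd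
      obtain ⟨d, rfl⟩ : ∃ m, d = m + 1 := ⟨d - 1, by omega⟩
      obtain ⟨rfl, rfl⟩ := hg.eq_of_pathOf_eq (by omega) (by omega) (hz.symm.trans hzd)
      have h1 : (e : ℕ) = k ∨ (e : ℕ) = l := by omega
      rcases h1 with h1 | h1
      · exact hsu (by rw [Fin.ext h1])
      · exact htu (by rw [Fin.ext h1])
    -- Segments of different paths that share `x` or `y` and meet elsewhere lie on one ray, so they
    -- would end in the same vertex.
    · have hc' : label j b = Sum.inr c := he ▸ hc
      have hne : i ≠ j := by
        rintro rfl
        rcases label_eq_inr hc with ⟨h1, h2⟩ | ⟨h1, h2⟩ <;>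
          rcases label_eq_inr hc' with ⟨h3, h4⟩ | ⟨h3, h4⟩
        · exact hst (by rw [show k = l from Fin.ext (by omega)])
        · rw [h1] at h3; cases h3
        · rw [h1] at h3; cases h3
        · exact hst (by rw [show k = l from Fin.ext (by omega)])
      rcases label_eq_inr hc with ⟨h1, h2⟩ | ⟨h1, h2⟩ <;>
        rcases label_eq_inr hc' with ⟨h3, h4⟩ | ⟨h3, h4⟩
      · unfold segOf at hs ht
        dsimp only at hs ht
        rw [show (k : ℕ) = 0 by omega, pathOf_zero] at hs
        rw [show (l : ℕ) = 0 by omega, pathOf_zero] at ht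
        have hd := (unitDir_eq_of_mem_segment hzx hs).symm.trans (unitDir_eq_of_mem_segment hzx ht)
        rw [pathOf_succ x y q i (by omega), pathOf_succ x y q j (by omega)] at hd
        have := hg.inj (σ.eq_of_unitDir_eq hr (interior_subset hx) (hq _) (hq _)
          (hg.vertex_ne_start _) (hg.vertex_ne_start _) hd)
        exact hne (congrArg Sigma.fst this)
      · rw [h1] at h3; cases h3
      · rw [h1] at h3; cases h3
      · unfold segOf at hs ht
        dsimp only at hs ht
        rw [show (k : ℕ) = i.1 + 1 by omega, pathOf_tail x y q i (k := i.1 + 1 + 1) (by omega),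
          segment_symm] at hs
        rw [show (l : ℕ) = j.1 + 1 by omega, pathOf_tail x y q j (k := j.1 + 1 + 1) (by omega),
          segment_symm] at ht
        have hd := (unitDir_eq_of_mem_segment hzy hs).symm.trans (unitDir_eq_of_mem_segment hzy ht)
        rw [pathOf_succ x y q i (by omega), pathOf_succ x y q j (by omega)] at hd
        have := hg.inj (σ.eq_of_unitDir_eq hr (interior_subset hy) (hq _) (hq _)
          (hg.vertex_ne_end _) (hg.vertex_ne_end _) hd)
        exact hne (congrArg Sigma.fst this)
  exact ⟨key _ _ (Or.inl rfl) (Or.inl rfl), key _ _ (Or.inl rfl) (Or.inr rfl),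
    key _ _ (Or.inr rfl) (Or.inl rfl), key _ _ (Or.inr rfl) (Or.inr rfl)⟩

end

/-- Local maxima in the robust neighbourhood are billiard paths, told apart by their numbers of
vertices. `NoTriple` concerns only segments without common ends, but by `segDisj_of_triple` three
segments meeting away from `x` and `y` are of this kind. -/
theorem exists_generalPosition_of_robust (σ : ConvexCurve r) (hr : 2 ≤ r) {n : ℕ} {x y : Plane}
    (hx : x ∈ interior σ.table) (hy : y ∈ interior σ.table) (h : Robust n σ.trace x y) :
    ∃ γ : Fin n → BilliardPath σ x y, Function.Injective γ ∧ InGeneralPosition γ := by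
  obtain ⟨q, hq, hg, hnt, hrefl⟩ := σ.exists_refl_of_robust hr h
  have hT := fun i k => pathOf_mem_table (interior_subset hx) (interior_subset hy) hq (n := n) i k
  let γ : Fin n → BilliardPath σ x y := fun i =>
    { m := i.1 + 1
      pt := fun k => pathOf x y q i k
      start_mem := hx
      end_mem := hy
      pt_zero := pathOf_zero x y q i
      pt_last := pathOf_tail x y q i (by simp)
      pt_ne := fun k => by
        simpa using hg.ne_succ i (k := k) (by omega)
      segment_subset := fun k => (σ.convex_table hr).segment_subset (hT _ _) (hT _ _)
      reflect := fun k => by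
        have n1 := hg.ne_succ i (k := k) (by omega)
        have n2 := hg.ne_succ i (k := k + 1) (by omega)
        exact (hrefl i k (by omega) n1 n2).exists_angle hr (hT _ _) (hT _ _) n1 n2.symm }
  have hm : ∀ i, (γ i).m = i.1 + 1 := fun i => rfl
  have hseg : ∀ (i : Fin n) (k : Fin (i.1 + 2)), (γ i).seg k = segOf x y q ⟨i, k⟩ := fun i k => rfl
  refine ⟨γ, fun i j hij => ?_, ?_, ?_, ?_, ?_⟩
  · have := congrArg BilliardPath.m hij
    rw [hm, hm] at this
    exact Fin.ext (by omega)
  · intro i j hij k l he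
    have hk : k.1 < i.1 + 1 := k.2
    have hl : l.1 < j.1 + 1 := l.2
    exact hij (hg.eq_of_pathOf_eq (k := k.1) (l := l.1) (by omega) (by omega) he).1
  · intro i k l he
    have hk : k.1 < i.1 + 1 := k.2
    have hl : l.1 < i.1 + 1 := l.2
    exact Fin.ext (hg.eq_of_pathOf_eq (k := k.1) (l := l.1) (by omega) (by omega) he).2
  · intro z hzx hzy
    by_contra! hcard
    obtain ⟨t, hts, ht3⟩ := Set.exists_subset_encard_eq (k := 3)
      (show (3 : ℕ∞) ≤ _ from Order.add_one_le_of_lt hcard)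
    obtain ⟨a, b, c, hab, hac, hbc, rfl⟩ := Set.encard_eq_three.1 ht3
    have ha : z ∈ segOf x y q a := hts (by simp)
    have hb : z ∈ segOf x y q b := hts (by simp)
    have hc : z ∈ segOf x y q c := hts (by simp)
    exact hnt a b c
      (segDisj_of_triple hr hx hy hq hg hab hac.symm hbc.symm hzx hzy ha hb hc)
      (segDisj_of_triple hr hx hy hq hg hac hab.symm hbc hzx hzy ha hc hb)
      (segDisj_of_triple hr hx hy hq hg hbc hab hac hzx hzy hb hc ha) ⟨z, ha, hb, hc⟩
  · intro i
    constructor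
    · rintro ⟨k, u, hu, h0, -, he⟩
      have hxs : x ∈ segment ℝ (pathOf x y q i k) (pathOf x y q i (k + 1)) := by
        rw [segment_eq_image_lineMap]; exact ⟨u, hu, he.symm⟩
      have hk' : k.1 < i.1 + 2 := k.2
      rcases Nat.eq_zero_or_pos k.1 with hk | hk
      · have he' : x = AffineMap.lineMap (pathOf x y q i k.1) (pathOf x y q i (k.1 + 1)) u := he
        rw [hk, pathOf_zero, eq_comm, AffineMap.lineMap_eq_left_iff] at he'
        rcases he' with h1 | h1
        · have := hg.ne_succ i (k := 0) (by omega)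
          rw [pathOf_zero] at this
          exact this h1
        · exact h0 ⟨Fin.ext hk, h1⟩
      · obtain ⟨l, hl⟩ : ∃ l, k.1 = l + 1 := ⟨k.1 - 1, by omega⟩
        rw [hl] at hxs
        exact hg.start_notMem i l (by omega) hxs
    · rintro ⟨k, u, hu, -, h0, he⟩
      have hys : y ∈ segment ℝ (pathOf x y q i k) (pathOf x y q i (k + 1)) := by
        rw [segment_eq_image_lineMap]; exact ⟨u, hu, he.symm⟩
      have hk' : k.1 < i.1 + 2 := k.2
      by_cases hk : k.1 ≤ i.1
      · exact hg.end_notMem i k hk hys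
      · have hk2 : k.1 = i.1 + 1 := by omega
        have he' : y = AffineMap.lineMap (pathOf x y q i k.1) (pathOf x y q i (k.1 + 1)) u := he
        rw [pathOf_tail x y q i (k := k.1 + 1) (by omega), eq_comm,
          AffineMap.lineMap_eq_right_iff] at he'
        rcases he' with h1 | h1
        · have := hg.ne_succ i (k := k.1) (by omega)
          rw [pathOf_tail x y q i (k := k.1 + 1) (by omega)] at this
          exact this h1
        · exact h0 ⟨Fin.ext hk2, h1⟩

/-- Arbitrarily many paths in general position cannot be blocked by a finite set. -/
theorem insecure_of_generalPosition {σ : ConvexCurve r} {x y : Plane}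
    (h : ∀ n : ℕ, ∃ γ : Fin n → BilliardPath σ x y, Function.Injective γ ∧ InGeneralPosition γ) :
    Insecure σ x y := by
  classical
  rintro ⟨B, hB, hsub, hblock⟩
  -- With `2 |B| + 1` paths some blocking point lies on three of them, hence on three segments.
  obtain ⟨γ, -, hγ⟩ := h (2 * hB.toFinset.card + 1)
  choose b hb using fun i => hblock (γ i)
  have hmaps : ∀ i ∈ (Finset.univ : Finset (Fin (2 * hB.toFinset.card + 1))), b i ∈ hB.toFinset :=
    fun i _ => hB.mem_toFinset.2 (hb i).2
  obtain ⟨z, hz, hcard⟩ := Finset.exists_lt_card_fiber_of_mul_lt_card_of_maps_to hmaps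
    (n := 2) (by rw [Finset.card_univ, Fintype.card_fin]; omega)
  have hzB := hsub (hB.mem_toFinset.1 hz)
  have hzxy : z ≠ x ∧ z ≠ y := by
    have := hzB.2
    simp only [Set.mem_insert_iff, Set.mem_singleton_iff, not_or] at this
    exact this
  choose k hk using fun i => Set.mem_iUnion.1 (hb i).1
  have h3 := hγ.no_triple z hzxy.1 hzxy.2
  set F := Finset.univ.filter fun i => b i = z with hF
  have hinj : Function.Injective fun i => (⟨i, k i⟩ : (i : Fin _) × Fin ((γ i).m + 1)) :=
    fun i j hij => congrArg Sigma.fst hij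
  have hsub2 : ((fun i => (⟨i, k i⟩ : (i : Fin _) × Fin ((γ i).m + 1))) '' (F : Set (Fin _))) ⊆
      {p : (i : Fin _) × Fin ((γ i).m + 1) | z ∈ (γ p.1).seg p.2} := by
    rintro _ ⟨i, hi, rfl⟩
    have : b i = z := (Finset.mem_filter.1 hi).2
    rw [Set.mem_ofPred_eq, ← this]
    exact hk i
  have h4 := (Set.encard_le_encard hsub2).trans h3
  rw [hinj.encard_image, Set.encard_coe_eq_coe_finsetCard] at h4
  have : F.card ≤ 2 := by exact_mod_cast h4
  omega

end ConvexCurve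
end

noncomputable section

/-! ### Nondegenerate maxima and small deformations -/

/-- A small affine change of variables which preserves the derivative of a `C²` function at a point
changes the function, up to a constant, by a small quadratic error only. -/
lemma exists_le_of_fderiv_comp_eq {V : Type*} [NormedAddCommGroup V] [NormedSpace ℝ V] {L : V → ℝ}
    {p : V} (hL : ContDiffAt ℝ 2 L p) {κ : ℝ} (hκ : 0 < κ) :
    ∃ δ > 0, ∀ (a : V) (M : V →L[ℝ] V), ‖a‖ < δ → ‖M‖ < δ →
      (∀ v, fderiv ℝ L (p + a) (v + M v) = fderiv ℝ L p v) →
      ∀ h, ‖h‖ < δ → L (p + a + (h + M h)) - L (p + a) ≤ L (p + h) - L p + κ * ‖h‖ ^ 2 := by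
  have hD : ContDiffAt ℝ 1 (fderiv ℝ L) p := hL.fderiv_right (by norm_num)
  obtain ⟨A, hA⟩ : ∃ A, HasStrictFDerivAt (fderiv ℝ L) A p :=
    ⟨_, hD.hasStrictFDerivAt (by norm_num)⟩
  have e1 := hA.isLittleO.def (show (0:ℝ) < κ / 10 by positivity)
  have e2 : ∀ᶠ u in 𝓝 p, DifferentiableAt ℝ L u :=
    (hL.eventually (by simp)).mono fun u hu => hu.differentiableAt (by norm_num)
  obtain ⟨r₁, hr₁, e1⟩ := Metric.eventually_nhds_iff_ball.1 e1
  obtain ⟨r₂, hr₂, e2⟩ := Metric.eventually_nhds_iff_ball.1 e2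
  have hA0 : 0 ≤ ‖A‖ := norm_nonneg A
  refine ⟨min (min 1 (κ / (6 * (‖A‖ + 1)))) (min (r₁ / 4) (r₂ / 4)), by positivity, ?_⟩
  intro a M ha hM hcrit h hh
  simp only [lt_min_iff] at ha hM hh
  have hM1 : ‖M‖ ≤ 1 := hM.1.1.le
  have hAM : ‖A‖ * ‖M‖ ≤ κ / 6 := by
    have := hM.1.2
    rw [lt_div_iff₀ (by positivity)] at this
    nlinarith [norm_nonneg M]
  -- The derivative of `g` vanishes at `0` by the condition on `fderiv`; it is at most `κ ‖h‖` on
  -- the ball of radius `‖h‖`, and the mean value inequality gives the quadratic error.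
  let g : V → ℝ := fun v => L (p + a + (v + M v)) - L (p + v)
  have hMv : ∀ v, ‖v + M v‖ ≤ 2 * ‖v‖ := by
    intro v
    have h1 := norm_add_le v (M v)
    have h2 := M.le_opNorm v
    nlinarith [norm_nonneg v]
  have hin1 : ∀ v, ‖v‖ ≤ ‖h‖ → ‖a + (v + M v)‖ < r₁ ∧ ‖a + (v + M v)‖ < r₂ := by
    intro v hv
    have h1 := norm_add_le a (v + M v)
    have h2 := hMv v
    constructor <;> linarith
  have hder : ∀ v, ‖v‖ ≤ ‖h‖ → HasFDerivAt g
      ((fderiv ℝ L (p + a + (v + M v))).comp (ContinuousLinearMap.id ℝ V + M) -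
        fderiv ℝ L (p + v)) v := by
    intro v hv
    have h1 : HasFDerivAt (fun v => p + a + (v + M v)) (ContinuousLinearMap.id ℝ V + M) v :=
      ((hasFDerivAt_id v).add M.hasFDerivAt).const_add (p + a)
    have h2 : HasFDerivAt (fun v => p + v) (ContinuousLinearMap.id ℝ V) v :=
      (hasFDerivAt_id v).const_add p
    have h3 : DifferentiableAt ℝ L (p + a + (v + M v)) := e2 _ (by
      rw [mem_ball_iff_norm, add_assoc, add_sub_cancel_left]; exact (hin1 v hv).2)
    have h4 : DifferentiableAt ℝ L (p + v) := e2 _ (by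
      rw [mem_ball_iff_norm, add_sub_cancel_left]; linarith)
    have h5 := (h3.hasFDerivAt.comp v h1).sub (h4.hasFDerivAt.comp v h2)
    rw [ContinuousLinearMap.comp_id] at h5
    exact h5
  have hbd : ∀ v, ‖v‖ ≤ ‖h‖ → ‖(fderiv ℝ L (p + a + (v + M v))).comp
      (ContinuousLinearMap.id ℝ V + M) - fderiv ℝ L (p + v)‖ ≤ κ * ‖h‖ := by
    intro v hv
    refine ContinuousLinearMap.opNorm_le_bound _ (by positivity) fun w => ?_
    have s1 := e1 (p + a + (v + M v), p + a) (by
      rw [← ball_prod_same]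
      exact ⟨by rw [mem_ball_iff_norm, add_assoc, add_sub_cancel_left]; exact (hin1 v hv).1,
        by rw [mem_ball_iff_norm, add_sub_cancel_left]; linarith⟩)
    have s2 := e1 (p + v, p) (by
      rw [← ball_prod_same]
      exact ⟨by rw [mem_ball_iff_norm, add_sub_cancel_left]; linarith, Metric.mem_ball_self hr₁⟩)
    dsimp only at s1 s2
    rw [add_sub_cancel_left] at s1 s2
    have t1 := ((fderiv ℝ L (p + a + (v + M v)) - fderiv ℝ L (p + a) - A (v + M v)).le_opNorm
      (w + M w)).trans (mul_le_mul s1 (hMv w) (norm_nonneg _) (by positivity))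
    have t2 := ((fderiv ℝ L (p + v) - fderiv ℝ L p - A v).le_opNorm w).trans
      (mul_le_mul_of_nonneg_right s2 (norm_nonneg _))
    have t3 : ‖A (M v) (w + M w)‖ ≤ κ / 6 * ‖v‖ * (2 * ‖w‖) := by
      refine ((A (M v)).le_opNorm _).trans (mul_le_mul ?_ (hMv w) (norm_nonneg _) (by positivity))
      refine (A.le_opNorm _).trans ?_
      have := M.le_opNorm v
      nlinarith [norm_nonneg v]
    have t4 : ‖A v (M w)‖ ≤ κ / 6 * ‖v‖ * ‖w‖ := by
      refine ((A v).le_opNorm _).trans ?_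
      have h1 := M.le_opNorm w
      have h2 := A.le_opNorm v
      calc ‖A v‖ * ‖M w‖ ≤ (‖A‖ * ‖v‖) * (‖M‖ * ‖w‖) := by gcongr
        _ = (‖A‖ * ‖M‖) * (‖v‖ * ‖w‖) := by ring
        _ ≤ κ / 6 * (‖v‖ * ‖w‖) := by gcongr
        _ = _ := by ring
    -- The terms of order zero cancel by `hcrit`. Two Taylor remainders of the derivative and two
    -- terms containing the small map `M` are left.
    have hid : ((fderiv ℝ L (p + a + (v + M v))).comp (ContinuousLinearMap.id ℝ V + M) -
        fderiv ℝ L (p + v)) w =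
        (fderiv ℝ L (p + a + (v + M v)) - fderiv ℝ L (p + a) - A (v + M v)) (w + M w) -
        (fderiv ℝ L (p + v) - fderiv ℝ L p - A v) w + A (M v) (w + M w) + A v (M w) := by
      have h1 := hcrit w
      simp only [sub_apply, ContinuousLinearMap.comp_apply, add_apply, ContinuousLinearMap.id_apply, map_add] at h1 ⊢
      linarith
    rw [hid]
    refine (norm_add₃_le).trans ?_
    have t5 := norm_sub_le
      ((fderiv ℝ L (p + a + (v + M v)) - fderiv ℝ L (p + a) - A (v + M v)) (w + M w))
      ((fderiv ℝ L (p + v) - fderiv ℝ L p - A v) w)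
    have t6 := hMv v
    have t7 : ‖v‖ * ‖w‖ ≤ ‖h‖ * ‖w‖ := by gcongr
    have t8 : ‖v + M v‖ * ‖w‖ ≤ 2 * ‖v‖ * ‖w‖ := by gcongr
    have t9 : κ * (‖v + M v‖ * ‖w‖) ≤ κ * (2 * ‖v‖ * ‖w‖) := by gcongr
    have t10 : κ * (‖v‖ * ‖w‖) ≤ κ * (‖h‖ * ‖w‖) := by gcongr
    linarith
  have hmv := (convex_closedBall (0:V) ‖h‖).norm_image_sub_le_of_norm_hasFDerivWithin_le
    (f := g) (C := κ * ‖h‖) (x := 0) (y := h)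
    (fun v hv => (hder v (by simpa using hv)).hasFDerivWithinAt)
    (fun v hv => hbd v (by simpa using hv)) (by simp) (by simp)
  have h1 := (le_abs_self _).trans hmv
  simp only [g, map_zero, add_zero, sub_zero] at h1
  nlinarith

/-- Pushing points in directions in which a function decreases. -/
lemma exists_push {ι F : Type*} [Fintype ι] [DecidableEq ι] [NormedAddCommGroup F] [NormedSpace ℝ F]
    {L : (ι → F) → ℝ} {p : ι → F} (hL : ContDiffAt ℝ 2 L p) (w : ι → F)
    (hw : ∀ k, fderiv ℝ L p (Pi.single k (w k)) < 0) :
    ∃ ρ > 0, ∃ κ > 0, ∃ e₀ > 0, ∀ e, 0 < e → e < e₀ → ∀ z, ‖z - p‖ ≤ ρ →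
      ‖(fun k => z k + (e * ‖z k - p k‖ ^ 2) • w k) - p‖ ≤ 2 * ‖z - p‖ ∧
      L (fun k => z k + (e * ‖z k - p k‖ ^ 2) • w k) ≤ L z - e * κ * ‖z - p‖ ^ 2 := by
  obtain ⟨κ, hκ', hκ⟩ : ∃ κ : ℝ, (∀ k, fderiv ℝ L p (Pi.single k (w k)) < -κ) ∧ 0 < κ := by
    have h1 : ∀ᶠ κ : ℝ in 𝓝[>] 0, ∀ k, fderiv ℝ L p (Pi.single k (w k)) < -κ := by
      refine Filter.eventually_all.2 fun k => ?_
      have : Filter.Tendsto (fun κ : ℝ => -κ) (𝓝[>] 0) (𝓝 0) := by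
        simpa using (continuous_neg.tendsto (0:ℝ)).mono_left nhdsWithin_le_nhds
      exact this.eventually_const_lt (hw k)
    exact (h1.and self_mem_nhdsWithin).exists
  have hD : ContinuousAt (fderiv ℝ L) p := (hL.fderiv_right (m := 1) (by norm_num)).continuousAt
  have e1 : ∀ᶠ u in 𝓝 p, ∀ k, fderiv ℝ L u (Pi.single k (w k)) < -κ :=
    Filter.eventually_all.2 fun k =>
      (hD.clm_apply continuousAt_const).eventually_lt_const (hκ' k)
  have e2 : ∀ᶠ u in 𝓝 p, DifferentiableAt ℝ L u :=
    (hL.eventually (by simp)).mono fun u hu => hu.differentiableAt (by norm_num)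
  obtain ⟨r₁, hr₁, e1⟩ := Metric.eventually_nhds_iff_ball.1 (e1.and e2)
  have hw0 : 0 ≤ ‖w‖ := norm_nonneg w
  -- For `e` below this bound and distances at most `1` the push is no longer than the distance
  -- itself; the radius `r₁ / 3` keeps the pushed point, at most twice as far away, in the good
  -- ball.
  refine ⟨min 1 (r₁ / 3), by positivity, κ, hκ, 1 / (‖w‖ + 1), by positivity, ?_⟩
  intro e he he0 z hz
  rw [lt_div_iff₀ (by positivity)] at he0
  have hz1 := hz.trans (min_le_left _ _)
  have hz2 := hz.trans (min_le_right _ _)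
  have hk : ∀ k, ‖z k - p k‖ ≤ ‖z - p‖ := fun k => norm_le_pi_norm (z - p) k
  set j : ι → F := fun k => z k + (e * ‖z k - p k‖ ^ 2) • w k with hj
  have hjp : ‖j - p‖ ≤ 2 * ‖z - p‖ := by
    refine (pi_norm_le_iff_of_nonneg (by positivity)).2 fun k => ?_
    have h1 : (j - p) k = (z k - p k) + (e * ‖z k - p k‖ ^ 2) • w k := by
      simp only [hj, Pi.sub_apply]; abel
    rw [h1]
    refine (norm_add_le _ _).trans ?_
    rw [norm_smul, Real.norm_of_nonneg (by positivity)]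
    have h2 := norm_le_pi_norm w k
    have h3 := hk k
    have h4 : e * ‖w k‖ ≤ 1 := by nlinarith
    have h5 : e * ‖z k - p k‖ ^ 2 * ‖w k‖ ≤ ‖z k - p k‖ := by
      calc e * ‖z k - p k‖ ^ 2 * ‖w k‖ = (e * ‖w k‖) * (‖z k - p k‖ * ‖z k - p k‖) := by ring
        _ ≤ 1 * (1 * ‖z k - p k‖) := by
          gcongr
          linarith
        _ = _ := by ring
    linarith
  refine ⟨hjp, ?_⟩
  have hzb : z ∈ Metric.ball p r₁ := by rw [mem_ball_iff_norm]; linarith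
  have hjb : j ∈ Metric.ball p r₁ := by rw [mem_ball_iff_norm]; linarith
  obtain ⟨ξ, hξ, hmv⟩ := domain_mvt (f := L) (f' := fderiv ℝ L)
    (fun u hu => (e1 u hu).2.hasFDerivAt.hasFDerivWithinAt) (convex_ball p r₁) hzb hjb
  have hξb := (convex_ball p r₁).segment_subset hzb hjb hξ
  have hsum : j - z = ∑ k, (e * ‖z k - p k‖ ^ 2) • (Pi.single k (w k) : ι → F) := by
    funext l
    simp only [hj, Pi.sub_apply, add_sub_cancel_left, Finset.sum_apply, Pi.smul_apply]
    rw [Finset.sum_eq_single l]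
    · simp
    · intro k _ hkl; simp [Pi.single_eq_of_ne hkl.symm]
    · simp
  have h1 : L j - L z ≤ ∑ k, (e * ‖z k - p k‖ ^ 2) * (-κ) := by
    rw [hmv, hsum, map_sum]
    refine Finset.sum_le_sum fun k _ => ?_
    rw [map_smul, smul_eq_mul]
    exact mul_le_mul_of_nonneg_left ((e1 ξ hξb).1 k).le (by positivity)
  have h2 : ‖z - p‖ ^ 2 ≤ ∑ k, ‖z k - p k‖ ^ 2 := by
    have h3 : ‖z - p‖ ≤ √(∑ k, ‖z k - p k‖ ^ 2) := by
      refine (pi_norm_le_iff_of_nonneg (by positivity)).2 fun k => ?_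
      exact Real.le_sqrt_of_sq_le
        (Finset.single_le_sum (f := fun k => ‖z k - p k‖ ^ 2) (fun k _ => by positivity)
          (Finset.mem_univ k))
    calc ‖z - p‖ ^ 2 ≤ √(∑ k, ‖z k - p k‖ ^ 2) ^ 2 := by gcongr
      _ = _ := Real.sq_sqrt (Finset.sum_nonneg fun k _ => by positivity)
  have h4 : ∑ k, (e * ‖z k - p k‖ ^ 2) * (-κ) = -(e * κ) * ∑ k, ‖z k - p k‖ ^ 2 := by
    rw [Finset.mul_sum]; exact Finset.sum_congr rfl fun k _ => by ring
  rw [h4] at h1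
  have h5 : e * κ * ‖z - p‖ ^ 2 ≤ e * κ * ∑ k, ‖z k - p k‖ ^ 2 := by gcongr
  linarith

/-- If a function is maximal at `p` among a set of points, then these points may be pushed off `p`
and then moved by small affine maps preserving criticality so that the image of `p` is a strict
local maximum. -/
lemma exists_deform {ι F : Type*} [Fintype ι] [DecidableEq ι] [NormedAddCommGroup F]
    [NormedSpace ℝ F] {L : (ι → F) → ℝ} {p : ι → F} (hL : ContDiffAt ℝ 2 L p) (w : ι → F)
    (hw : ∀ k, fderiv ℝ L p (Pi.single k (w k)) < 0) :
    ∃ e₀ > 0, ∀ e, 0 < e → e < e₀ → ∃ δ > 0, ∀ (a : ι → F) (M : ι → F →L[ℝ] F), ‖a‖ < δ →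
      (∀ k, ‖M k‖ < δ) →
      (∀ k v, fderiv ℝ L (p + a) (Pi.single k (v + M k v)) = fderiv ℝ L p (Pi.single k v)) →
      ∀ z, L z ≤ L p → ‖z - p‖ < δ → z ≠ p → ∀ h : ι → F,
        (∀ k, h k = z k + (e * ‖z k - p k‖ ^ 2) • w k - p k) →
        L (fun k => p k + a k + (h k + M k (h k))) < L (p + a) := by
  obtain ⟨ρ, hρ, κ, hκ, e₀, he₀, hpush⟩ := exists_push hL w hw
  refine ⟨e₀, he₀, fun e he hee => ?_⟩
  -- The push gains `e κ ‖z - p‖²`. Since `‖h‖ ≤ 2 ‖z - p‖`, an affine change with constant `e κ /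
  -- 8` costs at most half of this.
  obtain ⟨δ, hδ, haff⟩ := exists_le_of_fderiv_comp_eq hL (show 0 < e * κ / 8 by positivity)
  refine ⟨min ρ (δ / 2), by positivity, fun a M ha hM hcrit z hz hzp hne h hh => ?_⟩
  rw [lt_min_iff] at ha hzp
  obtain ⟨h1, h2⟩ := hpush e he hee z hzp.1.le
  let M' : (ι → F) →L[ℝ] (ι → F) :=
    ContinuousLinearMap.pi fun k => (M k).comp (ContinuousLinearMap.proj k)
  have hM' : ∀ v k, M' v k = M k (v k) := fun v k => rfl
  have hMn : ‖M'‖ < δ := by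
    refine lt_of_le_of_lt (ContinuousLinearMap.opNorm_le_bound _ (by positivity : 0 ≤ δ / 2)
      fun v => ?_) (by linarith)
    refine (pi_norm_le_iff_of_nonneg (by positivity)).2 fun k => ?_
    rw [hM']
    refine ((M k).le_opNorm _).trans ?_
    have h3 := (hM k).le.trans (min_le_right _ _)
    have h4 := norm_le_pi_norm v k
    gcongr
  have hc : ∀ v, fderiv ℝ L (p + a) (v + M' v) = fderiv ℝ L p v := by
    intro v
    rw [← Finset.univ_sum_single (v + M' v), map_sum]
    conv_rhs => rw [← Finset.univ_sum_single v, map_sum]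
    exact Finset.sum_congr rfl fun k _ => hcrit k (v k)
  have hh' : h = (fun k => z k + (e * ‖z k - p k‖ ^ 2) • w k) - p := by
    funext k; rw [hh]; rfl
  have h3 := haff a M' (by linarith) hMn hc h (by rw [hh']; linarith)
  have h4 : p + h = fun k => z k + (e * ‖z k - p k‖ ^ 2) • w k := by rw [hh']; abel
  have h5 : p + a + (h + M' h) = fun k => p k + a k + (h k + M k (h k)) := rfl
  rw [h4, h5] at h3
  rw [← hh'] at h1
  have h6 : 0 < ‖z - p‖ := norm_pos_iff.2 (sub_ne_zero.2 hne)
  have h7 : ‖h‖ ^ 2 ≤ (2 * ‖z - p‖) ^ 2 := by gcongr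
  have h8 : e * κ / 8 * ‖h‖ ^ 2 ≤ e * κ / 8 * (2 * ‖z - p‖) ^ 2 := by gcongr
  have h9 : 0 < e * κ * ‖z - p‖ ^ 2 := by positivity
  nlinarith

/-! ### Regularity of the length -/

lemma contDiff_toPath (x y : Plane) {m : ℕ} (k : ℕ) :
    ContDiff ℝ 2 fun q : Fin m → Plane => toPath x y q k := by
  unfold toPath
  split_ifs <;> fun_prop

lemma contDiffAt_polyLen (x y : Plane) {m : ℕ} {p : Fin m → Plane}
    (h : ∀ k ≤ m, toPath x y p k ≠ toPath x y p (k + 1)) :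
    ContDiffAt ℝ 2 (fun q : Fin m → Plane => polyLen m (toPath x y q)) p := by
  unfold polyLen
  refine ContDiffAt.sum fun k hk => ?_
  exact ContDiffAt.dist ℝ (contDiff_toPath x y k).contDiffAt (contDiff_toPath x y (k + 1)).contDiffAt
    (h k (by have := Finset.mem_range.1 hk; omega))

/-- Only the two segments at the vertex `k` vary. Applied to the sum `w` of the unit vectors towards
the neighbours, the formula gives `-‖w‖²`, so the length decreases when the vertex is pushed along
`w`. -/
lemma fderiv_polyLen_single (x y : Plane) {m : ℕ} {p : Fin m → Plane}
    (h : ∀ k ≤ m, toPath x y p k ≠ toPath x y p (k + 1)) (k : Fin m) (w : Plane) :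
    fderiv ℝ (fun q : Fin m → Plane => polyLen m (toPath x y q)) p (Pi.single k w) =
      -inner ℝ (unitDir (p k) (toPath x y p k) + unitDir (p k) (toPath x y p (k + 2))) w := by
  have hp : toPath x y p (k + 1) = p k := toPath_succ x y p k.2
  have h1 : HasDerivAt (fun t : ℝ => p + t • (Pi.single k w : Fin m → Plane)) (Pi.single k w) 0 := by
    simpa using ((hasDerivAt_id (0:ℝ)).smul_const (Pi.single k w : Fin m → Plane)).const_add p
  have hd := ((contDiffAt_polyLen x y h).differentiableAt (by norm_num)).hasFDerivAt
  have h2 : HasDerivAt (fun t : ℝ => polyLen m (toPath x y (p + t • (Pi.single k w : Fin m → Plane))))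
      (fderiv ℝ (fun q : Fin m → Plane => polyLen m (toPath x y q)) p (Pi.single k w)) 0 := by
    have h3 : HasFDerivAt (fun q : Fin m → Plane => polyLen m (toPath x y q))
        (fderiv ℝ (fun q : Fin m → Plane => polyLen m (toPath x y q)) p)
        (p + (0:ℝ) • (Pi.single k w : Fin m → Plane)) := by rwa [zero_smul, add_zero]
    exact h3.comp_hasDerivAt 0 h1
  have hu : ∀ t : ℝ, p + t • (Pi.single k w : Fin m → Plane) = Function.update p k (p k + t • w) := by
    intro t
    funext l
    by_cases hl : l = k
    · subst hl; simp
    · simp [hl]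
  have hl : HasDerivAt (fun t : ℝ => p k + t • w) w 0 := by
    simpa using ((hasDerivAt_id (0:ℝ)).smul_const w).const_add (p k)
  have hA : p k + (0:ℝ) • w ≠ toPath x y p k := by
    rw [zero_smul, add_zero, ← hp]; exact (h k (by omega)).symm
  have hB : p k + (0:ℝ) • w ≠ toPath x y p (k + 2) := by
    rw [zero_smul, add_zero, ← hp]; exact h (k + 1) (by omega)
  have h4 := ((hasDerivAt_dist_left hl hA).add (hasDerivAt_dist_left hl hB)).const_add
    (polyLen m (toPath x y p) - (dist (toPath x y p k) (toPath x y p (k + 1)) +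
      dist (toPath x y p (k + 1)) (toPath x y p (k + 2))))
  rw [zero_smul, add_zero] at h4
  refine h2.unique (HasDerivAt.congr_of_eventuallyEq (h4.congr_deriv ?_) (Filter.Eventually.of_forall fun t => ?_))
  · rw [unitDir_neg (p k), unitDir_neg (p k), inner_add_left, inner_neg_left, inner_neg_left]; ring
  · dsimp only [Pi.add_apply]
    rw [hu, toPath_update, polyLen_update m k k.2, dist_comm (p k + t • w)]

end

noncomputable section

/-! ### Generic configurations have no triple points -/

/-- The determinant that vanishes if the lines `a₁b₁`, `a₂b₂`, `a₃b₃` have a common point. -/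
def lineDet (a₁ b₁ a₂ b₂ a₃ b₃ : Plane) : ℝ :=
  cross (b₁ - a₁) (b₂ - a₂) * cross a₃ b₃ + cross (b₂ - a₂) (b₃ - a₃) * cross a₁ b₁ +
    cross (b₃ - a₃) (b₁ - a₁) * cross a₂ b₂

/-- For two points of a line through `z` the determinant is that of `z` with the direction of the
line; after this substitution the cyclic sum vanishes identically. -/
lemma lineDet_eq_zero {a₁ b₁ a₂ b₂ a₃ b₃ z : Plane} (h1 : z ∈ segment ℝ a₁ b₁)
    (h2 : z ∈ segment ℝ a₂ b₂) (h3 : z ∈ segment ℝ a₃ b₃) : lineDet a₁ b₁ a₂ b₂ a₃ b₃ = 0 := by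
  have key : ∀ {a b : Plane}, z ∈ segment ℝ a b → cross a b = cross z (b - a) := by
    intro a b h
    rw [segment_eq_image'] at h
    obtain ⟨t, -, rfl⟩ := h
    simp only [cross, PiLp.add_apply, PiLp.smul_apply, PiLp.sub_apply, smul_eq_mul]
    ring
  rw [lineDet, key h1, key h2, key h3]
  simp only [cross, PiLp.sub_apply]
  ring

/-- The witness: a horizontal line through `a₁`, a vertical line through `a₂`, and an antidiagonal
that misses their intersection. -/
lemma lineDet_ne_zero (a₁ a₂ : Plane) :
    lineDet a₁ (a₁ + !₂[1, 0]) a₂ (a₂ + !₂[0, 1]) !₂[a₂ 0 + 1, a₁ 1] !₂[a₂ 0, a₁ 1 + 1] ≠ 0 := by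
  simp only [lineDet, cross, PiLp.sub_apply, PiLp.add_apply]
  simp
  ring_nf
  norm_num

open scoped ContDiff in
lemma contDiff_labelPt_apply (x y : Plane) {n : ℕ} (l : Vtx n ⊕ Bool) (c : Fin 2) :
    ContDiff ℝ ω fun q : Vtx n → Plane => labelPt x y q l c := by
  rcases l with v | b
  · unfold labelPt; fun_prop
  · exact (contDiff_const : ContDiff ℝ ω fun _ : Vtx n → Plane => (if b then y else x) c)

lemma isOpen_noCommon (x y : Plane) {n : ℕ} (a₁ b₁ a₂ b₂ a₃ b₃ : Vtx n ⊕ Bool) :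
    IsOpen {q : Vtx n → Plane | ¬ ∃ z, z ∈ segment ℝ (labelPt x y q a₁) (labelPt x y q b₁) ∧
      z ∈ segment ℝ (labelPt x y q a₂) (labelPt x y q b₂) ∧
      z ∈ segment ℝ (labelPt x y q a₃) (labelPt x y q b₃)} := by
  have hc : ∀ l, Continuous fun q : Vtx n → Plane => labelPt x y q l := by
    rintro (v | b)
    · exact continuous_apply v
    · exact continuous_const
  exact (isClosed_triple (hc _) (hc _) (hc _) (hc _) (hc _) (hc _)).isOpen_compl

open scoped ContDiff in
-- A common point makes `lineDet` vanish. Being analytic in the vertices, it would vanish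
-- identically if it did so near one configuration. The hypotheses say that `b₁, b₂, a₃, b₃` can be
-- moved independently without moving `a₁` and `a₂`, so the witness of `lineDet_ne_zero` can be
-- realized.
lemma dense_noCommon (x y : Plane) {n : ℕ} {a₁ a₂ : Vtx n ⊕ Bool} {b₁ b₂ a₃ b₃ : Vtx n}
    (h11 : a₁ ≠ Sum.inl b₁) (h12 : a₁ ≠ Sum.inl b₂) (h13 : a₁ ≠ Sum.inl a₃) (h14 : a₁ ≠ Sum.inl b₃)
    (h21 : a₂ ≠ Sum.inl b₁) (h22 : a₂ ≠ Sum.inl b₂) (h23 : a₂ ≠ Sum.inl a₃) (h24 : a₂ ≠ Sum.inl b₃)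
    (h1 : b₁ ≠ b₂) (h2 : b₁ ≠ a₃) (h3 : b₁ ≠ b₃) (h4 : b₂ ≠ a₃) (h5 : b₂ ≠ b₃) (h6 : a₃ ≠ b₃) :
    Dense {q : Vtx n → Plane | ¬ ∃ z, z ∈ segment ℝ (labelPt x y q a₁) (q b₁) ∧
      z ∈ segment ℝ (labelPt x y q a₂) (q b₂) ∧ z ∈ segment ℝ (q a₃) (q b₃)} := by
  let f : (Vtx n → Plane) → ℝ := fun q =>
    lineDet (labelPt x y q a₁) (q b₁) (labelPt x y q a₂) (q b₂) (q a₃) (q b₃)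
  have hf : AnalyticOnNhd ℝ f Set.univ := by
    rw [← contDiff_omega_iff_analyticOnNhd]
    have e1 := contDiff_labelPt_apply x y a₁
    have e2 := contDiff_labelPt_apply x y a₂
    simp only [f, lineDet, cross, PiLp.sub_apply]
    fun_prop
  intro q
  by_contra hq
  have hz : f =ᶠ[𝓝 q] 0 := by
    rw [mem_closure_iff_frequently, Filter.not_frequently] at hq
    filter_upwards [hq] with q' hq'
    simp only [not_not] at hq'
    obtain ⟨z, z1, z2, z3⟩ := hq'
    exact lineDet_eq_zero z1 z2 z3
  have h0 := hf.eqOn_zero_of_preconnected_of_eventuallyEq_zero isPreconnected_univ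
    (Set.mem_univ q) hz
  classical
  let A₁ := labelPt x y q a₁
  let A₂ := labelPt x y q a₂
  let q' := Function.update (Function.update (Function.update (Function.update q b₁ (A₁ + !₂[1, 0]))
    b₂ (A₂ + !₂[0, 1])) a₃ !₂[A₂ 0 + 1, A₁ 1]) b₃ !₂[A₂ 0, A₁ 1 + 1]
  have ha : ∀ a : Vtx n ⊕ Bool, a ≠ Sum.inl b₁ → a ≠ Sum.inl b₂ → a ≠ Sum.inl a₃ →
      a ≠ Sum.inl b₃ → labelPt x y q' a = labelPt x y q a := by
    rintro (v | b) k1 k2 k3 k4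
    · have k1' : v ≠ b₁ := fun h => k1 (by rw [h])
      have k2' : v ≠ b₂ := fun h => k2 (by rw [h])
      have k3' : v ≠ a₃ := fun h => k3 (by rw [h])
      have k4' : v ≠ b₃ := fun h => k4 (by rw [h])
      simp only [labelPt, q']
      rw [Function.update_of_ne k4', Function.update_of_ne k3', Function.update_of_ne k2',
        Function.update_of_ne k1']
    · rfl
  have hb₁ : q' b₁ = A₁ + !₂[1, 0] := by
    simp only [q']
    rw [Function.update_of_ne h3, Function.update_of_ne h2, Function.update_of_ne h1,
      Function.update_self]
  have hb₂ : q' b₂ = A₂ + !₂[0, 1] := by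
    simp only [q']
    rw [Function.update_of_ne h5, Function.update_of_ne h4, Function.update_self]
  have ha₃ : q' a₃ = !₂[A₂ 0 + 1, A₁ 1] := by
    simp only [q']
    rw [Function.update_of_ne h6, Function.update_self]
  have hb₃ : q' b₃ = !₂[A₂ 0, A₁ 1 + 1] := by
    simp only [q']
    rw [Function.update_self]
  refine lineDet_ne_zero A₁ A₂ ?_
  have := h0 (Set.mem_univ q')
  simp only [f, Pi.zero_apply] at this
  rw [ha a₁ h11 h12 h13 h14, ha a₂ h21 h22 h23 h24, hb₁, hb₂, ha₃, hb₃] at this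
  exact this

/-- Every segment has a free end point. -/
lemma exists_free_end {n : ℕ} (s : Seg n) : ∃ (a : Vtx n ⊕ Bool) (b : Vtx n), a ≠ Sum.inl b ∧
    ((label s.1 s.2 = a ∧ label s.1 (s.2 + 1) = Sum.inl b) ∨
      (label s.1 s.2 = Sum.inl b ∧ label s.1 (s.2 + 1) = a)) := by
  obtain ⟨i, k⟩ := s
  dsimp only
  have hne : label i k ≠ label i (k + 1) := by
    intro h
    rcases hl : label i k with v | b
    · have h1 := (ConvexCurve.label_eq_inl hl).2
      have h2 := (ConvexCurve.label_eq_inl (h ▸ hl)).2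
      omega
    · have h1 := ConvexCurve.label_eq_inr hl
      have h2 := ConvexCurve.label_eq_inr (h ▸ hl)
      omega
  rcases hl : label i (k + 1) with v | b
  · exact ⟨label i k, v, hl ▸ hne, Or.inl ⟨rfl, rfl⟩⟩
  · rcases hl' : label i k with v | c
    · exact ⟨Sum.inr b, v, by simp, Or.inr ⟨rfl, rfl⟩⟩
    · have h1 := ConvexCurve.label_eq_inr hl
      have h2 := ConvexCurve.label_eq_inr hl'
      omega

/-- Every segment has a vertex as one end. The three other ends cannot all belong to `{x, y}` when
no label is shared, so some segment has two vertices as ends, and it takes the place of the third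
segment in `dense_noCommon`. -/
lemma dense_noTriple_segOf (x y : Plane) {n : ℕ} {s₁ s₂ s₃ : Seg n} (h12 : SegDisj s₁ s₂)
    (h13 : SegDisj s₁ s₃) (h23 : SegDisj s₂ s₃) :
    Dense {q : Vtx n → Plane | ¬ ∃ z, z ∈ segOf x y q s₁ ∧ z ∈ segOf x y q s₂ ∧
      z ∈ segOf x y q s₃} := by
  obtain ⟨a₁, b₁, n1, c1⟩ := exists_free_end s₁
  obtain ⟨a₂, b₂, n2, c2⟩ := exists_free_end s₂
  obtain ⟨a₃, b₃, n3, c3⟩ := exists_free_end s₃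
  have hseg : ∀ {s : Seg n} {a : Vtx n ⊕ Bool} {b : Vtx n},
      ((label s.1 s.2 = a ∧ label s.1 (s.2 + 1) = Sum.inl b) ∨
      (label s.1 s.2 = Sum.inl b ∧ label s.1 (s.2 + 1) = a)) → ∀ q : Vtx n → Plane,
      segOf x y q s = segment ℝ (labelPt x y q a) (q b) := by
    rintro s a b (⟨h1, h2⟩ | ⟨h1, h2⟩) q
    · rw [segOf, pathOf_eq_labelPt, pathOf_eq_labelPt, h1, h2]; rfl
    · rw [segOf, pathOf_eq_labelPt, pathOf_eq_labelPt, h1, h2, segment_symm]; rfl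
  have hd : ∀ {s t : Seg n} {a a' : Vtx n ⊕ Bool} {b b' : Vtx n}, SegDisj s t →
      ((label s.1 s.2 = a ∧ label s.1 (s.2 + 1) = Sum.inl b) ∨
      (label s.1 s.2 = Sum.inl b ∧ label s.1 (s.2 + 1) = a)) →
      ((label t.1 t.2 = a' ∧ label t.1 (t.2 + 1) = Sum.inl b') ∨
      (label t.1 t.2 = Sum.inl b' ∧ label t.1 (t.2 + 1) = a')) →
      a ≠ a' ∧ a ≠ Sum.inl b' ∧ a' ≠ Sum.inl b ∧ b ≠ b' := by
    rintro s t a a' b b' ⟨k1, k2, k3, k4⟩ (⟨h1, h2⟩ | ⟨h1, h2⟩) (⟨h3, h4⟩ | ⟨h3, h4⟩) <;>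
      rw [h1, h3] at k1 <;> rw [h1, h4] at k2 <;> rw [h2, h3] at k3 <;> rw [h2, h4] at k4 <;>
      refine ⟨?_, ?_, ?_, ?_⟩ <;>
      first
        | assumption
        | exact Ne.symm (by assumption)
        | exact fun h => k1 (congrArg Sum.inl h)
        | exact fun h => k2 (congrArg Sum.inl h)
        | exact fun h => k3 (congrArg Sum.inl h)
        | exact fun h => k4 (congrArg Sum.inl h)
  have d12 := hd h12 c1 c2
  have d13 := hd h13 c1 c3
  have d23 := hd h23 c2 c3
  simp only [hseg c1, hseg c2, hseg c3]
  rcases a₃ with v | b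
  · exact dense_noCommon x y n1 d12.2.1 d13.1 d13.2.1 d12.2.2.1 n2 d23.1 d23.2.1 d12.2.2.2
      (fun h => d13.2.2.1 (by rw [h])) d13.2.2.2 (fun h => d23.2.2.1 (by rw [h])) d23.2.2.2
      (fun h => n3 (by rw [h]))
  rcases a₂ with v | c
  · refine (dense_noCommon x y (a₁ := a₁) (b₁ := b₁) (a₂ := Sum.inr b) (b₂ := b₃) (a₃ := v)
      (b₃ := b₂) n1 d13.2.1 d12.1 d12.2.1 (by simp) (by simp) (by simp) (by simp) d13.2.2.2
      (fun h => d12.2.2.1 (by rw [h])) d12.2.2.2 (fun h => d23.2.1 (by rw [h]))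
      d23.2.2.2.symm (fun h => n2 (by rw [h]))).mono ?_
    rintro q hq ⟨z, z1, z2, z3⟩
    exact hq ⟨z, z1, z3, z2⟩
  rcases a₁ with v | d
  · refine (dense_noCommon x y (a₁ := Sum.inr c) (b₁ := b₂) (a₂ := Sum.inr b) (b₂ := b₃) (a₃ := v)
      (b₃ := b₁) (by simp) (by simp) (by simp) (by simp) (by simp) (by simp) (by simp) (by simp)
      d23.2.2.2 (fun h => d12.2.1 (by rw [h])) d12.2.2.2.symm (fun h => d13.2.1 (by rw [h]))
      d13.2.2.2.symm (fun h => n1 (by rw [h]))).mono ?_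
    rintro q hq ⟨z, z1, z2, z3⟩
    exact hq ⟨z, z2, z3, z1⟩
  · exfalso
    have e1 : d ≠ c := fun h => d12.1 (by rw [h])
    have e2 : d ≠ b := fun h => d13.1 (by rw [h])
    have e3 : c ≠ b := fun h => d23.1 (by rw [h])
    revert e1 e2 e3
    cases b <;> cases c <;> cases d <;> simp

lemma dense_noTriple (x y : Plane) (n : ℕ) : Dense {q : Vtx n → Plane | NoTriple x y q} := by
  have hd : Dense (⋂ s : {s : Seg n × Seg n × Seg n // SegDisj s.1 s.2.1 ∧ SegDisj s.1 s.2.2 ∧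
      SegDisj s.2.1 s.2.2}, {q : Vtx n → Plane | ¬ ∃ z, z ∈ segOf x y q s.1.1 ∧
        z ∈ segOf x y q s.1.2.1 ∧ z ∈ segOf x y q s.1.2.2}) := by
    refine dense_iInter_of_isOpen (fun s => ?_) fun s =>
      dense_noTriple_segOf x y s.2.1 s.2.2.1 s.2.2.2
    simp only [segOf, pathOf_eq_labelPt]
    exact isOpen_noCommon x y _ _ _ _ _ _
  refine hd.mono fun q hq s₁ s₂ s₃ h1 h2 h3 => ?_
  exact Set.mem_iInter.1 hq ⟨(s₁, s₂, s₃), h1, h2, h3⟩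

end

noncomputable section

/-! ### Deformations of a curve near given points -/

section

variable {ι : Type*} [Fintype ι]

/-- The points near `p v` are pushed in the direction `w v` and then moved by an affine map. -/
def deform (p w : ι → Plane) (φ : ι → Plane → ℝ)
    (c : ℝ × (ι → Plane) × (ι → Plane →L[ℝ] Plane)) (z : Plane) : Plane :=
  z + ∑ v, φ v z • (c.2.1 v + (c.1 * ‖z - p v‖ ^ 2) • w v +
    c.2.2 v (z + (c.1 * ‖z - p v‖ ^ 2) • w v - p v))

lemma deform_zero (p w : ι → Plane) (φ : ι → Plane → ℝ) (z : Plane) : deform p w φ 0 z = z := by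
  simp [deform]

lemma contDiff_deform (p w : ι → Plane) {φ : ι → Plane → ℝ} {r : ℕ} (hφ : ∀ v, ContDiff ℝ r (φ v)) :
    ContDiff ℝ r fun x : (ℝ × (ι → Plane) × (ι → Plane →L[ℝ] Plane)) × Plane =>
      deform p w φ x.1 x.2 := by
  unfold deform
  refine contDiff_snd.add (ContDiff.sum fun v _ => ?_)
  have h1 : ContDiff ℝ r fun x : (ℝ × (ι → Plane) × (ι → Plane →L[ℝ] Plane)) × Plane =>
      (x.1.1 * ‖x.2 - p v‖ ^ 2) • w v := by
    have h2 : ContDiff ℝ r fun x : (ℝ × (ι → Plane) × (ι → Plane →L[ℝ] Plane)) × Plane =>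
        ‖x.2 - p v‖ ^ 2 := (contDiff_snd.sub contDiff_const).norm_sq ℝ
    fun_prop
  have h3 : ContDiff ℝ r fun x : (ℝ × (ι → Plane) × (ι → Plane →L[ℝ] Plane)) × Plane =>
      x.1.2.2 v := by fun_prop
  have h4 : ContDiff ℝ r fun x : (ℝ × (ι → Plane) × (ι → Plane →L[ℝ] Plane)) × Plane =>
      x.1.2.1 v := by fun_prop
  exact ((hφ v).comp contDiff_snd).smul
    ((h4.add h1).add (h3.clm_apply ((contDiff_snd.add h1).sub contDiff_const)))

/-- Bump functions at finitely many points. -/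
lemma exists_bumps {p : ι → Plane} (hp : Function.Injective p) (r : ℕ) :
    ∃ β > 0, β ≤ 1 ∧ ∃ φ : ι → Plane → ℝ, (∀ v, ContDiff ℝ r (φ v)) ∧
      (∀ v z, dist z (p v) ≤ β → φ v z = 1 ∧ ∀ w, w ≠ v → φ w z = 0) ∧
      ∀ v z, |φ v z| ≤ 1 ∧ (φ v z ≠ 0 → dist z (p v) ≤ 1) := by
  obtain ⟨β, hβ, hβ0⟩ : ∃ β : ℝ, (∀ v w : ι, v ≠ w → 4 * β < dist (p v) (p w)) ∧ 0 < β := by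
    have h1 : ∀ᶠ β : ℝ in 𝓝[>] 0, ∀ v w : ι, v ≠ w → 4 * β < dist (p v) (p w) := by
      refine Filter.eventually_all.2 fun v => Filter.eventually_all.2 fun w => ?_
      have : Filter.Tendsto (fun β : ℝ => 4 * β) (𝓝[>] 0) (𝓝 0) := by
        have h : Continuous fun β : ℝ => 4 * β := by fun_prop
        simpa using (h.tendsto 0).mono_left nhdsWithin_le_nhds
      by_cases hvw : v = w
      · simp [hvw]
      · filter_upwards [this.eventually_lt_const (dist_pos.2 (hp.ne hvw))] with β h _ using h
    exact (h1.and self_mem_nhdsWithin).exists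
  let b := min β (1 / 2)
  have hb0 : 0 < b := by positivity
  have hbβ : b ≤ β := min_le_left _ _
  have hb1 : b ≤ 1 / 2 := min_le_right _ _
  let f : ∀ v : ι, ContDiffBump (p v) := fun v => ⟨b, 2 * b, hb0, by linarith⟩
  refine ⟨b, hb0, by linarith, fun v => f v, fun v => (f v).contDiff, fun v z hz => ⟨?_, ?_⟩,
    fun v z => ⟨?_, ?_⟩⟩
  · exact (f v).one_of_mem_closedBall hz
  · intro w hw
    refine (f w).zero_of_le_dist ?_
    have h1 := hβ w v hw
    have h2 := dist_triangle (p w) z (p v)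
    rw [dist_comm (p w) z] at h2
    change 2 * b ≤ dist z (p w)
    linarith
  · rw [abs_of_nonneg (f v).nonneg]; exact (f v).le_one
  · intro h
    by_contra hc
    refine h ((f v).zero_of_le_dist ?_)
    change 2 * b ≤ dist z (p v)
    linarith

lemma deform_eq {p : ι → Plane} (w : ι → Plane) {φ : ι → Plane → ℝ}
    (c : ℝ × (ι → Plane) × (ι → Plane →L[ℝ] Plane)) {z : Plane} {v : ι} (h1 : φ v z = 1)
    (h0 : ∀ w, w ≠ v → φ w z = 0) : deform p w φ c z = p v + c.2.1 v +
      (z + (c.1 * ‖z - p v‖ ^ 2) • w v - p v +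
        c.2.2 v (z + (c.1 * ‖z - p v‖ ^ 2) • w v - p v)) := by
  rw [deform, Finset.sum_eq_single v (fun u _ hu => by rw [h0 u hu, zero_smul]) (by simp), h1,
    one_smul]
  abel

/-- The bound serves to locate preimages: a point of the deformed curve near the moved vertex comes
from a point so near the old vertex that the bump function there is `1`. -/
lemma dist_deform_le {p : ι → Plane} (w : ι → Plane) {φ : ι → Plane → ℝ}
    (hφ : ∀ v z, |φ v z| ≤ 1 ∧ (φ v z ≠ 0 → dist z (p v) ≤ 1))
    {e : ℝ} (he : 0 ≤ e) (a : ι → Plane) (M : ι → Plane →L[ℝ] Plane) (z : Plane) :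
    dist (deform p w φ (e, a, M) z) z ≤
      e * ∑ v, ‖w v‖ + ∑ v, (‖a v‖ + ‖M v‖ * (1 + e * ‖w v‖)) := by
  rw [deform, dist_eq_norm, add_sub_cancel_left, Finset.mul_sum, ← Finset.sum_add_distrib]
  refine norm_sum_le_of_le _ fun v _ => ?_
  by_cases h0 : φ v z = 0
  · rw [h0, zero_smul, norm_zero]; positivity
  have hd := (hφ v z).2 h0
  rw [dist_eq_norm] at hd
  have h1 : ‖(e * ‖z - p v‖ ^ 2) • w v‖ ≤ e * ‖w v‖ := by
    rw [norm_smul, Real.norm_of_nonneg (by positivity)]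
    have : ‖z - p v‖ ^ 2 ≤ 1 := pow_le_one₀ (norm_nonneg _) hd
    calc e * ‖z - p v‖ ^ 2 * ‖w v‖ ≤ e * 1 * ‖w v‖ := by gcongr
      _ = _ := by ring
  have h2 : ‖z + (e * ‖z - p v‖ ^ 2) • w v - p v‖ ≤ 1 + e * ‖w v‖ := by
    rw [add_sub_right_comm]
    exact (norm_add_le _ _).trans (add_le_add hd h1)
  have h3 := ((M v).le_opNorm (z + (e * ‖z - p v‖ ^ 2) • w v - p v)).trans
    (mul_le_mul_of_nonneg_left h2 (norm_nonneg _))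
  rw [norm_smul, Real.norm_eq_abs]
  refine (mul_le_mul (hφ v z).1 norm_add₃_le (norm_nonneg _) zero_le_one).trans ?_
  dsimp only
  linarith

end

/-- This rules out a vanishing push direction, since a vertex on the boundary is not strictly
between its neighbours. -/
lemma mem_segment_of_unitDir_add_eq_zero {a p b : Plane} (ha : p ≠ a)
    (h : unitDir p a + unitDir p b = 0) : p ∈ segment ℝ a b := by
  have h1 := eq_add_dist_smul_unitDir p a
  have h2 := eq_add_dist_smul_unitDir p b
  have h3 : unitDir p b = -unitDir p a := (neg_eq_of_add_eq_zero_right h).symm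
  rw [mem_segment_iff_dist]
  have h4 : a - b = (dist p a + dist p b) • unitDir p a := by
    rw [h3] at h2
    conv_lhs => rw [h1, h2]
    rw [smul_neg, add_smul]; abel
  rw [dist_eq_norm a b, h4, norm_smul, norm_unitDir ha, mul_one, Real.norm_of_nonneg (by positivity),
    dist_comm a p]

end

/-! ### Perturbation of the curve to a robust configuration -/

noncomputable section

namespace ConvexCurve

variable {r : ℕ}

set_option maxHeartbeats 400000 in
/-- If a configuration of longest paths is generic except for triple points, then some curve close
to the given one has robust paths in general position. -/
lemma exists_robust_of_generic (σ : ConvexCurve r) (hr : 2 ≤ r) {n : ℕ} {x y : Plane}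
    (hx : x ∈ σ.table) (hy : y ∈ σ.table) {p : Vtx n → Plane} (hg : IsGeneric x y p)
    (hmax : ∀ i : Fin n, IsMaxPoly σ.trace (i.1 + 1) x y (pathOf x y p i)) {ε : ℝ} (hε : 0 < ε) :
    ∃ τ : ConvexCurve r, ckDist r σ τ < ε ∧ Robust n τ.trace x y := by
  classical
  have hpS : ∀ v, p v ∈ σ.trace := by
    intro v
    have := (hmax v.1).mem (v.2 + 1) (by omega) (by omega)
    rwa [pathOf_succ x y p v.1 (by omega : v.2.1 ≤ v.1.1)] at this
  -- The push direction is minus the gradient of the length in the vertex `v`.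
  let w : Vtx n → Plane := fun v => unitDir (p v) (pathOf x y p v.1 v.2) +
    unitDir (p v) (pathOf x y p v.1 (v.2 + 2))
  have hw : ∀ v, w v ≠ 0 := by
    intro v h0
    have hpv : pathOf x y p v.1 (v.2 + 1) = p v := pathOf_succ x y p v.1 (by omega)
    have hT := pathOf_mem_table hx hy hpS v.1
    have h1 := hg.ne_succ v.1 (k := v.2) (by omega)
    have h2 := hg.ne_succ v.1 (k := v.2 + 1) (by omega)
    rw [hpv] at h1 h2
    rcases σ.eq_or_eq_of_mem_segment hr (hT _) (hT _) (hpS v)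
      (mem_segment_of_unitDir_add_eq_zero h1.symm h0) with h | h
    · exact h1 h.symm
    · exact h2 h
  let L : ∀ i : Fin n, (Fin (i.1 + 1) → Plane) → ℝ := fun i q => polyLen (i.1 + 1) (toPath x y q)
  let pr : ∀ i : Fin n, (Vtx n → Plane) → Fin (i.1 + 1) → Plane := fun i q k => q ⟨i, k⟩
  have hne : ∀ i : Fin n, ∀ k ≤ i.1 + 1, toPath x y (pr i p) k ≠ toPath x y (pr i p) (k + 1) :=
    fun i k hk => hg.ne_succ i hk
  have hL : ∀ i, ContDiffAt ℝ 2 (L i) (pr i p) := fun i => contDiffAt_polyLen x y (hne i)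
  have hLw : ∀ i k, fderiv ℝ (L i) (pr i p) (Pi.single k (w ⟨i, k⟩)) < 0 := by
    intro i k
    have h1 : fderiv ℝ (L i) (pr i p) (Pi.single k (w ⟨i, k⟩)) = -inner ℝ (w ⟨i, k⟩) (w ⟨i, k⟩) :=
      fderiv_polyLen_single x y (hne i) k (w ⟨i, k⟩)
    rw [h1, neg_lt_zero]
    exact real_inner_self_pos.2 (hw _)
  choose e₀ he₀ hdef using fun i => exists_deform (hL i) (fun k => w ⟨i, k⟩) (hLw i)
  obtain ⟨β, hβ, hβ1, φ, hφC, hφ1, hφb⟩ := exists_bumps hg.inj r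
  -- the curves
  have hcurve : ∀ᶠ c : ℝ × (Vtx n → Plane) × (Vtx n → Plane →L[ℝ] Plane) in 𝓝 0,
      ∃ τ : ConvexCurve r, τ.trace = Set.range (fun s => deform p w φ c (σ.toFun s)) ∧
        ckDist r σ τ < ε :=
    σ.eventually_exists_curve hr (F := fun x => deform p w φ x.1 (σ.toFun x.2))
      ((contDiff_deform p w hφC).comp (contDiff_fst.prodMk (σ.contDiff.comp contDiff_snd)))
      (fun c s => by dsimp only; rw [σ.periodic s]) (fun s => deform_zero p w φ _) hε
  -- The strength `e` of the push is fixed first; the translations `a` and the linear parts are then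
  -- chosen small depending on it.
  have hcurve2 := Filter.Eventually.curry_nhds hcurve
  obtain ⟨e, ⟨hce, hee, heβ⟩, he⟩ : ∃ e : ℝ,
      ((∀ᶠ c : (Vtx n → Plane) × (Vtx n → Plane →L[ℝ] Plane) in 𝓝 0,
        ∃ τ : ConvexCurve r, τ.trace = Set.range (fun s => deform p w φ (e, c) (σ.toFun s)) ∧
        ckDist r σ τ < ε) ∧ (∀ i, e < e₀ i) ∧ e * ∑ v, ‖w v‖ < β / 4) ∧ 0 < e := by
    have h1 : ∀ᶠ e : ℝ in 𝓝 0, e * ∑ v, ‖w v‖ < β / 4 := by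
      have h : Continuous fun e : ℝ => e * ∑ v, ‖w v‖ := by fun_prop
      have := h.tendsto 0
      rw [zero_mul] at this
      exact this.eventually_lt_const (by positivity)
    have h2 : ∀ᶠ e : ℝ in 𝓝 0, ∀ i, e < e₀ i :=
      Filter.eventually_all.2 fun i => eventually_lt_nhds (he₀ i)
    have h3 := hcurve2.and (h2.and h1)
    exact ((h3.filter_mono nhdsWithin_le_nhds).and self_mem_nhdsWithin : ∀ᶠ e in 𝓝[>] (0:ℝ), _).exists
  choose δ hδ hdef using fun i => hdef i e he (hee i)
  -- the affine maps that preserve criticality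
  let ℓ : Vtx n → (Vtx n → Plane) → Plane →L[ℝ] ℝ := fun v a =>
    (fderiv ℝ (L v.1) (pr v.1 p + pr v.1 a)).comp (ContinuousLinearMap.single ℝ (fun _ => Plane) v.2)
  have hℓ : ∀ v, ContinuousAt (ℓ v) 0 := by
    intro v
    have h1 : ContinuousAt (fderiv ℝ (L v.1)) (pr v.1 p + pr v.1 0) := by
      have : pr v.1 p + pr v.1 0 = pr v.1 p := add_zero _
      rw [this]
      exact ((hL v.1).fderiv_right (m := 1) (by norm_num)).continuousAt
    have h2 : Continuous fun a : Vtx n → Plane => pr v.1 p + pr v.1 a :=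
      continuous_const.add (continuous_pi fun k => continuous_apply _)
    have h3 : ContinuousAt (fun a => fderiv ℝ (L v.1) (pr v.1 p + pr v.1 a)) 0 :=
      ContinuousAt.comp (f := fun a : Vtx n → Plane => pr v.1 p + pr v.1 a) h1 h2.continuousAt
    exact h3.clm_comp continuousAt_const
  have hℓ0 : ∀ v u, ℓ v 0 u = fderiv ℝ (L v.1) (pr v.1 p) (Pi.single v.2 u) := by
    intro v u
    have : pr v.1 p + pr v.1 0 = pr v.1 p := add_zero _
    simp only [ℓ]
    rw [this]; rfl
  have hℓw : ∀ v, ℓ v 0 (w v) < 0 := fun v => by rw [hℓ0]; exact hLw v.1 v.2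
  -- A rank one correction along `w v` that solves `ℓ v a (u + M a v u) = ℓ v 0 u`. It tends to `0`
  -- with `a` because `ℓ v 0 (w v)` is not zero.
  let M : (Vtx n → Plane) → Vtx n → Plane →L[ℝ] Plane := fun a v =>
    (ℓ v a (w v))⁻¹ • (ℓ v 0 - ℓ v a).smulRight (w v)
  have hM0 : M 0 = 0 := by
    funext v
    refine ContinuousLinearMap.ext fun u => ?_
    change (ℓ v 0 (w v))⁻¹ • ((ℓ v 0 - ℓ v 0) u • w v) = 0
    rw [sub_self, zero_apply, zero_smul, smul_zero]
  have hMc : ContinuousAt M 0 := by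
    refine continuousAt_pi.2 fun v => ?_
    have h1 : ContinuousAt (fun a => (ℓ v a (w v))⁻¹) 0 :=
      ((hℓ v).clm_apply continuousAt_const).inv₀ (hℓw v).ne
    have h2 : ContinuousAt (fun a => (ℓ v 0 - ℓ v a).smulRight (w v)) 0 := by
      have h3 : Continuous fun f : Plane →L[ℝ] ℝ => f.smulRight (w v) :=
        ((ContinuousLinearMap.smulRightL ℝ Plane Plane).flip (w v)).continuous
      exact ContinuousAt.comp (f := fun a => ℓ v 0 - ℓ v a) h3.continuousAt
        (continuousAt_const.sub (hℓ v))
    exact h1.smul h2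
  have hMt : Filter.Tendsto M (𝓝 0) (𝓝 0) := by
    have := hMc.tendsto
    rwa [hM0] at this
  have hMn : ∀ v, Filter.Tendsto (fun a => ‖M a v‖) (𝓝 0) (𝓝 0) := by
    intro v
    have := ((continuous_apply v).norm.tendsto (0 : Vtx n → Plane →L[ℝ] Plane)).comp hMt
    rw [Pi.zero_apply, norm_zero] at this
    exact this
  have c1 : ∀ᶠ a in 𝓝 (0 : Vtx n → Plane), ∃ τ : ConvexCurve r,
      τ.trace = Set.range (fun s => deform p w φ (e, a, M a) (σ.toFun s)) ∧ ckDist r σ τ < ε :=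
    (Filter.tendsto_id.prodMk_nhds hMt).eventually hce
  have c2 : ∀ᶠ a in 𝓝 (0 : Vtx n → Plane), ∀ v, ‖M a v‖ < δ v.1 ∧ ‖M a v‖ < 1 / 2 :=
    Filter.eventually_all.2 fun v => ((hMn v).eventually_lt_const (hδ v.1)).and
      ((hMn v).eventually_lt_const (by norm_num))
  have hnorm0 : Filter.Tendsto (fun a : Vtx n → Plane => ‖a‖) (𝓝 0) (𝓝 0) := tendsto_norm_zero
  have c3 : ∀ᶠ a in 𝓝 (0 : Vtx n → Plane), ‖a‖ < β / 8 ∧ ∀ i, ‖a‖ < δ i :=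
    (hnorm0.eventually_lt_const (by positivity)).and
      (Filter.eventually_all.2 fun i => hnorm0.eventually_lt_const (hδ i))
  have c4 : ∀ᶠ a in 𝓝 (0 : Vtx n → Plane),
      ∑ v, (‖a v‖ + ‖M a v‖ * (1 + e * ‖w v‖)) < β / 4 := by
    have h : Filter.Tendsto (fun a : Vtx n → Plane =>
        ∑ v, (‖a v‖ + ‖M a v‖ * (1 + e * ‖w v‖))) (𝓝 0) (𝓝 0) := by
      have h1 : ∀ v ∈ (Finset.univ : Finset (Vtx n)), Filter.Tendsto (fun a : Vtx n → Plane =>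
          ‖a v‖ + ‖M a v‖ * (1 + e * ‖w v‖)) (𝓝 0) (𝓝 0) := by
        intro v _
        have h2 := ((continuous_apply v).norm.tendsto (0 : Vtx n → Plane))
        have h3 := h2.add ((hMn v).mul_const (1 + e * ‖w v‖))
        simpa using h3
      simpa using tendsto_finsetSum _ h1
    exact h.eventually_lt_const (by positivity)
  have c5 : ∀ᶠ a in 𝓝 (0 : Vtx n → Plane), ∀ v, ℓ v a (w v) < 0 :=
    Filter.eventually_all.2 fun v =>
      ((hℓ v).clm_apply continuousAt_const).eventually_lt_const (hℓw v)
  have hadd : Filter.Tendsto (fun a : Vtx n → Plane => p + a) (𝓝 0) (𝓝 p) := by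
    have h : Continuous fun a : Vtx n → Plane => p + a := by fun_prop
    simpa using h.tendsto 0
  have c6 : ∀ᶠ a in 𝓝 (0 : Vtx n → Plane), IsGeneric x y (p + a) := by
    have h1 : Filter.Tendsto (fun a : Vtx n → Plane => ((x, y), p + a)) (𝓝 0) (𝓝 ((x, y), p)) :=
      tendsto_const_nhds.prodMk_nhds hadd
    exact h1.eventually ((isOpen_isGeneric n).eventually_mem (show ((x, y), p) ∈ _ from hg))
  -- Absence of triple points is known only on a dense set, hence frequently; the other requirements
  -- hold for all small `a`.
  have c7 : ∃ᶠ a in 𝓝 (0 : Vtx n → Plane), NoTriple x y (p + a) := by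
    have h1 : ∃ᶠ q in 𝓝 p, NoTriple x y q := mem_closure_iff_frequently.1 (dense_noTriple x y n p)
    rw [← add_zero p, ← map_add_left_nhds_zero] at h1
    rw [add_zero] at h1
    exact h1
  obtain ⟨a, hnt, ⟨τ, hτ, hτε⟩, hMa, ⟨haβ, haδ⟩, hsum, hℓa, hga⟩ :=
    (c7.and_eventually (c1.and (c2.and (c3.and (c4.and (c5.and c6)))))).exists
  refine ⟨τ, hτε, ?_⟩
  have hcrit : ∀ i k v, fderiv ℝ (L i) (pr i p + pr i a) (Pi.single k (v + M a ⟨i, k⟩ v)) =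
      fderiv ℝ (L i) (pr i p) (Pi.single k v) := by
    intro i k v
    have e1 : fderiv ℝ (L i) (pr i p + pr i a) (Pi.single k (v + M a ⟨i, k⟩ v)) =
      ℓ ⟨i, k⟩ a (v + M a ⟨i, k⟩ v) := rfl
    rw [e1, ← hℓ0 ⟨i, k⟩]
    have e2 : M a ⟨i, k⟩ v = (ℓ ⟨i, k⟩ a (w ⟨i, k⟩))⁻¹ • ((ℓ ⟨i, k⟩ 0 - ℓ ⟨i, k⟩ a) v • w ⟨i, k⟩) :=
      rfl
    have e3 := (hℓa ⟨i, k⟩).ne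
    rw [map_add, e2, map_smul, map_smul, smul_eq_mul, smul_eq_mul, sub_apply]
    field_simp
    ring
  obtain ⟨N, hN⟩ : ∃ N, N = M a := ⟨_, rfl⟩
  rw [← hN] at hτ hsum
  simp only [← hN] at hMa hcrit
  clear hN c1 c2 c4 c5 hMn hMt hMc hM0 hℓa hℓw hℓ0 hℓ M ℓ
  clear_value w
  -- the radius
  have g1 : ∀ᶠ q in 𝓝 (p + a), IsGeneric x y q ∧ NoTriple x y q := by
    have h1 : Filter.Tendsto (fun q : Vtx n → Plane => ((x, y), q)) (𝓝 (p + a))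
      (𝓝 ((x, y), p + a)) := tendsto_const_nhds.prodMk_nhds Filter.tendsto_id
    exact (h1.eventually ((isOpen_isGeneric n).eventually_mem (show ((x, y), p + a) ∈ _ from hga))).and
      (h1.eventually ((isOpen_noTriple n).eventually_mem (show ((x, y), p + a) ∈ _ from hnt)))
  obtain ⟨ρ₀, hρ₀, hgp⟩ := Metric.eventually_nhds_iff_ball.1 g1
  obtain ⟨ρ, ⟨hρρ₀, hρβ, hρδ⟩, hρ⟩ : ∃ ρ : ℝ, (ρ < ρ₀ ∧ ρ < β / 8 ∧ ∀ i, ρ < δ i / 4) ∧ 0 < ρ := by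
    have h1 : ∀ᶠ ρ : ℝ in 𝓝 0, ρ < ρ₀ ∧ ρ < β / 8 ∧ ∀ i, ρ < δ i / 4 :=
      (eventually_lt_nhds hρ₀).and ((eventually_lt_nhds (by positivity)).and
        (Filter.eventually_all.2 fun i => eventually_lt_nhds (by have := hδ i; positivity)))
    exact ((h1.filter_mono nhdsWithin_le_nhds).and self_mem_nhdsWithin : ∀ᶠ e in 𝓝[>] (0:ℝ), _).exists
  refine ⟨p + a, p + a, ρ, ?_, by rw [dist_self]; exact hρ, fun q hq => hgp q
    (lt_of_le_of_lt hq hρρ₀), ?_⟩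
  · intro v
    obtain ⟨s, hs⟩ := hpS v
    rw [hτ]
    refine ⟨s, ?_⟩
    have h0 := hφ1 v (p v) (by rw [dist_self]; exact hβ.le)
    dsimp only
    rw [hs, deform_eq w (e, a, N) h0.1 h0.2, sub_self, norm_zero, zero_pow two_ne_zero, mul_zero,
      zero_smul, add_zero, sub_self, map_zero, add_zero, add_zero]
    rfl
  · intro i q hq hqρ
    have hz : ∀ k, ∃ z ∈ σ.trace, deform p w φ (e, a, N) z = q k := by
      intro k
      have := hq k
      rw [hτ] at this
      obtain ⟨s, hs⟩ := this
      exact ⟨σ.toFun s, ⟨s, rfl⟩, hs⟩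
    choose z hzS hzq using hz
    have hqk : ∀ k, dist (q k) (p ⟨i, k⟩ + a ⟨i, k⟩) ≤ ρ := by
      intro k
      exact (dist_le_pi_dist q (fun k => (p + a) ⟨i, k⟩) k).trans hqρ.le
    -- The deformation moves points by less than `β / 2`, and `ρ` and `‖a‖` are below `β / 8`. So
    -- the preimages lie where the deformation is given by the local formula.
    have hzβ : ∀ k, dist (z k) (p ⟨i, k⟩) ≤ β := by
      intro k
      have h1 := dist_deform_le w hφb he.le a N (z k)
      rw [hzq] at h1
      have h2 := hqk k
      have h3 : dist (p ⟨i, k⟩ + a ⟨i, k⟩) (p ⟨i, k⟩) ≤ ‖a‖ := by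
        rw [dist_eq_norm, add_sub_cancel_left]; exact norm_le_pi_norm a _
      have h4 := dist_triangle4 (z k) (q k) (p ⟨i, k⟩ + a ⟨i, k⟩) (p ⟨i, k⟩)
      rw [dist_comm (z k) (q k)] at h4
      linarith
    let h : Fin (i.1 + 1) → Plane := fun k =>
      z k + (e * ‖z k - p ⟨i, k⟩‖ ^ 2) • w ⟨i, k⟩ - p ⟨i, k⟩
    have hqh : ∀ k, q k = p ⟨i, k⟩ + a ⟨i, k⟩ + (h k + N ⟨i, k⟩ (h k)) := by
      intro k
      have h0 := hφ1 ⟨i, k⟩ (z k) (hzβ k)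
      rw [← hzq k, deform_eq w (e, a, N) h0.1 h0.2]
    have hhρ : ∀ k, ‖h k‖ ≤ 2 * ρ := by
      intro k
      have h1 := hqk k
      rw [hqh k, dist_eq_norm, add_sub_cancel_left] at h1
      have h2 := norm_sub_le (h k + N ⟨i, k⟩ (h k)) (N ⟨i, k⟩ (h k))
      rw [add_sub_cancel_right] at h2
      have h3 := (N ⟨i, k⟩).le_opNorm (h k)
      have h4 := (hMa ⟨i, k⟩).2
      nlinarith [norm_nonneg (h k)]
    have hzρ : ∀ k, ‖z k - p ⟨i, k⟩‖ ≤ 4 * ρ := by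
      intro k
      have h1 := hhρ k
      have h2 := norm_sub_le (h k) ((e * ‖z k - p ⟨i, k⟩‖ ^ 2) • w ⟨i, k⟩)
      have h3 : h k - (e * ‖z k - p ⟨i, k⟩‖ ^ 2) • w ⟨i, k⟩ = z k - p ⟨i, k⟩ := by
        simp only [h]; abel
      rw [h3, norm_smul, Real.norm_of_nonneg (by positivity)] at h2
      have h4 := hzβ k
      rw [dist_eq_norm] at h4
      have h5 : e * ‖w ⟨i, k⟩‖ ≤ 1 / 4 := by
        have : ‖w ⟨i, k⟩‖ ≤ ∑ v, ‖w v‖ :=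
          Finset.single_le_sum (f := fun v => ‖w v‖) (fun v _ => norm_nonneg _) (Finset.mem_univ _)
        nlinarith
      have h6 : e * ‖z k - p ⟨i, k⟩‖ ^ 2 * ‖w ⟨i, k⟩‖ ≤ 1 / 4 * ‖z k - p ⟨i, k⟩‖ := by
        calc e * ‖z k - p ⟨i, k⟩‖ ^ 2 * ‖w ⟨i, k⟩‖
            = (e * ‖w ⟨i, k⟩‖) * (‖z k - p ⟨i, k⟩‖ * ‖z k - p ⟨i, k⟩‖) := by ring
          _ ≤ 1 / 4 * (1 * ‖z k - p ⟨i, k⟩‖) := by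
            gcongr
            exact h4.trans hβ1
          _ = _ := by ring
      nlinarith [norm_nonneg (z k - p ⟨i, k⟩)]
    -- The length at `z` is at most that at `p` because `p` is longest on `σ`, and `z ≠ p` because
    -- `q` lies on the sphere and not at its centre.
    have hlt := hdef i (pr i a) (fun k => N ⟨i, k⟩) ?_ (fun k => (hMa ⟨i, k⟩).1) ?_ z ?_ ?_ ?_ h
      (fun k => rfl)
    · have e1 : q = fun k => pr i p k + pr i a k + (h k + N ⟨i, k⟩ (h k)) := funext hqh
      rw [e1]
      exact hlt
    · refine lt_of_le_of_lt ((pi_norm_le_iff_of_nonneg (norm_nonneg a)).2 fun k => ?_) (haδ i)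
      exact norm_le_pi_norm a _
    · exact hcrit i
    · have := (hmax i).le _ (isPolyPath_toPath x y hzS)
      exact this
    · refine (pi_norm_lt_iff (hδ i)).2 fun k => lt_of_le_of_lt (hzρ k) ?_
      have := hρδ i
      linarith
    · intro hzp
      have : q = fun k => (p + a) ⟨i, k⟩ := by
        funext k
        rw [hqh k]
        have : z k = p ⟨i, k⟩ := congrFun hzp k
        simp [h, this]
      rw [this, dist_self] at hqρ
      exact hρ.ne hqρ

theorem exists_robust_near (σ : ConvexCurve r) (hr : 2 ≤ r) (n : ℕ) {O : Set (Plane × Plane)}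
    (hO : O ⊆ σ.interiorPairs) (ho : IsOpen O) (hne : O.Nonempty) {ε : ℝ} (hε : 0 < ε) :
    ∃ x y, (x, y) ∈ O ∧ x ≠ y ∧ ∃ τ : ConvexCurve r, ckDist r σ τ < ε ∧ Robust n τ.trace x y := by
  obtain ⟨x, y, hxy, hne, P, hP, h1, h2, h3⟩ := σ.exists_generic_pair hr n hO ho hne
  let p : Vtx n → Plane := fun v => P v.1 (v.2 + 1)
  have hp : ∀ i : Fin n, pathOf x y p i = P i := fun i => (hP i).toIsPolyPath.eq_toPath.symm
  refine ⟨x, y, hxy, hne, σ.exists_robust_of_generic hr (p := p) (interior_subset (hO hxy).1)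
    (interior_subset (hO hxy).2) ⟨?_, ?_, ?_⟩ (fun i => by rw [hp]; exact hP i) hε⟩
  · rintro ⟨i, k⟩ ⟨j, l⟩ h
    obtain ⟨e1, e2⟩ := h1 i i.2 j j.2 k (by omega) l (by omega) h
    obtain rfl : i = j := Fin.ext e1
    obtain rfl : k = l := Fin.ext e2
    rfl
  · intro i k hk
    rw [hp]
    exact h2 i i.2 k hk
  · intro i k hk
    rw [hp]
    exact h3 i i.2 k hk

end ConvexCurve

end

noncomputable section

namespace ConvexCurve

variable {r : ℕ}

/-! ### Consequences of `C^k` closeness -/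

lemma contDiff_shift (σ : ConvexCurve r) (s₀ : ℝ) : ContDiff ℝ r fun s => σ.toFun (s + s₀) :=
  σ.contDiff.comp (contDiff_id.add contDiff_const)

lemma periodic_shift (σ : ConvexCurve r) (s₀ : ℝ) :
    Function.Periodic (fun s => σ.toFun (s + s₀)) 1 := fun s => by
  dsimp only; rw [add_right_comm, σ.periodic]

lemma norm_iteratedDeriv_sub_le {f g : ℝ → Plane} {k : ℕ} (hf : ContDiff ℝ k f)
    (hg : ContDiff ℝ k g) (hfp : Function.Periodic f 1) (hgp : Function.Periodic g 1) {j : ℕ}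
    (hj : j ≤ k) (s : ℝ) :
    ‖iteratedDeriv j f s - iteratedDeriv j g s‖ ≤ ckDistFun k f g := by
  have hcont : ∀ j : Fin (k + 1),
      Continuous fun s => ‖iteratedDeriv j f s - iteratedDeriv j g s‖ := fun j =>
    ((hf.continuous_iteratedDeriv j (by exact_mod_cast (by omega : j.1 ≤ k))).sub
      (hg.continuous_iteratedDeriv j (by exact_mod_cast (by omega : j.1 ≤ k)))).norm
  have hbdd : ∀ j : Fin (k + 1), BddAbove (Set.range fun s : Set.Icc (0:ℝ) 1 =>
      ‖iteratedDeriv j f s - iteratedDeriv j g s‖) := fun j =>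
    (isCompact_range ((hcont j).comp continuous_subtype_val)).bddAbove
  have h1 : iteratedDeriv j f s - iteratedDeriv j g s =
      iteratedDeriv j f (Int.fract s) - iteratedDeriv j g (Int.fract s) := by
    have e1 := (periodic_iteratedDeriv hfp j).sub_zsmul_eq ⌊s⌋ (x := s)
    have e2 := (periodic_iteratedDeriv hgp j).sub_zsmul_eq ⌊s⌋ (x := s)
    rw [zsmul_eq_mul, mul_one] at e1 e2
    rw [Int.fract, e1, e2]
  rw [h1]
  have h2 : ‖iteratedDeriv j f (Int.fract s) - iteratedDeriv j g (Int.fract s)‖ ≤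
      ⨆ s : Set.Icc (0:ℝ) 1, ‖iteratedDeriv j f s - iteratedDeriv j g s‖ :=
    le_ciSup (hbdd ⟨j, by omega⟩) ⟨Int.fract s, Int.fract_nonneg s, (Int.fract_lt_one s).le⟩
  refine h2.trans ?_
  exact le_ciSup (f := fun j : Fin (k + 1) => ⨆ s : Set.Icc (0:ℝ) 1,
    ‖iteratedDeriv j f s - iteratedDeriv j g s‖) (Set.finite_range _).bddAbove ⟨j, by omega⟩

lemma exists_shift_of_ckDist_lt {k : ℕ} (hk : k ≤ r) {σ τ : ConvexCurve r} {ε : ℝ}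
    (h : ckDist k σ τ < ε) : ∃ s₀, ∀ j ≤ k, ∀ s,
      ‖iteratedDeriv j (fun s => σ.toFun (s + s₀)) s - iteratedDeriv j τ.toFun s‖ < ε := by
  obtain ⟨s₀, hs⟩ := exists_lt_of_ciInf_lt h
  have hk' : (k : WithTop ℕ∞) ≤ r := by exact_mod_cast hk
  exact ⟨s₀, fun j hj s => lt_of_le_of_lt (norm_iteratedDeriv_sub_le
    ((σ.contDiff_shift s₀).of_le hk') (τ.contDiff.of_le hk') (σ.periodic_shift s₀) τ.periodic hj s) hs⟩

lemma trace_close {k : ℕ} (hk : k ≤ r) {σ τ : ConvexCurve r} {ε : ℝ} (h : ckDist k σ τ < ε) :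
    (∀ z ∈ τ.trace, ∃ w ∈ σ.trace, dist z w ≤ ε) ∧ ∀ w ∈ σ.trace, ∃ z ∈ τ.trace, dist z w ≤ ε := by
  obtain ⟨s₀, hs⟩ := exists_shift_of_ckDist_lt hk h
  have h0 : ∀ s, dist (σ.toFun (s + s₀)) (τ.toFun s) ≤ ε := fun s => by
    have := hs 0 (Nat.zero_le _) s
    rw [iteratedDeriv_zero, iteratedDeriv_zero] at this
    rw [dist_eq_norm]; exact this.le
  constructor
  · rintro _ ⟨s, rfl⟩
    exact ⟨_, ⟨s + s₀, rfl⟩, by rw [dist_comm]; exact h0 s⟩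
  · rintro _ ⟨s, rfl⟩
    refine ⟨_, ⟨s - s₀, rfl⟩, ?_⟩
    have := h0 (s - s₀)
    rw [sub_add_cancel] at this
    rw [dist_comm]; exact this

lemma ckDist_self (k : ℕ) (σ : ConvexCurve r) : ckDist k σ σ ≤ 0 :=
  (ckDist_le σ σ 0).trans (ckDistFun_le fun j _ s => by simp)

lemma isOpen_setOf_robust {k : ℕ} (hk : k ≤ r) (n : ℕ) (x y : Plane) :
    IsOpen[ckTopology r k] {σ : ConvexCurve r | Robust n σ.trace x y} := by
  intro σ hσ
  obtain ⟨δ, hδ, h⟩ := Robust.stable σ.isCompact_trace.isClosed hσ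
  refine ⟨δ, hδ, fun τ hτ => ?_⟩
  have hc := trace_close hk hτ
  exact h τ.trace x y hc.1 hc.2 (by rw [dist_self]; exact hδ.le) (by rw [dist_self]; exact hδ.le)

lemma isOpen_setOf_notMem_table (hr : 2 ≤ r) {k : ℕ} (hk : k ≤ r) (x : Plane) :
    IsOpen[ckTopology r k] {σ : ConvexCurve r | x ∉ σ.table} := by
  intro σ hσ
  have hcl := (σ.isCompact_table hr).isClosed
  have hne : σ.table.Nonempty := σ.trace_nonempty.mono σ.trace_subset_table
  have hpos := (hcl.notMem_iff_infDist_pos hne).1 hσ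
  refine ⟨Metric.infDist x σ.table / 2, by positivity, fun τ hτ hx => ?_⟩
  have hsub : τ.table ⊆ Metric.cthickening (Metric.infDist x σ.table / 2) σ.table := by
    rw [τ.table_eq hr]
    refine convexHull_min (fun z hz => ?_) ((σ.convex_table hr).cthickening _)
    obtain ⟨w, hw, hd⟩ := (trace_close hk hτ).1 z hz
    exact Metric.mem_cthickening_of_dist_le z w _ _ (σ.trace_subset_table hw) hd
  have h1 := hsub hx
  rw [Metric.cthickening_eq_preimage_infEDist, Set.mem_preimage] at h1
  have h2 := ENNReal.toReal_mono ENNReal.ofReal_ne_top h1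
  rw [ENNReal.toReal_ofReal (by positivity)] at h2
  change Metric.infDist x σ.table ≤ _ at h2
  linarith

lemma interior_table_nonempty (σ : ConvexCurve r) (hr : 2 ≤ r) : (interior σ.table).Nonempty := by
  obtain ⟨a, ha, b, hb, hab⟩ := σ.trace_infinite.nontrivial
  have hm : midpoint ℝ a b ∈ segment ℝ a b := midpoint_mem_segment a b
  have ha' := σ.trace_subset_table ha
  have hb' := σ.trace_subset_table hb
  refine ⟨midpoint ℝ a b, σ.mem_interior_table hr ((σ.convex_table hr).segment_subset ha' hb' hm) ?_⟩
  intro h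
  rcases σ.eq_or_eq_of_mem_segment hr ha' hb' h hm with h1 | h1
  · exact hab ((midpoint_eq_left_iff ℝ).1 h1)
  · exact hab ((midpoint_eq_right_iff ℝ).1 h1)

/-! ### The open dense sets -/

/-- The curves for which some pair in `B` has robust paths in general position, or for which `B` is
not contained in the table. -/
def goodCurves (r n : ℕ) (B : Set (Plane × Plane)) : Set (ConvexCurve r) :=
  {σ | B ⊆ σ.table ×ˢ σ.table → ∃ p ∈ B, p.1 ≠ p.2 ∧ Robust n σ.trace p.1 p.2}

/-- The condition that `B` lies in the table fails on an open set of curves, so the implication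
describes a union of open sets. -/
lemma isOpen_goodCurves (hr : 2 ≤ r) {k : ℕ} (hk : k ≤ r) (n : ℕ) (B : Set (Plane × Plane)) :
    IsOpen[ckTopology r k] (goodCurves r n B) := by
  have heq : goodCurves r n B =
      ((⋃ p ∈ B, {σ : ConvexCurve r | p.1 ∉ σ.table}) ∪ ⋃ p ∈ B, {σ | p.2 ∉ σ.table}) ∪
        ⋃ p ∈ B, ⋃ _ : p.1 ≠ p.2, {σ | Robust n σ.trace p.1 p.2} := by
    ext σ
    simp only [goodCurves, Set.mem_union, Set.mem_iUnion, Set.mem_ofPred_eq, exists_prop]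
    constructor
    · intro h
      by_cases hB : B ⊆ σ.table ×ˢ σ.table
      · exact Or.inr (h hB)
      · obtain ⟨p, hp, hpt⟩ := Set.not_subset.1 hB
        rw [Set.mem_prod, not_and_or] at hpt
        exact Or.inl (hpt.imp (fun h => ⟨p, hp, h⟩) fun h => ⟨p, hp, h⟩)
    · rintro ((⟨p, hp, h⟩ | ⟨p, hp, h⟩) | h) hB
      · exact absurd (hB hp).1 h
      · exact absurd (hB hp).2 h
      · exact h
  rw [heq]
  let _ := ckTopology r k
  refine (IsOpen.union ?_ ?_).union ?_
  · exact isOpen_biUnion fun p _ => isOpen_setOf_notMem_table hr hk p.1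
  · exact isOpen_biUnion fun p _ => isOpen_setOf_notMem_table hr hk p.2
  · exact isOpen_biUnion fun p _ => isOpen_iUnion fun _ => isOpen_setOf_robust hk n p.1 p.2

/-- If `B` is not contained in the table, the curve itself is good. Otherwise `B`, being open,
consists of interior pairs, and the perturbation theorem applies. -/
lemma exists_mem_goodCurves (hr : 2 ≤ r) (n : ℕ) {B : Set (Plane × Plane)} (hB : IsOpen B)
    (hne : B.Nonempty) (σ : ConvexCurve r) {ε : ℝ} (hε : 0 < ε) :
    ∃ τ ∈ goodCurves r n B, ckDist r σ τ < ε := by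
  by_cases hBσ : B ⊆ σ.table ×ˢ σ.table
  · have hsub : B ⊆ σ.interiorPairs := by
      have h1 : B ⊆ interior (σ.table ×ˢ σ.table) := interior_maximal hBσ hB
      rw [interior_prod_eq] at h1
      exact fun p hp => h1 hp
    obtain ⟨x, y, hxy, hne, τ, hτ, hR⟩ := σ.exists_robust_near hr n hsub hB hne hε
    exact ⟨τ, fun _ => ⟨(x, y), hxy, hne, hR⟩, hτ⟩
  · exact ⟨σ, fun h => absurd h hBσ, (ckDist_self r σ).trans_lt hε⟩

/-- Goodness does not depend on the starting point of the parametrization, which the Baire argument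
needs. -/
lemma mem_goodCurves_of_trace_eq {σ τ : ConvexCurve r} (h : σ.trace = τ.trace) {n : ℕ}
    {B : Set (Plane × Plane)} (hσ : σ ∈ goodCurves r n B) : τ ∈ goodCurves r n B := by
  have ht : σ.table = τ.table := by rw [table, table, h]
  simp only [goodCurves, Set.mem_ofPred_eq] at hσ ⊢
  rwa [← h, ← ht]

/-! ### Generic pairs of points for a good curve -/

/-- For each `n` the robust pairs of distinct interior points form an open set by `Robust.stable`.
It is dense because every basic open set of interior pairs contains such a pair. Baire's theorem in
the compact space of pairs finishes the argument. -/
lemma exists_generic_pairs (σ : ConvexCurve r) (hr : 2 ≤ r)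
    (hσ : ∀ n, ∀ B ∈ TopologicalSpace.countableBasis (Plane × Plane), σ ∈ goodCurves r n B) :
    ∃ R : Set (σ.table × σ.table), IsGδ R ∧ Dense R ∧ ∀ p ∈ R,
      ((p.1 : Plane) ∈ interior σ.table ∧ (p.2 : Plane) ∈ interior σ.table ∧ (p.1 : Plane) ≠ p.2) ∧
      ∀ n, Robust n σ.trace p.1 p.2 := by
  have hcomp : CompactSpace σ.table := isCompact_iff_compactSpace.1 (σ.isCompact_table hr)
  let V : ℕ → Set (σ.table × σ.table) := fun n => {p | (p.1 : Plane) ∈ interior σ.table ∧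
    (p.2 : Plane) ∈ interior σ.table ∧ (p.1 : Plane) ≠ p.2 ∧ Robust n σ.trace p.1 p.2}
  have hc1 : Continuous fun p : σ.table × σ.table => (p.1 : Plane) := by fun_prop
  have hc2 : Continuous fun p : σ.table × σ.table => (p.2 : Plane) := by fun_prop
  have hVo : ∀ n, IsOpen (V n) := by
    intro n
    suffices h : IsOpen {p : σ.table × σ.table | Robust n σ.trace p.1 p.2} from
      (isOpen_interior.preimage hc1).inter ((isOpen_interior.preimage hc2).inter
        ((isClosed_eq hc1 hc2).isOpen_compl.inter h))
    rw [isOpen_iff_mem_nhds]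
    intro p hp
    obtain ⟨δ, hδ, h⟩ := Robust.stable σ.isCompact_trace.isClosed hp
    filter_upwards [Metric.ball_mem_nhds p hδ] with q hq
    rw [Metric.mem_ball, Prod.dist_eq, max_lt_iff] at hq
    exact h σ.trace q.1 q.2 (fun z hz => ⟨z, hz, by rw [dist_self]; exact hδ.le⟩)
      (fun z hz => ⟨z, hz, by rw [dist_self]; exact hδ.le⟩) hq.1.le hq.2.le
  have hVd : ∀ n, Dense (V n) := by
    intro n
    rw [dense_iff_inter_open]
    rintro O hO ⟨p, hp⟩
    have hind : Topology.IsInducing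
        (Prod.map Subtype.val Subtype.val : σ.table × σ.table → Plane × Plane) :=
      Topology.IsInducing.subtypeVal.prodMap Topology.IsInducing.subtypeVal
    obtain ⟨W, hW, rfl⟩ := hind.isOpen_iff.1 hO
    -- The interior is dense in the table, a convex set with nonempty interior, so boundary points
    -- cause no trouble.
    have hcl : ((p.1 : Plane), (p.2 : Plane)) ∈ closure (interior σ.table ×ˢ interior σ.table) := by
      rw [closure_prod_eq, (σ.convex_table hr).closure_interior_eq_closure_of_nonempty_interior
        (σ.interior_table_nonempty hr)]
      exact ⟨subset_closure p.1.2, subset_closure p.2.2⟩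
    obtain ⟨z, hzW, hz⟩ := mem_closure_iff.1 hcl W hW hp
    obtain ⟨B, hB, hzB, hBW⟩ := (TopologicalSpace.isBasis_countableBasis (Plane × Plane)).exists_subset_of_mem_open
      (show z ∈ W ∩ (interior σ.table ×ˢ interior σ.table) from ⟨hzW, hz⟩)
      (hW.inter (isOpen_interior.prod isOpen_interior))
    obtain ⟨q, hq, hne, hR⟩ := hσ n B hB fun q hq =>
      ⟨interior_subset (hBW hq).2.1, interior_subset (hBW hq).2.2⟩
    exact ⟨(⟨q.1, interior_subset (hBW hq).2.1⟩, ⟨q.2, interior_subset (hBW hq).2.2⟩),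
      (hBW hq).1, (hBW hq).2.1, (hBW hq).2.2, hne, hR⟩
  refine ⟨⋂ n, V n, IsGδ.iInter_of_isOpen hVo, dense_iInter_of_isOpen hVo hVd, fun p hp => ?_⟩
  have h := Set.mem_iInter.1 hp
  exact ⟨⟨(h 0).1, (h 0).2.1, (h 0).2.2.1⟩, fun n => (h n).2.2.2⟩

end ConvexCurve

end

open scoped BoundedContinuousFunction
noncomputable section

namespace ConvexCurve

variable {r : ℕ}

/-! ### The Baire property of the space of curves -/

/-- The curve with another starting point. -/
def shift (τ : ConvexCurve r) (t : ℝ) : ConvexCurve r where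
  toFun s := τ.toFun (s + t)
  contDiff := τ.contDiff_shift t
  periodic := τ.periodic_shift t
  injOn := by
    intro s hs s' hs' h
    obtain ⟨k, hk⟩ := τ.eq_add_int h
    have h1 : s' - s = k := by linarith
    have h2 : |(k : ℝ)| < 1 := by
      rw [abs_lt, ← h1]
      constructor <;> linarith [hs.1, hs.2, hs'.1, hs'.2]
    have h3 : |k| < 1 := by exact_mod_cast h2
    rw [Int.abs_lt_one_iff] at h3
    rw [h3, Int.cast_zero] at h1
    linarith
  const_speed := by
    obtain ⟨c, hc, h⟩ := τ.const_speed
    exact ⟨c, hc, fun s => by rw [deriv_comp_add_const]; exact h _⟩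
  curv_pos s := by
    have h1 : deriv (fun s => τ.toFun (s + t)) = fun s => deriv τ.toFun (s + t) := by
      funext s; rw [deriv_comp_add_const]
    rw [h1, deriv_comp_add_const]
    exact τ.curv_pos _

lemma trace_shift (τ : ConvexCurve r) (t : ℝ) : (τ.shift t).trace = τ.trace := by
  ext z
  constructor
  · rintro ⟨s, rfl⟩; exact ⟨s + t, rfl⟩
  · rintro ⟨s, rfl⟩; exact ⟨s - t, by simp [shift]⟩

lemma exists_jet (r : ℕ) : ∃ J : ConvexCurve r → Fin (r + 1) → ℝ →ᵇ Plane,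
    ∀ σ j s, J σ j s = iteratedDeriv j σ.toFun s := by
  have h : ∀ (σ : ConvexCurve r) (j : Fin (r + 1)), ∃ f : ℝ →ᵇ Plane,
      ∀ s, f s = iteratedDeriv j σ.toFun s := by
    intro σ j
    have hc := σ.contDiff.continuous_iteratedDeriv j (by exact_mod_cast (by omega : j.1 ≤ r))
    obtain ⟨C, hC⟩ := ((periodic_iteratedDeriv σ.periodic j).isBounded_of_continuous
      one_ne_zero hc).exists_norm_le
    exact ⟨BoundedContinuousFunction.ofNormedAddCommGroup _ hc C fun s => hC _ ⟨s, rfl⟩,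
      fun s => rfl⟩
  choose J hJ using h
  exact ⟨J, hJ⟩

/-- The derivatives of periodic `C^r` functions of constant speed. -/
def jetSet (r : ℕ) : Set (Fin (r + 1) → ℝ →ᵇ Plane) :=
  {f | (∀ j : Fin r, ∀ s, HasDerivAt (f j.castSucc) (f j.succ s) s) ∧
    Function.Periodic (f 0) 1 ∧ ∀ j : Fin (r + 1), j.1 = 1 → ∀ s, ‖f j s‖ = ‖f j 0‖}

/-- Uniform limits preserve the relation between a function and its derivative. Simplicity and
positive curvature are not part of `jetSet`, since they do not survive limits. -/
lemma isClosed_jetSet (r : ℕ) : IsClosed (jetSet r) := by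
  refine IsSeqClosed.isClosed fun x f hx hf => ?_
  have hu : ∀ j, TendstoUniformly (fun i s => x i j s) (f j) Filter.atTop := fun j =>
    BoundedContinuousFunction.tendsto_iff_tendstoUniformly.1 (tendsto_pi_nhds.1 hf j)
  have hp : ∀ j s, Filter.Tendsto (fun i => x i j s) Filter.atTop (𝓝 (f j s)) := fun j s =>
    (hu j).tendsto_at s
  refine ⟨fun j s => ?_, fun s => ?_, fun j hj s => ?_⟩
  · exact hasDerivAt_of_tendstoUniformly (f := fun i s => x i j.castSucc s) (hu j.succ)
      (Filter.Eventually.of_forall fun i => (hx i).1 j) (hp _) s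
  · refine tendsto_nhds_unique (hp 0 (s + 1)) ?_
    have : (fun i => x i 0 (s + 1)) = fun i => x i 0 s := funext fun i => (hx i).2.1 s
    rw [this]
    exact hp 0 s
  · refine tendsto_nhds_unique (hp j s).norm ?_
    have : (fun i => ‖x i j s‖) = fun i => ‖x i j 0‖ := funext fun i => (hx i).2.2 j hj s
    rw [this]
    exact (hp j 0).norm

lemma iteratedDeriv_of_mem_jetSet {f : Fin (r + 1) → ℝ →ᵇ Plane} (hf : f ∈ jetSet r) {j : ℕ}
    (hj : j < r + 1) : iteratedDeriv j (f 0) = f ⟨j, hj⟩ := by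
  induction j with
  | zero => rw [iteratedDeriv_zero]; rfl
  | succ j ih =>
    rw [iteratedDeriv_succ, ih (by omega)]
    funext s
    exact (hf.1 ⟨j, by omega⟩ s).deriv

lemma contDiff_of_mem_jetSet {f : Fin (r + 1) → ℝ →ᵇ Plane} (hf : f ∈ jetSet r) :
    ContDiff ℝ r (f 0) := by
  have h := (contDiff_iff_iteratedDeriv (𝕜 := ℝ) (n := r) (f := f 0)).2 ⟨fun m hm => ?_, fun m hm => ?_⟩
  · exact_mod_cast h
  · have hm' : m ≤ r := by exact_mod_cast hm
    rw [iteratedDeriv_of_mem_jetSet hf (by omega)]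
    exact (f _).continuous
  · have hm' : m < r := by exact_mod_cast hm
    rw [iteratedDeriv_of_mem_jetSet hf (by omega)]
    exact fun s => (hf.1 ⟨m, hm'⟩ s).differentiableAt

lemma jet_mem_jetSet {J : ConvexCurve r → Fin (r + 1) → ℝ →ᵇ Plane}
    (hJ : ∀ σ j s, J σ j s = iteratedDeriv j σ.toFun s) (σ : ConvexCurve r) : J σ ∈ jetSet r := by
  have hfun : ∀ j, (J σ j : ℝ → Plane) = iteratedDeriv j σ.toFun := fun j => funext (hJ σ j)
  refine ⟨fun j s => ?_, ?_, fun j hj s => ?_⟩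
  · rw [hfun, hJ]
    have h1 : (j.1 : WithTop ℕ∞) < r := by exact_mod_cast j.2
    have h2 := (σ.contDiff.differentiable_iteratedDeriv j.1 h1 s).hasDerivAt
    rw [← iteratedDeriv_succ] at h2
    exact h2
  · rw [hfun]; exact periodic_iteratedDeriv σ.periodic _
  · obtain ⟨c, -, hc⟩ := σ.const_speed
    rw [hJ, hJ, hj, iteratedDeriv_one, hc, hc]

/-- The convex curves form an open subset of the space of jets. -/
lemma isOpen_range_jet (hr : 2 ≤ r) {J : ConvexCurve r → Fin (r + 1) → ℝ →ᵇ Plane}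
    (hJ : ∀ σ j s, J σ j s = iteratedDeriv j σ.toFun s) :
    IsOpen (Set.range fun σ => (⟨J σ, jet_mem_jetSet hJ σ⟩ : jetSet r)) := by
  rw [Metric.isOpen_iff]
  rintro _ ⟨σ, rfl⟩
  obtain ⟨ε, hε, h⟩ := σ.exists_stability hr
  refine ⟨ε, hε, ?_⟩
  rintro ⟨f, hf⟩ hfε
  have hd : ∀ j s, ‖f j s - J σ j s‖ < ε := by
    intro j s
    rw [← dist_eq_norm]
    exact ((BoundedContinuousFunction.dist_coe_le_dist s).trans (dist_le_pi_dist f (J σ) j)).trans_lt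
      hfε
  have hC := contDiff_of_mem_jetSet hf
  have e1 : deriv (f 0) = f ⟨1, by omega⟩ := by
    rw [← iteratedDeriv_of_mem_jetSet hf (j := 1) (by omega), iteratedDeriv_one]
  have e2 : deriv (deriv (f 0)) = f ⟨2, by omega⟩ := by
    rw [← iteratedDeriv_of_mem_jetSet hf (j := 2) (by omega), iteratedDeriv_succ, iteratedDeriv_one]
  obtain ⟨h1, h2⟩ := h (f 0) (hC.of_le (by exact_mod_cast hr)) hf.2.1
    (fun s => by
      have := hd 0 s
      rw [hJ, Fin.val_zero, iteratedDeriv_zero] at this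
      exact this)
    (fun s => by
      have := hd ⟨1, by omega⟩ s
      rw [hJ, iteratedDeriv_one] at this
      rw [e1]; exact this)
    (fun s => by
      have := hd ⟨2, by omega⟩ s
      rw [hJ, iteratedDeriv_succ, iteratedDeriv_one] at this
      rw [e2]; exact this)
  let τ : ConvexCurve r :=
    { toFun := f 0
      contDiff := hC
      periodic := hf.2.1
      injOn := h1
      const_speed := by
        -- `jetSet` allows speed zero; here the strict curvature inequality excludes it.
        refine ⟨‖f ⟨1, by omega⟩ 0‖, norm_pos_iff.2 fun h0 => ?_, fun s => ?_⟩
        · have h3 := h2 0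
          rw [e1, h0] at h3
          have h4 : rot90 0 = 0 := by
            rw [← norm_eq_zero, norm_rot90, norm_zero]
          rw [h4, inner_zero_right] at h3
          exact lt_irrefl _ h3
        · rw [e1]; exact hf.2.2 _ rfl s
      curv_pos := h2 }
  refine ⟨τ, Subtype.ext ?_⟩
  funext j
  refine BoundedContinuousFunction.ext fun s => ?_
  dsimp only
  rw [hJ]
  exact congrFun (iteratedDeriv_of_mem_jetSet hf j.2) s

/-- Baire's theorem is applied to the finer topology of parametrized curves, whose jets form an open
subset of a closed set in a Banach space. Density in the finer topology implies density in the
coarser one. Conversely, closeness in `ckDist` becomes closeness of jets after a shift of the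
parameter, under which the sets `U i` are invariant. -/
theorem dense_iInter_of_isOpen (hr : 2 ≤ r) {U : ℕ → Set (ConvexCurve r)}
    (hopen : ∀ i, IsOpen[ckTopology r r] (U i))
    (hinv : ∀ i σ τ, σ.trace = τ.trace → σ ∈ U i → τ ∈ U i)
    (hd : ∀ i σ, ∀ ε > 0, ∃ τ ∈ U i, ckDist r σ τ < ε) :
    @Dense _ (ckTopology r r) (⋂ i, U i) := by
  obtain ⟨J, hJ⟩ := exists_jet r
  let Ψ : ConvexCurve r → jetSet r := fun σ => ⟨J σ, jet_mem_jetSet hJ σ⟩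
  let T : TopologicalSpace (ConvexCurve r) := TopologicalSpace.induced Ψ inferInstance
  have hdist : ∀ σ τ j s, ‖iteratedDeriv j σ.toFun s - iteratedDeriv j τ.toFun s‖ ≤ dist (Ψ τ) (Ψ σ)
      ∨ r < j := by
    intro σ τ j s
    by_cases hj : r < j
    · exact Or.inr hj
    · left
      have h1 := (BoundedContinuousFunction.dist_coe_le_dist s).trans
        (dist_le_pi_dist (J σ) (J τ) ⟨j, by omega⟩)
      rw [hJ, hJ, dist_eq_norm, dist_comm] at h1
      exact h1
  have hfine : ∀ O, IsOpen[ckTopology r r] O → IsOpen O := by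
    intro O hO
    rw [isOpen_iff_mem_nhds]
    intro σ hσ
    obtain ⟨ε, hε, h⟩ := hO σ hσ
    rw [nhds_induced]
    refine ⟨Metric.ball (Ψ σ) ε, Metric.ball_mem_nhds _ hε, fun τ hτ => h τ ?_⟩
    refine ((ckDist_le σ τ 0).trans (ckDistFun_le (ε := dist (Ψ τ) (Ψ σ)) fun j hj s => ?_)).trans_lt hτ
    simp only [add_zero]
    exact (hdist σ τ j s).resolve_right (by omega)
  have hemb : Topology.IsOpenEmbedding Ψ := by
    refine ⟨⟨⟨rfl⟩, fun σ τ h => ?_⟩, isOpen_range_jet hr hJ⟩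
    have h1 : σ.toFun = τ.toFun := by
      funext s
      have h2 : J σ 0 s = J τ 0 s := by rw [show J σ = J τ from congrArg Subtype.val h]
      rw [hJ, hJ] at h2
      simpa using h2
    cases σ; cases τ; cases h1; rfl
  have : CompleteSpace (jetSet r) := (isClosed_jetSet r).completeSpace_coe
  have hB : BaireSpace (ConvexCurve r) := hemb.baireSpace
  have hUd : ∀ i, Dense (U i) := by
    intro i σ
    rw [mem_closure_iff_nhds]
    intro N hN
    rw [nhds_induced] at hN
    obtain ⟨W, hW, hWN⟩ := hN
    obtain ⟨ε, hε, hWε⟩ := Metric.mem_nhds_iff.1 hW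
    obtain ⟨τ, hτ, hστ⟩ := hd i σ (ε / 2) (by positivity)
    obtain ⟨s₀, hs⟩ := exists_shift_of_ckDist_lt le_rfl hστ
    -- The infimum in `ckDist` shifts `σ`; to stay near `σ` itself, `τ` is shifted the other way.
    refine ⟨τ.shift (-s₀), hWN (hWε ?_), hinv i τ _ (τ.trace_shift _).symm hτ⟩
    refine lt_of_le_of_lt ?_ (half_lt_self hε)
    refine (dist_pi_le_iff (by positivity)).2 fun j => ?_
    refine (BoundedContinuousFunction.dist_le (by positivity)).2 fun s => ?_
    have h1 := hs j (by omega) (s - s₀)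
    have h2 : iteratedDeriv j (fun s => σ.toFun (s + s₀)) (s - s₀) = iteratedDeriv j σ.toFun s := by
      rw [iteratedDeriv_comp_add_const]; simp
    have h3 : iteratedDeriv j (τ.shift (-s₀)).toFun s = iteratedDeriv j τ.toFun (s - s₀) := by
      change iteratedDeriv j (fun s => τ.toFun (s + -s₀)) s = _
      rw [iteratedDeriv_comp_add_const]; rfl
    rw [h2, ← h3, norm_sub_rev, ← dist_eq_norm] at h1
    change dist (J _ j s) (J _ j s) ≤ _
    rw [hJ, hJ]
    exact h1.le
  have hdense : Dense (⋂ i, U i) := _root_.dense_iInter_of_isOpen (fun i => hfine _ (hopen i)) hUd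
  refine (@dense_iff_inter_open _ (ckTopology r r) _).2 fun O hO hne => ?_
  exact hdense.inter_open_nonempty O (hfine O hO) hne

end ConvexCurve

/-- The sets `goodCurves r n B`, for all `n` and all `B` in a countable basis, are enumerated in one
sequence. They are open in both the `C²` and the `C^r` topology, and each inherits density from the
intersection. -/
theorem mainTheorem1 (r : ℕ) (hr : 2 ≤ r) :
    ∃ A : Set (ConvexCurve r),
      @IsGδ _ (ckTopology r r) A ∧ @Dense _ (ckTopology r r) A ∧
      (∃ U : ℕ → Set (ConvexCurve r),
        (∀ i, IsOpen[ckTopology r 2] (U i) ∧ @Dense _ (ckTopology r r) (U i)) ∧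
        A = ⋂ i, U i) ∧
      ∀ σ ∈ A, ∃ R : Set (σ.table × σ.table), IsGδ R ∧ Dense R ∧
        ∀ p ∈ R,
          ((p.1 : Plane) ∈ interior σ.table ∧ (p.2 : Plane) ∈ interior σ.table ∧
            (p.1 : Plane) ≠ p.2) ∧
          (∀ n : ℕ, ∃ γ : Fin n → BilliardPath σ p.1 p.2,
            Function.Injective γ ∧ InGeneralPosition γ) ∧
          Insecure σ p.1 p.2 := by
  let 𝓑 := TopologicalSpace.countableBasis (Plane × Plane)
  have : Countable 𝓑 := (TopologicalSpace.countable_countableBasis (Plane × Plane)).to_subtype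
  have : Nonempty 𝓑 := by
    obtain ⟨B, hB, -⟩ := (TopologicalSpace.isBasis_countableBasis (Plane × Plane)).exists_subset_of_mem_open
      (Set.mem_univ (0 : Plane × Plane)) isOpen_univ
    exact ⟨⟨B, hB⟩⟩
  obtain ⟨f, hf⟩ := exists_surjective_nat (ℕ × 𝓑)
  let U : ℕ → Set (ConvexCurve r) := fun i => ConvexCurve.goodCurves r (f i).1 (f i).2
  have hopen : ∀ k ≤ r, ∀ i, IsOpen[ckTopology r k] (U i) := fun k hk i =>
    ConvexCurve.isOpen_goodCurves hr hk _ _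
  have hinv : ∀ i σ τ, σ.trace = τ.trace → σ ∈ U i → τ ∈ U i := fun i σ τ h =>
    ConvexCurve.mem_goodCurves_of_trace_eq h
  have hd : ∀ i σ, ∀ ε > 0, ∃ τ ∈ U i, ckDist r σ τ < ε := fun i σ ε hε =>
    ConvexCurve.exists_mem_goodCurves hr _ (TopologicalSpace.isOpen_of_mem_countableBasis (f i).2.2)
      (TopologicalSpace.nonempty_of_mem_countableBasis (f i).2.2) σ hε
  have hdense : @Dense _ (ckTopology r r) (⋂ i, U i) :=
    ConvexCurve.dense_iInter_of_isOpen hr (hopen r le_rfl) hinv hd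
  refine ⟨⋂ i, U i, ?_, hdense, ⟨U, fun i => ⟨hopen 2 hr i, ?_⟩, rfl⟩, fun σ hσ => ?_⟩
  · let _ := ckTopology r r
    exact IsGδ.iInter_of_isOpen (hopen r le_rfl)
  · let _ := ckTopology r r
    exact hdense.mono (Set.iInter_subset U i)
  · have hgood : ∀ n, ∀ B ∈ TopologicalSpace.countableBasis (Plane × Plane),
        σ ∈ ConvexCurve.goodCurves r n B := by
      intro n B hB
      obtain ⟨i, hi⟩ := hf (n, ⟨B, hB⟩)
      have := Set.mem_iInter.1 hσ i
      simp only [U, hi] at this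
      exact this
    obtain ⟨R, hR, hRd, h⟩ := σ.exists_generic_pairs hr hgood
    refine ⟨R, hR, hRd, fun p hp => ?_⟩
    obtain ⟨h1, h2⟩ := h p hp
    have h3 : ∀ n : ℕ, ∃ γ : Fin n → BilliardPath σ p.1 p.2,
        Function.Injective γ ∧ InGeneralPosition γ :=
      fun n => σ.exists_generalPosition_of_robust hr h1.1 h1.2.1 (h2 n)
    exact ⟨h1, h3, ConvexCurve.insecure_of_generalPosition h3⟩

end
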